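/- Let $N_4$ be the closed non-orientable surface of genus $4$ (the connected sum of four projective planes). A triangulation of $N_4$ is a two-dimensional simplicial complex $\Delta$ whose underlying space $|\Delta|$ is homeomorphic to $N_4$; triangulations are counted up to combinatorial isomorphism. A polyhedral realization of $\Delta$ is given by an assignment $\psi\colon V(\Delta)\to\mathbb R^3$ of coordinates to the vertices whose induced simplexwise linear map $\phi_\psi\colon|\Delta|\to\mathbb R^3$ is locally injective (an immersion). A geometric symmetry of it is an isometry of $\mathbb R^3$ that maps $\phi_\psi(|\Delta|)$ onto itself and is induced by an automorphism of $\Delta$. At least $112$ pairwise non-isomorphic triangulations of $N_4$ with $10$ vertices possess a polyhedral realization in $\mathbb R^3$, with integer vertex coordinates, that has a $2$-fold rotation (a rotation by the angle $\pi$ about a line) as a geometric symmetry. -/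

import Mathlib

noncomputable section

/-- The generating identifications on the closed unit disc, regarded as a polygon with `2 * h`
sides on its boundary circle, for the boundary word `a₁ a₁ a₂ a₂ ⋯ a_h a_h`: for each `k < h`, the
sides number `2 * k` and `2 * k + 1` (both run counterclockwise) are glued. -/
def crosscapGluing (h : ℕ) (z w : Metric.closedBall (0 : ℂ) 1) : Prop :=
  ∃ k : ℕ, k < h ∧ ∃ t : ℝ, 0 ≤ t ∧ t ≤ 1 ∧
    (z : ℂ) = Complex.exp (((Real.pi * (2 * k + t) / h : ℝ) : ℂ) * Complex.I) ∧
    (w : ℂ) = Complex.exp (((Real.pi * (2 * k + 1 + t) / h : ℝ) : ℂ) * Complex.I)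

/-- The closed non-orientable surface `N_h` of genus `h ≥ 1`, i.e. the connected sum of `h`
projective planes: the quotient of the disc by the equivalence relation generated by
`crosscapGluing h`, with the quotient topology. -/
abbrev NonorientableSurface (h : ℕ) : Type := Quot (crosscapGluing h)

/-- Euclidean 3-space. -/
abbrev Space3 : Type := EuclideanSpace ℝ (Fin 3)

section Complexes

variable {V : Type} [Fintype V]

open Classical in
/-- The underlying space `|K|` of a finite abstract simplicial complex: the points are the
barycentric coordinate vectors whose support is a face. -/
def geomRealization (K : AbstractSimplicialComplex V) : Set (V → ℝ) :=
  {x | x ∈ stdSimplex ℝ V ∧ Finset.univ.filter (fun v => x v ≠ 0) ∈ K}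

/-- `K` is a triangulation of the space `S`: a two-dimensional simplicial complex whose underlying
space is homeomorphic to `S`. All elements of `V` are vertices of `K`. -/
def IsTriangulationOf (K : AbstractSimplicialComplex V) (S : Type) [TopologicalSpace S] : Prop :=
  (∀ s ∈ K, s.card ≤ 3) ∧ (∃ s ∈ K, s.card = 3) ∧ Nonempty (geomRealization K ≃ₜ S)

/-- The bijection `σ` of the vertices is an isomorphism from `K` to `L`. -/
def IsComplexIso (K L : AbstractSimplicialComplex V) (σ : Equiv.Perm V) : Prop :=
  ∀ s : Finset V, s ∈ K ↔ s.map σ.toEmbedding ∈ L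

/-- `K` and `L` are combinatorially isomorphic. -/
def Isomorphic (K L : AbstractSimplicialComplex V) : Prop :=
  ∃ σ : Equiv.Perm V, IsComplexIso K L σ

/-- The simplexwise linear map induced by an assignment `ψ` of coordinates to the vertices,
in barycentric coordinates. -/
def simplexwiseLinear (ψ : V → Space3) (x : V → ℝ) : Space3 :=
  ∑ v, x v • ψ v

/-- `ψ` induces a polyhedral realization of a triangulated non-orientable surface, i.e. a
simplexwise linear immersion: the induced map `|K| → ℝ³` is locally injective. -/
def IsPolyhedralImmersion (K : AbstractSimplicialComplex V) (ψ : V → Space3) : Prop :=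
  ∀ x : geomRealization K, ∃ U ∈ nhds x,
    Set.InjOn (fun y : geomRealization K => simplexwiseLinear ψ y) U

/-- The isometry `R` of space is a geometric symmetry of the realization of `K` induced by `ψ`:
it preserves the image of `|K|` and is induced by an automorphism `σ` of `K`, whose simplicial
self-map of `|K|` is `x ↦ x ∘ σ⁻¹`. -/
def IsGeometricSymmetry (K : AbstractSimplicialComplex V) (ψ : V → Space3)
    (R : Space3 ≃ᵃⁱ[ℝ] Space3) : Prop :=
  R '' (simplexwiseLinear ψ '' geomRealization K) = simplexwiseLinear ψ '' geomRealization K ∧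
  ∃ σ : Equiv.Perm V, IsComplexIso K K σ ∧
    ∀ x ∈ geomRealization K, R (simplexwiseLinear ψ x) = simplexwiseLinear ψ (x ∘ σ.symm)

end Complexes

/-- `R` is a 2-fold rotation: the rotation by the angle `π` about the line through `p` with unit
direction vector `u`. It keeps the component of `x - p` along `u` and negates the component
orthogonal to `u`. -/
def IsTwofoldRotation (R : Space3 ≃ᵃⁱ[ℝ] Space3) : Prop :=
  ∃ p u : Space3, ‖u‖ = 1 ∧
    ∀ x : Space3, R x = p + inner ℝ u (x - p) • u - ((x - p) - inner ℝ u (x - p) • u)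

end

/-! The proof gives explicit data for the triangulations and reduces every required property to a
finite computation with integers, evaluated by the kernel.

Topology. Subdivide each side of the octagon into three edges and insert a ring of 24 vertices and a
centre. After the sides are glued this is a simplicial complex on 34 vertices. An explicit map in
polar coordinates is a continuous bijection from the glued disc, which is compact, to the
realization of this complex, which is Hausdorff, hence a homeomorphism
(`nonempty_homeomorph_octagonFacets`). A bistellar move preserves the realization up to
homeomorphism by an explicit formula (`BistellarHalf.nonempty_homeomorph`), so the classification of
surfaces is not used. Recorded edge flips and removals of vertices of degree three lead from the 34
vertices to one triangulation `baseFacets` on ten vertices, and further flips lead from there to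
every triangulation of the list.

Immersion. The open stars of the vertices cover the realization, so injectivity on each of them
suffices. Seen from `v`, the star is a union of cones over the edges of the link. Injectivity
follows if every cone is nondegenerate and any two cones meet only in their common face, and signs
of determinants of integer vectors certify this (`injOn_of_linkOk`).

Symmetry. The rotation is the one about the third axis, `(x, y, z) ↦ (-x, -y, z)`. An involution of
the vertices that preserves the facets and matches the coordinates induces it. The immersion test is
then needed for only one vertex of each orbit.

Non-isomorphism. `colourInvariant 3` is a numerical isomorphism invariant. The list is ordered so
that its values strictly increase. -/

/-! ### Bistellar moves as homeomorphisms of realizations. -/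

section BistellarMoves

variable {V : Type}

/-- The points of the standard simplex on `V` that are supported on a member of `T`: the underlying
space of the simplicial complex whose facets are the members of `T`. -/
def facetSpace [Fintype V] (T : Set (Set V)) : Set (V → ℝ) :=
  {x | x ∈ stdSimplex ℝ V ∧ ∃ t ∈ T, ∀ v, x v ≠ 0 → v ∈ t}

variable [DecidableEq V]

/-- One direction of a bistellar move: the facets of `T` containing `A` lie in the join of `A` with
the boundary of `B`, which is replaced by the join of the boundary of `A` with `B`. -/
structure BistellarHalf (A B : Finset V) (T T' : Set (Set V)) : Prop where
  left_nonempty : A.Nonempty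
  disjoint : Disjoint A B
  contain : ∀ t ∈ T, (A : Set V) ⊆ t → ∃ b ∈ B, t ⊆ ↑(A ∪ B) \ {b}
  avoid : ∀ t ∈ T, ¬ (B : Set V) ⊆ t
  keep : ∀ t ∈ T, ¬ (A : Set V) ⊆ t → t ∈ T'
  insert : ∀ a ∈ A, (↑(A ∪ B) : Set V) \ {a} ∈ T'

/-- The map underlying a bistellar move, in barycentric coordinates. -/
noncomputable def bistellarMap (A B : Finset V) (hA : A.Nonempty) (x : V → ℝ) (v : V) : ℝ :=
  x v - (if v ∈ A then A.inf' hA x else 0) +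
    (if v ∈ B then A.inf' hA x * (A.card / B.card) else 0)

theorem continuous_bistellarMap (A B : Finset V) (hA : A.Nonempty) :
    Continuous (bistellarMap A B hA) := by
  have h : Continuous fun x : V → ℝ => A.inf' hA x :=
    Continuous.finset_inf'_apply hA fun i _ => continuous_apply i
  refine continuous_pi fun v => ?_
  unfold bistellarMap
  refine ((continuous_apply v).sub ?_).add ?_
  · split_ifs
    · exact h
    · exact continuous_const
  · split_ifs
    · exact h.mul continuous_const
    · exact continuous_const

namespace BistellarHalf

variable {A B : Finset V} {T T' : Set (Set V)}

theorem notMem_right (h : BistellarHalf A B T T') {v : V} (hv : v ∈ A) : v ∉ B :=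
  Finset.disjoint_left.1 h.disjoint hv

variable [Fintype V]

/-- If the minimum over `A` does not vanish, the point lies in one of the replaced facets. -/
theorem exists_of_inf_ne_zero (h : BistellarHalf A B T T') {x : V → ℝ} (hx : x ∈ facetSpace T)
    (h0 : A.inf' h.left_nonempty x ≠ 0) :
    ∃ b ∈ B, ∀ v, x v ≠ 0 → v ∈ A ∪ B ∧ v ≠ b := by
  obtain ⟨⟨hpos, -⟩, t, ht, hxt⟩ := hx
  have hA : (A : Set V) ⊆ t := by
    intro a ha
    refine hxt a fun hxa => h0 (le_antisymm ?_ ?_)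
    · exact hxa ▸ Finset.inf'_le x ha
    · exact (Finset.le_inf'_iff _ _).2 fun i _ => hpos i
  obtain ⟨b, hb, htb⟩ := h.contain t ht hA
  exact ⟨b, hb, fun v hv => htb (hxt v hv)⟩

/-- By `avoid`, some vertex of `B` lies outside the facet carrying `x`, so its coordinate vanishes.
The reversibility of the move rests on this. -/
theorem inf_right_eq_zero (h : BistellarHalf A B T T') {x : V → ℝ} (hx : x ∈ facetSpace T)
    (hB : B.Nonempty) : B.inf' hB x = 0 := by
  obtain ⟨⟨hpos, -⟩, t, ht, hxt⟩ := hx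
  obtain ⟨b, hb, hbt⟩ := Set.not_subset.1 (h.avoid t ht)
  have hxb : x b = 0 := by
    by_contra hne
    exact hbt (hxt b hne)
  exact le_antisymm (hxb ▸ Finset.inf'_le x hb) ((Finset.le_inf'_iff _ _).2 fun i _ => hpos i)

/-- Subtracting the minimum over `A` kills the coordinate at a minimizing vertex `a`, which puts the
image into the new facet `(A ∪ B) \ {a}`. The factor `A.card / B.card` preserves the sum of the
coordinates. Where the minimum is 0 the map is the identity, and the point lies in a kept facet or
again in `(A ∪ B) \ {a}`. -/
theorem mapsTo (h : BistellarHalf A B T T') (hB : B.Nonempty) :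
    Set.MapsTo (bistellarMap A B h.left_nonempty) (facetSpace T) (facetSpace T') := by
  intro x hx
  obtain ⟨⟨hpos, hsum⟩, t, ht, hxt⟩ := id hx
  obtain ⟨a, ha, hxa⟩ := A.exists_mem_eq_inf' h.left_nonempty x
  set m := A.inf' h.left_nonempty x with hm
  have hm0 : 0 ≤ m := (Finset.le_inf'_iff _ _).2 fun i _ => hpos i
  have hcard : (B.card : ℝ) ≠ 0 := by exact_mod_cast hB.card_pos.ne'
  have hval : ∀ v, bistellarMap A B h.left_nonempty x v =
      x v - (if v ∈ A then m else 0) + (if v ∈ B then m * (A.card / B.card) else 0) := fun v => rfl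
  refine ⟨⟨fun v => ?_, ?_⟩, ?_⟩
  · rw [hval]
    have h1 : 0 ≤ x v - (if v ∈ A then m else 0) := by
      split_ifs with hv
      · exact sub_nonneg.2 (Finset.inf'_le x hv)
      · simpa using hpos v
    have h2 : 0 ≤ (if v ∈ B then m * ((A.card : ℝ) / B.card) else 0) := by
      split_ifs <;> positivity
    exact add_nonneg h1 h2
  · simp only [hval, Finset.sum_add_distrib, Finset.sum_sub_distrib, hsum, Finset.sum_ite_mem,
      Finset.univ_inter, Finset.sum_const, nsmul_eq_mul]
    field_simp
    ring
  · have haB := h.notMem_right ha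
    by_cases h0 : m = 0
    · have hxy : ∀ v, bistellarMap A B h.left_nonempty x v = x v := fun v => by
        rw [hval]; simp [h0]
      simp only [hxy]
      by_cases hAt : (A : Set V) ⊆ t
      · obtain ⟨b, hb, htb⟩ := h.contain t ht hAt
        refine ⟨_, h.insert a ha, fun v hv => ⟨(htb (hxt v hv)).1, ?_⟩⟩
        rintro rfl
        exact hv (hxa.symm.trans h0)
      · exact ⟨t, h.keep t ht hAt, hxt⟩
    · obtain ⟨b, hb, hsupp⟩ := h.exists_of_inf_ne_zero hx h0
      refine ⟨_, h.insert a ha, fun v hv => ⟨?_, ?_⟩⟩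
      · by_contra hvn
        have hvn' : v ∉ A ∪ B := hvn
        have hxv : x v = 0 := by
          by_contra hne
          exact hvn' (hsupp v hne).1
        rw [Finset.notMem_union] at hvn'
        exact hv (by rw [hval]; simp [hvn'.1, hvn'.2, hxv])
      · rintro rfl
        exact hv (by rw [hval]; simp [ha, haB, ← hxa])

/-- Since the minimum over `B` was 0, after the move it equals exactly the amount added there. The
reverse map reads off this amount and undoes both changes. -/
theorem leftInverse (h : BistellarHalf A B T T') (hB : B.Nonempty) {x : V → ℝ}
    (hx : x ∈ facetSpace T) :
    bistellarMap B A hB (bistellarMap A B h.left_nonempty x) = x := by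
  set m := A.inf' h.left_nonempty x with hm
  set y := bistellarMap A B h.left_nonempty x with hy
  have hcA : (A.card : ℝ) ≠ 0 := by exact_mod_cast h.left_nonempty.card_pos.ne'
  have hcB : (B.card : ℝ) ≠ 0 := by exact_mod_cast hB.card_pos.ne'
  have hval : ∀ v, y v =
      x v - (if v ∈ A then m else 0) + (if v ∈ B then m * (A.card / B.card) else 0) := fun v => rfl
  have hyB : B.inf' hB y = m * (A.card / B.card) := by
    have hyb : ∀ b ∈ B, y b = x b + m * (A.card / B.card) := fun b hb => by
      rw [hval]
      simp [hb, Finset.disjoint_right.1 h.disjoint hb]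
    obtain ⟨b, hb, hxb⟩ := B.exists_mem_eq_inf' hB x
    rw [h.inf_right_eq_zero hx hB] at hxb
    refine le_antisymm ?_ ((Finset.le_inf'_iff _ _).2 fun i hi => ?_)
    · calc B.inf' hB y ≤ y b := Finset.inf'_le y hb
        _ = _ := by rw [hyb b hb, ← hxb, zero_add]
    · rw [hyb i hi]
      linarith [hx.1.1 i]
  funext v
  have : bistellarMap B A hB y v = y v - (if v ∈ B then B.inf' hB y else 0) +
    (if v ∈ A then B.inf' hB y * (B.card / A.card) else 0) := rfl
  rw [this, hval, hyB]
  by_cases hvA : v ∈ A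
  · have := h.notMem_right hvA
    simp only [hvA, this, if_true, if_false]
    field_simp
    ring
  · by_cases hvB : v ∈ B <;> simp [hvA, hvB]

/-- A bistellar move does not change the homeomorphism type. -/
theorem nonempty_homeomorph (h : BistellarHalf A B T T') (h' : BistellarHalf B A T' T) :
    Nonempty (facetSpace T ≃ₜ facetSpace T') :=
  ⟨{ toFun := fun x => ⟨_, h.mapsTo h'.left_nonempty x.2⟩
     invFun := fun y => ⟨_, h'.mapsTo h.left_nonempty y.2⟩
     left_inv := fun x => Subtype.ext (h.leftInverse h'.left_nonempty x.2)
     right_inv := fun y => Subtype.ext (h'.leftInverse h.left_nonempty y.2)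
     continuous_toFun := ((continuous_bistellarMap A B _).comp continuous_subtype_val).subtype_mk _
     continuous_invFun :=
      ((continuous_bistellarMap B A _).comp continuous_subtype_val).subtype_mk _ }⟩

end BistellarHalf

end BistellarMoves

/-! ### Complexes generated by facets, and their realizations. -/

section Facets

variable {V W : Type}

/-- The simplicial complex generated by a covering family of vertex sets. -/
def facetComplex (T : Set (Set V)) (h : ∀ v, ∃ t ∈ T, v ∈ t) : AbstractSimplicialComplex V where
  faces := {s | s.Nonempty ∧ ∃ t ∈ T, (s : Set V) ⊆ t}
  isRelLowerSet_faces := fun _ hs =>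
    ⟨hs.1, fun _ hu hne => ⟨hne, hs.2.imp fun _ ht =>
      ⟨ht.1, (Finset.coe_subset.2 hu).trans ht.2⟩⟩⟩
  singleton_mem := fun v => ⟨Finset.singleton_nonempty v, (h v).imp fun t ht =>
    ⟨ht.1, by simpa using ht.2⟩⟩

theorem mem_facetComplex {T : Set (Set V)} {h : ∀ v, ∃ t ∈ T, v ∈ t} {s : Finset V} :
    s ∈ facetComplex T h ↔ s.Nonempty ∧ ∃ t ∈ T, (s : Set V) ⊆ t := Iff.rfl

variable [Fintype V] [Fintype W]

theorem geomRealization_facetComplex (T : Set (Set V)) (h : ∀ v, ∃ t ∈ T, v ∈ t) :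
    geomRealization (facetComplex T h) = facetSpace T := by
  classical
  ext x
  refine and_congr_right fun hx => ?_
  rw [mem_facetComplex]
  constructor
  · rintro ⟨-, t, ht, hs⟩
    exact ⟨t, ht, fun v hv => hs (by simpa using hv)⟩
  · rintro ⟨t, ht, hs⟩
    refine ⟨?_, t, ht, fun v hv => hs v (by simpa using hv)⟩
    -- An empty support is impossible because the coordinates sum to 1.
    by_contra hne
    rw [Finset.not_nonempty_iff_eq_empty, Finset.filter_eq_empty_iff] at hne
    have h0 : ∑ v, x v = 0 := Finset.sum_eq_zero fun v hv => not_not.1 (hne hv)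
    exact zero_ne_one (h0.symm.trans hx.2)

/-- Vertices outside all facets can be dropped. -/
theorem facetSpace_restrict {e : V → W} (he : Function.Injective e) (T : Set (Set W))
    (hT : ∀ t ∈ T, t ⊆ Set.range e) :
    Nonempty (facetSpace T ≃ₜ facetSpace ((e ⁻¹' ·) '' T)) := by
  -- The homeomorphism restricts coordinates along `e`. Its inverse is extension by zero, because
  -- coordinates outside the range of `e` vanish.
  have hout : ∀ y ∈ facetSpace T, ∀ w ∉ Set.range e, y w = 0 := by
    rintro y ⟨-, t, ht, hy⟩ w hw
    by_contra hne
    exact hw (hT t ht (hy w hne))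
  have hto : ∀ y ∈ facetSpace T, y ∘ e ∈ facetSpace ((e ⁻¹' ·) '' T) := by
    rintro y hy
    obtain ⟨⟨hpos, hsum⟩, t, ht, hyt⟩ := id hy
    refine ⟨⟨fun v => hpos _, ?_⟩, _, ⟨t, ht, rfl⟩, fun v hv => hyt _ hv⟩
    rw [← hsum]
    exact Fintype.sum_of_injective e he _ _ (hout y hy) fun _ => rfl
  have hinv : ∀ x ∈ facetSpace ((e ⁻¹' ·) '' T), Function.extend e x 0 ∈ facetSpace T := by
    rintro x ⟨⟨hpos, hsum⟩, _, ⟨t, ht, rfl⟩, hxt⟩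
    refine ⟨⟨fun w => ?_, ?_⟩, t, ht, fun w hw => ?_⟩
    · by_cases hw : w ∈ Set.range e
      · obtain ⟨v, rfl⟩ := hw
        rw [he.extend_apply]
        exact hpos v
      · rw [Function.extend_apply' _ _ _ hw]
        rfl
    · rw [← hsum]
      refine (Fintype.sum_of_injective e he _ _ (fun w hw => ?_) fun v => ?_).symm
      · rw [Function.extend_apply' _ _ _ hw]
        rfl
      · rw [he.extend_apply]
    · by_cases hr : w ∈ Set.range e
      · obtain ⟨v, rfl⟩ := hr
        rw [he.extend_apply] at hw
        exact hxt v hw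
      · rw [Function.extend_apply' _ _ _ hr] at hw
        exact absurd rfl hw
  refine ⟨{ toFun := fun y => ⟨_, hto y y.2⟩
            invFun := fun x => ⟨_, hinv x x.2⟩
            left_inv := fun y => Subtype.ext ?_
            right_inv := fun x => Subtype.ext (funext fun v => he.extend_apply _ _ _)
            continuous_toFun := Continuous.subtype_mk
              (f := fun y : facetSpace T => (y : W → ℝ) ∘ e) (continuous_pi fun v =>
                (continuous_apply (e v)).comp continuous_subtype_val) _
            continuous_invFun := Continuous.subtype_mk (continuous_pi fun w => ?_) _ }⟩
  · funext w
    by_cases hw : w ∈ Set.range e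
    · obtain ⟨v, rfl⟩ := hw
      exact he.extend_apply _ _ _
    · exact (Function.extend_apply' _ _ _ hw).trans (hout y y.2 w hw).symm
  · by_cases hw : w ∈ Set.range e
    · obtain ⟨v, rfl⟩ := hw
      simp only [he.extend_apply]
      exact (continuous_apply v).comp continuous_subtype_val
    · simp only [Function.extend_apply' _ _ _ hw]
      exact continuous_const

end Facets

/-! ### Computable bistellar moves on bit masks. -/

section Masks

/-- The vertex set given by the binary digits of `m`. -/
def maskFinset (n m : ℕ) : Finset (Fin n) := Finset.univ.filter fun v => m.testBit v

/-- A family of vertex sets given by bit masks. -/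
def maskFacets (n : ℕ) (L : List ℕ) : Set (Set (Fin n)) := {t | ∃ m ∈ L, t = maskFinset n m}

/-- The positions below `n` of the nonzero binary digits of `m`. -/
def maskList (n m : ℕ) : List ℕ := (List.range n).filter m.testBit

@[simp] theorem mem_maskFinset {n m : ℕ} {v : Fin n} : v ∈ maskFinset n m ↔ m.testBit v := by
  simp [maskFinset]

theorem mem_maskList {n m i : ℕ} : i ∈ maskList n m ↔ i < n ∧ m.testBit i := by
  simp [maskList]

theorem maskFinset_lor (n a b : ℕ) : maskFinset n (a ||| b) = maskFinset n a ∪ maskFinset n b := by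
  ext v
  simp

/-- The bound serves the direction from left to right: digits of `a` beyond `n` are invisible to
`maskFinset`. -/
theorem maskFinset_subset_iff {n a m : ℕ} (ha : a < 2 ^ n) :
    maskFinset n a ⊆ maskFinset n m ↔ m &&& a = a := by
  constructor
  · intro h
    refine Nat.eq_of_testBit_eq fun i => ?_
    by_cases hi : i < n
    · have := @h ⟨i, hi⟩
      simp only [mem_maskFinset] at this
      rw [Nat.testBit_and]
      cases h1 : a.testBit i <;> simp_all
    · rw [Nat.testBit_and, Nat.testBit_lt_two_pow (ha.trans_le (Nat.pow_le_pow_right two_pos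
        (not_lt.1 hi))), Bool.and_false]
  · intro h v hv
    rw [mem_maskFinset] at hv ⊢
    rw [← h, Nat.testBit_and] at hv
    exact (Bool.and_eq_true_iff.1 hv).1

theorem maskFinset_xor_two_pow {n a i : ℕ} (hi : i < n) (ha : a.testBit i) :
    (maskFinset n (a ^^^ 2 ^ i) : Set (Fin n)) = ↑(maskFinset n a) \ {⟨i, hi⟩} := by
  ext v
  simp only [Finset.mem_coe, mem_maskFinset, Set.mem_sdiff, Set.mem_singleton_iff,
    Nat.testBit_xor, Nat.testBit_two_pow, Fin.ext_iff]
  by_cases h : i = v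
  · subst h
    simp [ha]
  · simp [h, Ne.symm h]

/-- The vertices opposite to the face `A`. -/
def coMask (A : ℕ) (L : List ℕ) : ℕ :=
  -- If some facet contains `A`, so does the union, and `^^^` removes `A` from it. Otherwise the
  -- result is `A` itself, which `bistellarOk` rejects.
  (L.filter fun m => (m &&& A) == A).foldl (· ||| ·) 0 ^^^ A

/-- The facets after the bistellar move replacing `A` by `B`. -/
def bistellarMove (n A B : ℕ) (L : List ℕ) : List ℕ :=
  (maskList n A).map (fun a => (A ||| B) ^^^ 2 ^ a) ++ L.filter fun m => !((m &&& A) == A)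

/-- Whether the move replacing `A` by `B` is admissible. -/
def bistellarOk (n A B : ℕ) (L : List ℕ) : Bool :=
  A.blt (2 ^ n) && B.blt (2 ^ n) && !(A == 0) && !(B == 0) && (A &&& B) == 0 &&
  L.all (fun m => !((m &&& B) == B) && (!((m &&& A) == A) || (m ||| (A ||| B)) == (A ||| B))) &&
  (maskList n B).all fun b => L.elem ((A ||| B) ^^^ 2 ^ b)

/-- Whether the sequence `As` of bistellar moves leads from `L` to `L'`. -/
def movesTo (n : ℕ) : List ℕ → List ℕ → List ℕ → Bool
  | [], L, L' => L.all (fun m => L'.elem m) && L'.all fun m => L.elem m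
  | A :: As, L, L' =>
    bistellarOk n A (coMask A L) L && movesTo n As (bistellarMove n A (coMask A L) L) L'

theorem maskFinset_nonempty {n A : ℕ} (hA : A < 2 ^ n) (h0 : A ≠ 0) :
    (maskFinset n A).Nonempty := by
  by_contra h
  rw [Finset.not_nonempty_iff_eq_empty] at h
  apply h0
  have := (maskFinset_subset_iff (m := 0) hA).1 (by simp [h])
  simpa using this.symm

/-- The move and its inverse are verified as two instances of `BistellarHalf`. For the inverse, the
facets containing `B` are exactly the inserted ones, because `B` was contained in no old facet. -/
theorem nonempty_homeomorph_bistellarMove {n A B : ℕ} {L : List ℕ} (h : bistellarOk n A B L) :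
    Nonempty (facetSpace (maskFacets n L) ≃ₜ
      facetSpace (maskFacets n (bistellarMove n A B L))) := by
  simp only [bistellarOk, Bool.and_eq_true, Nat.blt_eq, Bool.not_eq_true', beq_eq_false_iff_ne,
    beq_iff_eq, List.all_eq_true, List.elem_eq_mem, decide_eq_true_eq, Bool.or_eq_true] at h
  obtain ⟨⟨⟨⟨⟨⟨hAn, hBn⟩, hA0⟩, hB0⟩, hAB⟩, hL⟩, hins⟩ := h
  have hdisj : Disjoint (maskFinset n A) (maskFinset n B) := by
    rw [Finset.disjoint_left]
    intro v hv hv'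
    have := congrArg (fun m => m.testBit v) hAB
    rw [mem_maskFinset] at hv hv'
    simp [hv, hv'] at this
  have hsubA : ∀ {m}, (↑(maskFinset n A) : Set (Fin n)) ⊆ ↑(maskFinset n m) ↔ m &&& A = A :=
    fun {m} => by rw [Finset.coe_subset, maskFinset_subset_iff hAn]
  have hsubB : ∀ {m}, (↑(maskFinset n B) : Set (Fin n)) ⊆ ↑(maskFinset n m) ↔ m &&& B = B :=
    fun {m} => by rw [Finset.coe_subset, maskFinset_subset_iff hBn]
  have hnew : ∀ a ∈ maskFinset n A, (↑(maskFinset n A ∪ maskFinset n B) : Set (Fin n)) \ {a} =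
      maskFinset n ((A ||| B) ^^^ 2 ^ (a : ℕ)) := by
    intro a ha
    rw [maskFinset_xor_two_pow a.2 (by simp_all), maskFinset_lor]
  have hold : ∀ b ∈ maskFinset n B, (↑(maskFinset n A ∪ maskFinset n B) : Set (Fin n)) \ {b} =
      maskFinset n ((A ||| B) ^^^ 2 ^ (b : ℕ)) := by
    intro b hb
    rw [maskFinset_xor_two_pow b.2 (by simp_all), maskFinset_lor]
  have hmem : ∀ {t}, t ∈ maskFacets n (bistellarMove n A B L) →
      (∃ a ∈ maskFinset n A, t = ↑(maskFinset n A ∪ maskFinset n B) \ {a}) ∨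
      ∃ m ∈ L, ¬ m &&& A = A ∧ t = maskFinset n m := by
    rintro t ⟨m, hm, rfl⟩
    simp only [bistellarMove, List.mem_append, List.mem_map, mem_maskList, List.mem_filter] at hm
    obtain ⟨a, ⟨han, haA⟩, rfl⟩ | ⟨hm, hmA⟩ := hm
    · exact Or.inl ⟨⟨a, han⟩, by simpa using haA, (hnew ⟨a, han⟩ (by simpa using haA)).symm⟩
    · exact Or.inr ⟨m, hm, by simpa using hmA, rfl⟩
  have key : BistellarHalf (maskFinset n A) (maskFinset n B) (maskFacets n L)
      (maskFacets n (bistellarMove n A B L)) := by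
    refine ⟨maskFinset_nonempty hAn hA0, hdisj, ?_, ?_, ?_, ?_⟩
    · rintro _ ⟨m, hm, rfl⟩ hAm
      have h1 := (hL m hm).1
      rw [ne_eq, ← hsubB] at h1
      obtain ⟨b, hb, hbm⟩ := Set.not_subset.1 h1
      refine ⟨b, hb, fun v hv => ⟨?_, fun hvb => hbm (hvb ▸ hv)⟩⟩
      have h2 := (hL m hm).2.resolve_left fun h => h (hsubA.1 hAm)
      rw [← maskFinset_lor, ← h2, Finset.mem_coe, maskFinset_lor]
      exact Finset.mem_union_left _ hv
    · rintro _ ⟨m, hm, rfl⟩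
      rw [hsubB]
      exact (hL m hm).1
    · rintro _ ⟨m, hm, rfl⟩ hAm
      rw [hsubA] at hAm
      refine ⟨m, ?_, rfl⟩
      simp [bistellarMove, hm, hAm]
    · intro a ha
      refine ⟨_, ?_, hnew a ha⟩
      refine List.mem_append_left _ (List.mem_map.2 ⟨a, ?_, rfl⟩)
      exact mem_maskList.2 ⟨a.2, by simpa using ha⟩
  have key' : BistellarHalf (maskFinset n B) (maskFinset n A)
      (maskFacets n (bistellarMove n A B L)) (maskFacets n L) := by
    refine ⟨maskFinset_nonempty hBn hB0, hdisj.symm, ?_, ?_, ?_, ?_⟩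
    · intro t ht hBt
      obtain ⟨a, ha, rfl⟩ | ⟨m, hm, -, rfl⟩ := hmem ht
      · exact ⟨a, ha, by rw [Finset.union_comm]⟩
      · exact absurd (hsubB.1 hBt) (hL m hm).1
    · intro t ht hAt
      obtain ⟨a, ha, rfl⟩ | ⟨m, hm, hmA, rfl⟩ := hmem ht
      · exact (hAt ha).2 rfl
      · exact hmA (hsubA.1 hAt)
    · intro t ht hBt
      obtain ⟨a, ha, rfl⟩ | ⟨m, hm, -, rfl⟩ := hmem ht
      · refine absurd (fun v hv => ⟨Finset.mem_union_right _ hv, ?_⟩) hBt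
        rintro rfl
        exact Finset.disjoint_left.1 hdisj ha hv
      · exact ⟨m, hm, rfl⟩
    · intro b hb
      rw [Finset.union_comm, hold b hb]
      exact ⟨_, hins b (mem_maskList.2 ⟨b.2, by simpa using hb⟩), rfl⟩
  exact key.nonempty_homeomorph key'

theorem nonempty_homeomorph_of_movesTo {n : ℕ} {As L L' : List ℕ} (h : movesTo n As L L') :
    Nonempty (facetSpace (maskFacets n L) ≃ₜ facetSpace (maskFacets n L')) := by
  induction As generalizing L with
  | nil =>
    simp only [movesTo, Bool.and_eq_true, List.all_eq_true, List.elem_eq_mem,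
      decide_eq_true_eq] at h
    have : maskFacets n L = maskFacets n L' := Set.ext fun t =>
      ⟨fun ⟨m, hm, ht⟩ => ⟨m, h.1 m hm, ht⟩, fun ⟨m, hm, ht⟩ => ⟨m, h.2 m hm, ht⟩⟩
    rw [this]
    exact ⟨Homeomorph.refl _⟩
  | cons A As ih =>
    rw [movesTo, Bool.and_eq_true] at h
    obtain ⟨e⟩ := nonempty_homeomorph_bistellarMove h.1
    obtain ⟨e'⟩ := ih h.2
    exact ⟨e.trans e'⟩

/-- Unused vertices can be dropped. -/
theorem nonempty_homeomorph_maskFacets_of_le {k n : ℕ} (hkn : k ≤ n) {L : List ℕ}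
    (h : L.all fun m => m.blt (2 ^ k)) :
    Nonempty (facetSpace (maskFacets n L) ≃ₜ facetSpace (maskFacets k L)) := by
  simp only [List.all_eq_true, Nat.blt_eq] at h
  have himg : ((Fin.castLE hkn) ⁻¹' ·) '' maskFacets n L = maskFacets k L := by
    ext t
    constructor
    · rintro ⟨_, ⟨m, hm, rfl⟩, rfl⟩
      exact ⟨m, hm, by ext v; simp⟩
    · rintro ⟨m, hm, rfl⟩
      exact ⟨_, ⟨m, hm, rfl⟩, by ext v; simp⟩
  rw [← himg]
  refine facetSpace_restrict (Fin.castLE_injective hkn) _ ?_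
  rintro _ ⟨m, hm, rfl⟩ v hv
  have hv' : m.testBit v = true := by simpa using hv
  have hvk : (v : ℕ) < k := by
    by_contra hle
    rw [Nat.testBit_lt_two_pow ((h m hm).trans_le (Nat.pow_le_pow_right two_pos
      (not_lt.1 hle)))] at hv'
    cases hv'
  exact ⟨⟨v, hvk⟩, rfl⟩

end Masks

/-! ### Sign criteria for the intersection of two plane cones in space. -/

section LinearAlgebra

/-- The cross product of integer vectors. -/
def cross3 (a b : ℤ × ℤ × ℤ) : ℤ × ℤ × ℤ :=
  (a.2.1 * b.2.2 - a.2.2 * b.2.1, a.2.2 * b.1 - a.1 * b.2.2, a.1 * b.2.1 - a.2.1 * b.1)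

/-- The dot product of integer vectors. -/
def dot3 (a b : ℤ × ℤ × ℤ) : ℤ := a.1 * b.1 + (a.2.1 * b.2.1 + a.2.2 * b.2.2)

/-- Whether an integer is negative. -/
def isNeg : ℤ → Bool
  | Int.ofNat _ => false
  | Int.negSucc _ => true

theorem isNeg_eq_true {x : ℤ} : isNeg x = true ↔ x < 0 := by
  cases x with
  | ofNat n => simp [isNeg]
  | negSucc n => simp [isNeg, Int.negSucc_lt_zero]

/-- The determinants describing the linear dependency between `a`, `b`, `-c`, `-d`. -/
def dependency (a b c d : ℤ × ℤ × ℤ) : List ℤ :=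
  [dot3 b (cross3 c d), dot3 a (cross3 d c), dot3 d (cross3 b a), dot3 c (cross3 a b)]

/-- A sufficient condition for the cones over `a, b` and over `c, d` to meet only in the apex. -/
def conesDisjoint (a b c d : ℤ × ℤ × ℤ) : Bool :=
  (dependency a b c d).any isNeg && (dependency a b c d).any fun x => isNeg (-x)

/-- A sufficient condition for the cones over `a, b` and over `a, d` to meet only in the common
ray. -/
def conesAdjacent (a b d : ℤ × ℤ × ℤ) : Bool :=
  !(dot3 d (cross3 a b) == 0) || isNeg (dot3 (cross3 a b) (cross3 a d))

/-- If `μ` were nonzero, `l` would be a real multiple of it and could not take both signs. The proof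
compares `i` with an index where `l` has the sign opposite to `l i`; for `l i = 0` the negative one
serves. -/
theorem eq_zero_of_proportional {ι : Type} {μ l : ι → ℝ} (hμ : ∀ i, 0 ≤ μ i)
    (h : ∀ i j, μ i * l j = μ j * l i) (hneg : ∃ i, l i < 0) (hpos : ∃ i, 0 < l i) (i : ι) :
    μ i = 0 := by
  by_contra hne
  have hi : 0 < μ i := lt_of_le_of_ne (hμ i) (Ne.symm hne)
  obtain ⟨j, hj⟩ := hneg
  obtain ⟨k, hk⟩ := hpos
  have h1 : 0 ≤ μ j * (l i) ^ 2 := mul_nonneg (hμ j) (sq_nonneg _)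
  rcases lt_trichotomy (l i) 0 with h0 | h0 | h0
  · nlinarith [h i k, hμ k, mul_pos hi hk, mul_nonneg (hμ k) (neg_nonneg.2 h0.le)]
  · have := h i j
    rw [h0, mul_zero] at this
    exact (mul_neg_of_pos_of_neg hi hj).ne this
  · nlinarith [h i j, mul_neg_of_pos_of_neg hi hj, mul_nonneg (hμ j) h0.le]

/-- The relation `α a + β b = γ c + δ d` between integer vectors with real coefficients. -/
def LinRel (α β γ δ : ℝ) (a b c d : ℤ × ℤ × ℤ) : Prop :=
  α * a.1 + β * b.1 = γ * c.1 + δ * d.1 ∧ α * a.2.1 + β * b.2.1 = γ * c.2.1 + δ * d.2.1 ∧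
    α * a.2.2 + β * b.2.2 = γ * c.2.2 + δ * d.2.2

theorem LinRel.swap_left {α β γ δ : ℝ} {a b c d : ℤ × ℤ × ℤ} (h : LinRel α β γ δ a b c d) :
    LinRel β α γ δ b a c d := by
  obtain ⟨h1, h2, h3⟩ := h
  exact ⟨by linarith, by linarith, by linarith⟩

theorem LinRel.swap_right {α β γ δ : ℝ} {a b c d : ℤ × ℤ × ℤ} (h : LinRel α β γ δ a b c d) :
    LinRel α β δ γ a b d c := by
  obtain ⟨h1, h2, h3⟩ := h
  exact ⟨by linarith, by linarith, by linarith⟩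

/-- By Cramer's rule the coefficients of any relation are proportional to the determinants in
`dependency`; if these take both signs, no nontrivial relation has nonnegative coefficients. To
compare two coefficients, the relation is paired with the cross product of the other two vectors,
which eliminates their coefficients. -/
theorem eq_zero_of_conesDisjoint {α β γ δ : ℝ} {a b c d : ℤ × ℤ × ℤ} (hα : 0 ≤ α) (hβ : 0 ≤ β)
    (hγ : 0 ≤ γ) (hδ : 0 ≤ δ) (h : LinRel α β γ δ a b c d) (hc : conesDisjoint a b c d) :
    α = 0 ∧ β = 0 ∧ γ = 0 ∧ δ = 0 := by
  let μ : Fin 4 → ℝ := ![α, β, γ, δ]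
  let l : Fin 4 → ℝ := ![dot3 b (cross3 c d), dot3 a (cross3 d c), dot3 d (cross3 b a),
    dot3 c (cross3 a b)]
  have hμ : ∀ i, 0 ≤ μ i := by
    intro i
    fin_cases i <;> assumption
  have hprop : ∀ i j, μ i * l j = μ j * l i := by
    obtain ⟨a1, a2, a3⟩ := a
    obtain ⟨b1, b2, b3⟩ := b
    obtain ⟨c1, c2, c3⟩ := c
    obtain ⟨d1, d2, d3⟩ := d
    obtain ⟨h1, h2, h3⟩ := h
    have key : ∀ i j, i < j → μ i * l j = μ j * l i := by
      intro i j hij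
      fin_cases i <;> fin_cases j <;> first | exact absurd hij (by decide) | skip
      all_goals simp [μ, l, dot3, cross3] at h1 h2 h3 ⊢
      · linear_combination (d2 * c3 - d3 * c2 : ℝ) * h1 + (d3 * c1 - d1 * c3 : ℝ) * h2 +
          (d1 * c2 - d2 * c1 : ℝ) * h3
      · linear_combination (d2 * b3 - d3 * b2 : ℝ) * h1 + (d3 * b1 - d1 * b3 : ℝ) * h2 +
          (d1 * b2 - d2 * b1 : ℝ) * h3
      · linear_combination (b2 * c3 - b3 * c2 : ℝ) * h1 + (b3 * c1 - b1 * c3 : ℝ) * h2 +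
          (b1 * c2 - b2 * c1 : ℝ) * h3
      · linear_combination (a2 * d3 - a3 * d2 : ℝ) * h1 + (a3 * d1 - a1 * d3 : ℝ) * h2 +
          (a1 * d2 - a2 * d1 : ℝ) * h3
      · linear_combination (c2 * a3 - c3 * a2 : ℝ) * h1 + (c3 * a1 - c1 * a3 : ℝ) * h2 +
          (c1 * a2 - c2 * a1 : ℝ) * h3
      · linear_combination (b2 * a3 - b3 * a2 : ℝ) * h1 + (b3 * a1 - b1 * a3 : ℝ) * h2 +
          (b1 * a2 - b2 * a1 : ℝ) * h3
    intro i j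
    rcases lt_trichotomy i j with hij | rfl | hij
    · exact key i j hij
    · rfl
    · exact (key j i hij).symm
  have hl : ∀ x ∈ dependency a b c d, ∃ i, l i = x := by
    intro x hx
    simp only [dependency, List.mem_cons, List.not_mem_nil, or_false] at hx
    rcases hx with rfl | rfl | rfl | rfl
    exacts [⟨0, rfl⟩, ⟨1, rfl⟩, ⟨2, rfl⟩, ⟨3, rfl⟩]
  simp only [conesDisjoint, Bool.and_eq_true, List.any_eq_true, isNeg_eq_true] at hc
  obtain ⟨⟨x, hx, hx0⟩, y, hy, hy0⟩ := hc
  obtain ⟨i, hi⟩ := hl x hx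
  obtain ⟨j, hj⟩ := hl y hy
  have hzero := eq_zero_of_proportional hμ hprop ⟨i, by rw [hi]; exact_mod_cast hx0⟩
    ⟨j, by rw [hj]; exact_mod_cast neg_lt_zero.1 hy0⟩
  exact ⟨hzero 0, hzero 1, hzero 2, hzero 3⟩

/-- If the determinant is nonzero, the three vectors are independent. In the other case, the cross
product of the relation with `a` reads `β (a × b) = δ (a × d)`; when `a × b` and `a × d` have
negative inner product, nonnegative `β` and `δ` must vanish. For coplanar vectors this says that `b`
and `d` lie on opposite sides of the line of `a`. Either condition excludes `a = 0`, whence `α = γ`.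
-/
theorem eq_of_conesAdjacent {α β γ δ : ℝ} {a b d : ℤ × ℤ × ℤ} (hβ : 0 ≤ β) (hδ : 0 ≤ δ)
    (h : LinRel α β γ δ a b a d) (hc : conesAdjacent a b d) : α = γ ∧ β = 0 ∧ δ = 0 := by
  obtain ⟨a1, a2, a3⟩ := a
  obtain ⟨b1, b2, b3⟩ := b
  obtain ⟨d1, d2, d3⟩ := d
  obtain ⟨h1, h2, h3⟩ := h
  simp only [conesAdjacent, Bool.or_eq_true, Bool.not_eq_true', beq_eq_false_iff_ne,
    isNeg_eq_true] at hc
  simp only [dot3, cross3] at hc h1 h2 h3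
  have hb : β = 0 ∧ δ = 0 := by
    rcases hc with hc | hc
    · have hc' : (d1 * (a2 * b3 - a3 * b2) + (d2 * (a3 * b1 - a1 * b3) +
        d3 * (a1 * b2 - a2 * b1)) : ℝ) ≠ 0 := by exact_mod_cast hc
      constructor
      · refine (mul_eq_zero.1 ?_).resolve_right hc'
        linear_combination (d2 * a3 - d3 * a2 : ℝ) * h1 + (d3 * a1 - d1 * a3 : ℝ) * h2 +
          (d1 * a2 - d2 * a1 : ℝ) * h3
      · refine (mul_eq_zero.1 ?_).resolve_right hc'
        linear_combination -(a2 * b3 - a3 * b2 : ℝ) * h1 - (a3 * b1 - a1 * b3 : ℝ) * h2 -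
          (a1 * b2 - a2 * b1 : ℝ) * h3
    · have hc' : ((a2 * b3 - a3 * b2) * (a2 * d3 - a3 * d2) +
        ((a3 * b1 - a1 * b3) * (a3 * d1 - a1 * d3) +
        (a1 * b2 - a2 * b1) * (a1 * d2 - a2 * d1)) : ℝ) < 0 := by exact_mod_cast hc
      have e1 : β * (a2 * b3 - a3 * b2) = δ * (a2 * d3 - a3 * d2) := by
        linear_combination (a2 : ℝ) * h3 - (a3 : ℝ) * h2
      have e2 : β * (a3 * b1 - a1 * b3) = δ * (a3 * d1 - a1 * d3) := by
        linear_combination (a3 : ℝ) * h1 - (a1 : ℝ) * h3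
      have e3 : β * (a1 * b2 - a2 * b1) = δ * (a1 * d2 - a2 * d1) := by
        linear_combination (a1 : ℝ) * h2 - (a2 : ℝ) * h1
      generalize (a2 * b3 - a3 * b2 : ℝ) = p1 at *
      generalize (a3 * b1 - a1 * b3 : ℝ) = p2 at *
      generalize (a1 * b2 - a2 * b1 : ℝ) = p3 at *
      generalize (a2 * d3 - a3 * d2 : ℝ) = q1 at *
      generalize (a3 * d1 - a1 * d3 : ℝ) = q2 at *
      generalize (a1 * d2 - a2 * d1 : ℝ) = q3 at *
      have f1 : β * (p1 * q1 + (p2 * q2 + p3 * q3)) = δ * (q1 ^ 2 + q2 ^ 2 + q3 ^ 2) := by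
        linear_combination q1 * e1 + q2 * e2 + q3 * e3
      have f2 : δ * (p1 * q1 + (p2 * q2 + p3 * q3)) = β * (p1 ^ 2 + p2 ^ 2 + p3 ^ 2) := by
        linear_combination -p1 * e1 - p2 * e2 - p3 * e3
      constructor
      · by_contra hne
        have : 0 < β := lt_of_le_of_ne hβ (Ne.symm hne)
        have h4 := mul_neg_of_pos_of_neg this hc'
        have h5 : 0 ≤ δ * (q1 ^ 2 + q2 ^ 2 + q3 ^ 2) := by positivity
        linarith
      · by_contra hne
        have : 0 < δ := lt_of_le_of_ne hδ (Ne.symm hne)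
        have h4 := mul_neg_of_pos_of_neg this hc'
        have h5 : 0 ≤ β * (p1 ^ 2 + p2 ^ 2 + p3 ^ 2) := by positivity
        linarith
  obtain ⟨rfl, rfl⟩ := hb
  refine ⟨?_, rfl, rfl⟩
  by_contra hne
  have hne' : α - γ ≠ 0 := sub_ne_zero.2 hne
  have g1 : (a1 : ℝ) = 0 :=
    (mul_eq_zero.1 (by linear_combination h1 : (α - γ) * a1 = 0)).resolve_left hne'
  have g2 : (a2 : ℝ) = 0 :=
    (mul_eq_zero.1 (by linear_combination h2 : (α - γ) * a2 = 0)).resolve_left hne'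
  have g3 : (a3 : ℝ) = 0 :=
    (mul_eq_zero.1 (by linear_combination h3 : (α - γ) * a3 = 0)).resolve_left hne'
  rw [Int.cast_eq_zero] at g1 g2 g3
  subst g1 g2 g3
  simp at hc

/-- Every component of `a × b` is annihilated by both `α - γ` and `β - δ`. -/
theorem eq_of_cross3_ne_zero {α β γ δ : ℝ} {a b : ℤ × ℤ × ℤ} (h : LinRel α β γ δ a b a b)
    (hc : cross3 a b ≠ 0) : α = γ ∧ β = δ := by
  obtain ⟨a1, a2, a3⟩ := a
  obtain ⟨b1, b2, b3⟩ := b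
  obtain ⟨h1, h2, h3⟩ := h
  by_contra hne
  apply hc
  have key : ∀ x : ℤ, (α - γ) * x = 0 → (β - δ) * x = 0 → x = 0 := by
    intro x hx hy
    by_contra hx0
    have hx0' : (x : ℝ) ≠ 0 := by exact_mod_cast hx0
    exact hne ⟨sub_eq_zero.1 ((mul_eq_zero.1 hx).resolve_right hx0'),
      sub_eq_zero.1 ((mul_eq_zero.1 hy).resolve_right hx0')⟩
  simp only at h1 h2 h3
  refine Prod.ext (key _ ?_ ?_) (Prod.ext (key _ ?_ ?_) (key _ ?_ ?_)) <;>
    simp only [cross3] <;> push_cast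
  · linear_combination (b3 : ℝ) * h2 - (b2 : ℝ) * h3
  · linear_combination (a2 : ℝ) * h3 - (a3 : ℝ) * h2
  · linear_combination (b1 : ℝ) * h3 - (b3 : ℝ) * h1
  · linear_combination (a3 : ℝ) * h1 - (a1 : ℝ) * h3
  · linear_combination (b2 : ℝ) * h1 - (b1 : ℝ) * h2
  · linear_combination (a1 : ℝ) * h2 - (a2 : ℝ) * h1

end LinearAlgebra

/-! ### Injectivity on open stars from a test on vertex links. -/

section Immersion

/-- The integer vector from `p` to `q`. -/
def sub3 (q p : ℤ × ℤ × ℤ) : ℤ × ℤ × ℤ := (q.1 - p.1, q.2.1 - p.2.1, q.2.2 - p.2.2)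

/-- The point of space with the given integer coordinates. -/
noncomputable def intPoint (p : ℤ × ℤ × ℤ) : Space3 := !₂[(p.1 : ℝ), (p.2.1 : ℝ), (p.2.2 : ℝ)]

/-- Whether the cones over two link edges, with vertices placed at `P`, are compatible. -/
def coneOk (P : ℕ → ℤ × ℤ × ℤ) : List ℕ → List ℕ → Bool
  | [a, b], [c, d] =>
    -- The branches look for a common vertex of the two edges and make it the first argument of
    -- `conesAdjacent`.
    bif a.beq c then conesAdjacent (P a) (P b) (P d)
    else bif b.beq d then conesAdjacent (P b) (P a) (P c)
    else bif a.beq d then conesAdjacent (P a) (P b) (P c)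
    else bif b.beq c then conesAdjacent (P b) (P a) (P d)
    else conesDisjoint (P a) (P b) (P c) (P d)
  | _, _ => false

/-- Whether the cone over a link edge is nondegenerate. -/
def coneNondegenerate (P : ℕ → ℤ × ℤ × ℤ) : List ℕ → Bool
  | [a, b] => !(cross3 (P a) (P b) == (0, 0, 0)) && !(a == b)
  | _ => false

/-- Whether the cones over all link edges are nondegenerate and meet only in common faces. -/
def linkOk (P : ℕ → ℤ × ℤ × ℤ) : List (List ℕ) → Bool
  | [] => true
  | e :: l => coneNondegenerate P e && l.all (coneOk P e) && linkOk P l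

/-- The link of `v`, as a list of edges. -/
def linkEdges (v : ℕ) (F : List (List ℕ)) : List (List ℕ) :=
  (F.filter fun f => f.elem v).map fun f => f.erase v

/-- The combination `α e_a + β e_b` of unit vectors. -/
noncomputable def edgeVec (a b : ℕ) (α β : ℝ) (w : ℕ) : ℝ :=
  (if w = a then α else 0) + if w = b then β else 0

/-- Equality of the vectors `edgeVec` expresses that the point lies in the common face, whatever the
position of a shared vertex in the two lists. -/
theorem edgeVec_eq_of_coneOk {P : ℕ → ℤ × ℤ × ℤ} {a b c d : ℕ} {α β γ δ : ℝ} (hα : 0 ≤ α)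
    (hβ : 0 ≤ β) (hγ : 0 ≤ γ) (hδ : 0 ≤ δ) (h : LinRel α β γ δ (P a) (P b) (P c) (P d))
    (hc : coneOk P [a, b] [c, d]) : edgeVec a b α β = edgeVec c d γ δ := by
  simp only [coneOk, Bool.cond_eq_ite, Nat.beq_eq] at hc
  split_ifs at hc with h1 h2 h3 h4
  · subst h1
    obtain ⟨rfl, rfl, rfl⟩ := eq_of_conesAdjacent hβ hδ h hc
    funext w
    simp [edgeVec]
  · subst h2
    obtain ⟨rfl, rfl, rfl⟩ := eq_of_conesAdjacent hα hγ h.swap_left.swap_right hc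
    funext w
    simp [edgeVec]
  · subst h3
    obtain ⟨rfl, rfl, rfl⟩ := eq_of_conesAdjacent hβ hγ h.swap_right hc
    funext w
    simp [edgeVec]
  · subst h4
    obtain ⟨rfl, rfl, rfl⟩ := eq_of_conesAdjacent hα hδ h.swap_left hc
    funext w
    simp [edgeVec]
  · obtain ⟨rfl, rfl, rfl, rfl⟩ := eq_zero_of_conesDisjoint hα hβ hγ hδ h hc
    funext w
    simp [edgeVec]

theorem coneNondegenerate_of_linkOk {P : ℕ → ℤ × ℤ × ℤ} {l : List (List ℕ)} (h : linkOk P l)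
    {e : List ℕ} (he : e ∈ l) : coneNondegenerate P e := by
  induction l with
  | nil => cases he
  | cons e' l ih =>
    simp only [linkOk, Bool.and_eq_true] at h
    rcases List.mem_cons.1 he with rfl | he
    · exact h.1.1
    · exact ih h.2 he

/-- `linkOk` tests each pair of list entries in one order only, hence the disjunction. -/
theorem coneOk_of_linkOk {P : ℕ → ℤ × ℤ × ℤ} {l : List (List ℕ)} (h : linkOk P l)
    {e f : List ℕ} (he : e ∈ l) (hf : f ∈ l) : e = f ∨ coneOk P e f ∨ coneOk P f e := by
  induction l with
  | nil => cases he
  | cons e' l ih =>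
    simp only [linkOk, Bool.and_eq_true, List.all_eq_true] at h
    rcases List.mem_cons.1 he with rfl | he' <;> rcases List.mem_cons.1 hf with rfl | hf'
    · exact Or.inl rfl
    · exact Or.inr (Or.inl (h.1.2 f hf'))
    · exact Or.inr (Or.inr (h.1.2 e he'))
    · exact ih h.2 he' hf'

/-- Cones over link edges that pass the test meet only in common faces. -/
theorem edgeVec_eq_of_linkOk {P : ℕ → ℤ × ℤ × ℤ} {l : List (List ℕ)} (hl : linkOk P l)
    {a b c d : ℕ} {α β γ δ : ℝ} (hα : 0 ≤ α) (hβ : 0 ≤ β) (hγ : 0 ≤ γ) (hδ : 0 ≤ δ)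
    (he : [a, b] ∈ l) (hf : [c, d] ∈ l) (h : LinRel α β γ δ (P a) (P b) (P c) (P d)) :
    edgeVec a b α β = edgeVec c d γ δ := by
  rcases coneOk_of_linkOk hl he hf with heq | hc | hc
  · simp only [List.cons.injEq, and_true] at heq
    obtain ⟨rfl, rfl⟩ := heq
    have hn := coneNondegenerate_of_linkOk hl he
    simp only [coneNondegenerate, Bool.and_eq_true, Bool.not_eq_true', beq_eq_false_iff_ne] at hn
    obtain ⟨rfl, rfl⟩ := eq_of_cross3_ne_zero h hn.1
    rfl
  · exact edgeVec_eq_of_coneOk hα hβ hγ hδ h hc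
  · refine (edgeVec_eq_of_coneOk hγ hδ hα hβ ?_ hc).symm
    obtain ⟨h1, h2, h3⟩ := h
    exact ⟨h1.symm, h2.symm, h3.symm⟩

variable {n : ℕ}

/-- A point of the open star of `v` lies in a facet through `v`. That the rest of this facet is a
pair comes from `coneNondegenerate`, which rejects lists of any other length. -/
theorem exists_linkEdge {F : List (List ℕ)} {L : List ℕ} (hF : L.map (maskList n) = F)
    {P : ℕ → ℤ × ℤ × ℤ} {v : Fin n} (hok : linkOk P (linkEdges v F)) {y : Fin n → ℝ}
    (hy : y ∈ facetSpace (maskFacets n L)) (hv : y v ≠ 0) :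
    ∃ a b : Fin n, [(a : ℕ), (b : ℕ)] ∈ linkEdges v F ∧ a ≠ b ∧ a ≠ v ∧ b ≠ v ∧
      ∀ w, y w ≠ 0 → w = v ∨ w = a ∨ w = b := by
  obtain ⟨-, _, ⟨m, hm, rfl⟩, hym⟩ := hy
  have hvm : (v : ℕ) ∈ maskList n m := mem_maskList.2 ⟨v.2, by simpa using hym v hv⟩
  have hmem : (maskList n m).erase v ∈ linkEdges v F := by
    refine List.mem_map.2 ⟨maskList n m, List.mem_filter.2 ⟨?_, by simpa using hvm⟩, rfl⟩
    rw [← hF]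
    exact List.mem_map_of_mem hm
  have hnodup : (maskList n m).Nodup := List.Nodup.filter _ List.nodup_range
  have hn := coneNondegenerate_of_linkOk hok hmem
  have hex : ∃ a b, (maskList n m).erase v = [a, b] := by
    revert hn
    generalize (maskList n m).erase v = e
    intro hn
    match e, hn with
    | [a, b], _ => exact ⟨a, b, rfl⟩
  obtain ⟨a, b, hab⟩ := hex
  have hin : ∀ i, i ∈ (maskList n m).erase v ↔ i = a ∨ i = b := fun i => by rw [hab]; simp
  have ha := hnodup.mem_erase_iff.1 ((hin a).2 (Or.inl rfl))
  have hb := hnodup.mem_erase_iff.1 ((hin b).2 (Or.inr rfl))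
  have hne : a ≠ b := by
    have := hnodup.erase (v : ℕ)
    rw [hab] at this
    simpa using this
  refine ⟨⟨a, (mem_maskList.1 ha.2).1⟩, ⟨b, (mem_maskList.1 hb.2).1⟩, hab ▸ hmem, ?_, ?_, ?_, ?_⟩
  · simpa [Fin.ext_iff] using hne
  · simpa [Fin.ext_iff] using ha.1
  · simpa [Fin.ext_iff] using hb.1
  · intro w hw
    by_cases hwv : w = v
    · exact Or.inl hwv
    · refine Or.inr ?_
      have := (hin w).1 (hnodup.mem_erase_iff.2 ⟨by simpa [Fin.ext_iff] using hwv,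
        mem_maskList.2 ⟨w.2, by simpa using hym w hw⟩⟩)
      simpa [Fin.ext_iff] using this

theorem sum_eq_of_support {y : Fin n → ℝ} {v a b : Fin n} (hab : a ≠ b) (hav : a ≠ v)
    (hbv : b ≠ v) (h : ∀ w, y w ≠ 0 → w = v ∨ w = a ∨ w = b) (g : Fin n → ℝ) :
    ∑ w, y w * g w = y v * g v + (y a * g a + y b * g b) := by
  rw [← Finset.sum_subset (Finset.subset_univ {v, a, b})]
  · rw [Finset.sum_insert (by simp [hav.symm, hbv.symm]), Finset.sum_pair hab]
  · intro w _ hw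
    have : y w = 0 := by
      by_contra hne
      exact hw (by simpa using h w hne)
    rw [this, zero_mul]

/-- The coordinates pass to a realization of the complex. -/
noncomputable def listPoint (p : List (ℤ × ℤ × ℤ)) (v : Fin n) : Space3 := intPoint (p.getD v 0)

theorem simplexwiseLinear_apply (ψ : Fin n → Space3) (x : Fin n → ℝ) (i : Fin 3) :
    simplexwiseLinear ψ x i = ∑ w, x w * ψ w i := by
  simp [simplexwiseLinear]

/-- The coordinates sum to 1, so subtracting the position of `v` eliminates the coordinate at `v`
and turns equality of images into a relation between directions from `v` to its link. The cone test
then gives equality of all coordinates off `v`, and the sum gives the one at `v`. -/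
theorem injOn_of_linkOk {p : List (ℤ × ℤ × ℤ)} {F : List (List ℕ)} {L : List ℕ}
    (hF : L.map (maskList n) = F) {v : Fin n}
    (hok : linkOk (fun w => sub3 (p.getD w 0) (p.getD v 0)) (linkEdges v F)) :
    Set.InjOn (simplexwiseLinear (listPoint p)) (facetSpace (maskFacets n L) ∩ {y | y v ≠ 0}) := by
  rintro y ⟨hy, hyv⟩ z ⟨hz, hzv⟩ hyz
  obtain ⟨a, b, he, hab, hav, hbv, hys⟩ := exists_linkEdge hF hok hy hyv
  obtain ⟨c, d, hf, hcd, hcv, hdv, hzs⟩ := exists_linkEdge hF hok hz hzv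
  have hysum := sum_eq_of_support hab hav hbv hys fun _ => 1
  have hzsum := sum_eq_of_support hcd hcv hdv hzs fun _ => 1
  simp only [mul_one, hy.1.2, hz.1.2] at hysum hzsum
  have hcoord : ∀ i, y v * listPoint p v i + (y a * listPoint p a i + y b * listPoint p b i) =
      z v * listPoint p v i + (z c * listPoint p c i + z d * listPoint p d i) := by
    intro i
    rw [← sum_eq_of_support hab hav hbv hys (listPoint p · i),
      ← sum_eq_of_support hcd hcv hdv hzs (listPoint p · i),
      ← simplexwiseLinear_apply, ← simplexwiseLinear_apply, hyz]
  have hrel : LinRel (y a) (y b) (z c) (z d) (sub3 (p.getD a 0) (p.getD v 0))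
      (sub3 (p.getD b 0) (p.getD v 0)) (sub3 (p.getD c 0) (p.getD v 0))
      (sub3 (p.getD d 0) (p.getD v 0)) := by
    have h0 := hcoord 0
    have h1 := hcoord 1
    have h2 := hcoord 2
    simp only [listPoint, intPoint, Matrix.cons_val, PiLp.toLp_apply] at h0 h1 h2
    refine ⟨?_, ?_, ?_⟩ <;> simp only [sub3] <;> push_cast
    · linear_combination h0 + ((p.getD v 0).1 : ℝ) * (hysum - hzsum)
    · linear_combination h1 + ((p.getD v 0).2.1 : ℝ) * (hysum - hzsum)
    · linear_combination h2 + ((p.getD v 0).2.2 : ℝ) * (hysum - hzsum)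
  have key := edgeVec_eq_of_linkOk hok (hy.1.1 a) (hy.1.1 b) (hz.1.1 c) (hz.1.1 d) he hf hrel
  have hoff : ∀ {y : Fin n → ℝ} {a b : Fin n}, a ≠ b →
      (∀ w, y w ≠ 0 → w = v ∨ w = a ∨ w = b) → ∀ w, w ≠ v → y w = edgeVec a b (y a) (y b) w := by
    intro y a b hab hys w hwv
    by_cases hwa : w = a
    · subst hwa
      simp [edgeVec, Fin.val_inj, hab]
    by_cases hwb : w = b
    · subst hwb
      simp [edgeVec, Fin.val_inj, hwa]
    · have : y w = 0 := by
        by_contra hne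
        rcases hys w hne with h | h | h
        exacts [hwv h, hwa h, hwb h]
      simp [edgeVec, Fin.val_inj, hwa, hwb, this]
  have heq : ∀ w, w ≠ v → y w = z w := fun w hw => by
    rw [hoff hab hys w hw, hoff hcd hzs w hw, key]
  funext w
  by_cases hw : w = v
  · subst hw
    have h1 := hy.1.2
    have h2 := hz.1.2
    rw [← Finset.add_sum_erase _ _ (Finset.mem_univ w)] at h1 h2
    rw [Finset.sum_congr rfl fun u hu => heq u (Finset.ne_of_mem_erase hu)] at h1
    linarith
  · exact heq w hw

end Immersion

/-! ### The half-turn and the involution inducing it. -/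

section Symmetry

/-- The rotation by `π` about the third coordinate axis. -/
noncomputable def axisRotation : Space3 ≃ᵃⁱ[ℝ] Space3 :=
  (LinearIsometryEquiv.piLpCongrRight 2 fun i : Fin 3 =>
    if i = 2 then LinearIsometryEquiv.refl ℝ ℝ else LinearIsometryEquiv.neg ℝ).toAffineIsometryEquiv

theorem axisRotation_apply (x : Space3) (i : Fin 3) :
    axisRotation x i = if i = 2 then x i else -x i := by
  have : axisRotation x i =
    (if i = 2 then LinearIsometryEquiv.refl ℝ ℝ else LinearIsometryEquiv.neg ℝ) (x i) := rfl
  rw [this]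
  split_ifs <;> rfl

theorem isTwofoldRotation_axisRotation : IsTwofoldRotation axisRotation := by
  refine ⟨0, EuclideanSpace.single 2 1, by simp, fun x => ?_⟩
  ext i
  rw [axisRotation_apply]
  fin_cases i <;> simp [EuclideanSpace.inner_single_left]

variable {n : ℕ}

theorem axisRotation_simplexwiseLinear (ψ : Fin n → Space3) {σ : Equiv.Perm (Fin n)}
    (hσ : ∀ v, ψ (σ v) = axisRotation (ψ v)) (x : Fin n → ℝ) :
    axisRotation (simplexwiseLinear ψ x) = simplexwiseLinear ψ (x ∘ σ.symm) := by
  ext i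
  rw [axisRotation_apply, simplexwiseLinear_apply, simplexwiseLinear_apply,
    ← Equiv.sum_comp σ fun w => (x ∘ σ.symm) w * ψ w i]
  simp only [Function.comp_apply, Equiv.symm_apply_apply, hσ, axisRotation_apply]
  split_ifs
  · rfl
  · rw [← Finset.sum_neg_distrib]
    exact Finset.sum_congr rfl fun v _ => by ring

/-- The image of a bit mask under a map of the vertices. -/
def mapMask (n : ℕ) (s : List ℕ) (m : ℕ) : ℕ :=
  ((maskList n m).map fun v => 2 ^ s.getD v 0).foldl (· ||| ·) 0

/-- Whether `s` is an involution of the vertices preserving the facets and corresponding to the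
rotation of the coordinates `p`. -/
def symmetryOk (n : ℕ) (s : List ℕ) (p : List (ℤ × ℤ × ℤ)) (L : List ℕ) : Bool :=
  ((List.range n).all fun v => (s.getD v 0).blt n && s.getD (s.getD v 0) 0 == v &&
    p.getD (s.getD v 0) 0 == (-(p.getD v 0).1, -(p.getD v 0).2.1, (p.getD v 0).2.2)) &&
  L.all fun m => L.elem (mapMask n s m)

theorem testBit_foldl_lor (l : List ℕ) (a i : ℕ) :
    (l.foldl (· ||| ·) a).testBit i = (a.testBit i || l.any fun m => m.testBit i) := by
  induction l generalizing a with
  | nil => simp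
  | cons b l ih => simp [ih, Nat.testBit_or, Bool.or_assoc]

/-- An involution is its own inverse, so mapping facets to facets already makes it an automorphism.
-/
theorem exists_perm_of_symmetryOk {s : List ℕ} {p : List (ℤ × ℤ × ℤ)} {L : List ℕ}
    (h : ∀ v, ∃ t ∈ maskFacets n L, v ∈ t) (hok : symmetryOk n s p L) :
    ∃ σ : Equiv.Perm (Fin n), (∀ v, (σ v : ℕ) = s.getD v 0) ∧ σ.symm = σ ∧
      (∀ v, listPoint p (σ v) = axisRotation (listPoint p v)) ∧
      IsComplexIso (facetComplex (maskFacets n L) h) (facetComplex (maskFacets n L) h) σ ∧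
      ∀ x ∈ geomRealization (facetComplex (maskFacets n L) h),
        x ∘ σ.symm ∈ geomRealization (facetComplex (maskFacets n L) h) := by
  simp only [symmetryOk, Bool.and_eq_true, List.all_eq_true, List.mem_range, Nat.blt_eq,
    beq_iff_eq, List.elem_eq_mem, decide_eq_true_eq] at hok
  obtain ⟨hs, hL⟩ := hok
  let f : Fin n → Fin n := fun v => ⟨s.getD v 0, (hs v v.2).1.1⟩
  have hf : Function.Involutive f := fun v => Fin.ext (hs v v.2).1.2
  let σ : Equiv.Perm (Fin n) := hf.toPerm
  have hσ : ∀ v, listPoint p (σ v) = axisRotation (listPoint p v) := by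
    intro v
    have h1 : p.getD (σ v : ℕ) 0 = _ := (hs v v.2).2
    ext i
    rw [axisRotation_apply, listPoint, listPoint, h1]
    fin_cases i <;> simp [intPoint]
  have hsymm : σ.symm = σ := Function.Involutive.toPerm_symm hf
  have hmask : ∀ m ∈ L, maskFinset n (mapMask n s m) = (maskFinset n m).map σ.toEmbedding := by
    intro m hm
    ext v
    rw [Finset.mem_map_equiv, hsymm, mem_maskFinset, mem_maskFinset, mapMask, testBit_foldl_lor]
    simp only [Nat.zero_testBit, Bool.false_or, List.any_eq_true, List.mem_map, mem_maskList]
    constructor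
    · rintro ⟨_, ⟨w, ⟨hwn, hwm⟩, rfl⟩, hw⟩
      rw [Nat.testBit_two_pow, decide_eq_true_eq] at hw
      have : σ v = ⟨w, hwn⟩ := by
        rw [← hf ⟨w, hwn⟩]
        exact congrArg f (Fin.ext hw.symm)
      rw [this]
      exact hwm
    · intro hv
      refine ⟨_, ⟨σ v, ⟨(σ v).2, hv⟩, rfl⟩, ?_⟩
      rw [Nat.testBit_two_pow, decide_eq_true_eq]
      exact (hs v v.2).1.2
  have hmap : ∀ s ∈ facetComplex (maskFacets n L) h,
      s.map σ.toEmbedding ∈ facetComplex (maskFacets n L) h := by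
    rintro s ⟨hne, _, ⟨m, hm, rfl⟩, hsm⟩
    refine ⟨hne.map, _, ⟨_, hL m hm, rfl⟩, ?_⟩
    rw [hmask m hm, Finset.coe_subset]
    exact Finset.map_subset_map.2 (Finset.coe_subset.1 hsm)
  have hiso : IsComplexIso (facetComplex (maskFacets n L) h) (facetComplex (maskFacets n L) h)
      σ := by
    intro s
    refine ⟨hmap s, fun hs => ?_⟩
    have := hmap _ hs
    rw [Finset.map_map] at this
    convert this
    ext v
    simp only [Finset.mem_map, Function.Embedding.trans_apply, Equiv.coe_toEmbedding]
    exact ⟨fun hv => ⟨v, hv, hf v⟩, fun ⟨w, hw, hwv⟩ => (hf w ▸ hwv : w = v) ▸ hw⟩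
  have hreal : ∀ x ∈ geomRealization (facetComplex (maskFacets n L) h),
      x ∘ σ.symm ∈ geomRealization (facetComplex (maskFacets n L) h) := by
    rw [geomRealization_facetComplex]
    rintro x ⟨⟨hpos, hsum⟩, _, ⟨m, hm, rfl⟩, hxm⟩
    refine ⟨⟨fun v => hpos _, ?_⟩, _, ⟨_, hL m hm, rfl⟩, fun v hv => ?_⟩
    · rw [← hsum]
      exact Equiv.sum_comp σ.symm x
    · rw [hmask m hm, Finset.mem_coe, Finset.mem_map_equiv]
      exact hxm _ hv
  exact ⟨σ, fun _ => rfl, hsymm, hσ, hiso, hreal⟩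

theorem isGeometricSymmetry_of_symmetryOk {s : List ℕ} {p : List (ℤ × ℤ × ℤ)} {L : List ℕ}
    (h : ∀ v, ∃ t ∈ maskFacets n L, v ∈ t) (hok : symmetryOk n s p L) :
    IsGeometricSymmetry (facetComplex (maskFacets n L) h) (listPoint p) axisRotation := by
  obtain ⟨σ, -, hsymm, hσ, hiso, hreal⟩ := exists_perm_of_symmetryOk h hok
  refine ⟨Set.Subset.antisymm ?_ ?_, σ, hiso, fun x _ => axisRotation_simplexwiseLinear _ hσ x⟩
  · rintro _ ⟨_, ⟨x, hx, rfl⟩, rfl⟩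
    exact ⟨_, hreal x hx, (axisRotation_simplexwiseLinear _ hσ x).symm⟩
  · rintro _ ⟨x, hx, rfl⟩
    refine ⟨_, ⟨_, hreal x hx, rfl⟩, ?_⟩
    rw [axisRotation_simplexwiseLinear _ hσ]
    congr 1
    funext v
    have hinv : σ (σ v) = v := by
      simpa only [hsymm] using σ.symm_apply_apply v
    simp only [Function.comp_apply, hsymm, hinv]

/-- A sufficient condition for the coordinates `p`, with the symmetry `s`, to define an immersion:
it suffices to examine one vertex of each orbit. -/
def immersionOk (n : ℕ) (s : List ℕ) (p : List (ℤ × ℤ × ℤ)) (F : List (List ℕ)) : Bool :=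
  -- A vertex is skipped if its partner is smaller; fixed vertices are always tested.
  (List.range n).all fun v => (s.getD v 0).blt v ||
    linkOk (fun w => sub3 (p.getD w 0) (p.getD v 0)) (linkEdges v F)

/-- The open stars are open and cover the realization, since some coordinate of every point is
nonzero. The star of an untested vertex is the image under `σ` of a tested star, and the rotation
transports injectivity. -/
theorem isPolyhedralImmersion_of_immersionOk {s : List ℕ} {p : List (ℤ × ℤ × ℤ)} {L : List ℕ}
    (h : ∀ v, ∃ t ∈ maskFacets n L, v ∈ t) (hok : symmetryOk n s p L)
    (himm : immersionOk n s p (L.map (maskList n))) :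
    IsPolyhedralImmersion (facetComplex (maskFacets n L) h) (listPoint p) := by
  obtain ⟨σ, hσs, hsymm, hσ, -, hreal⟩ := exists_perm_of_symmetryOk h hok
  simp only [immersionOk, List.all_eq_true, List.mem_range, Bool.or_eq_true, Nat.blt_eq] at himm
  have hK := geomRealization_facetComplex (maskFacets n L) h
  have hinj : ∀ v, Set.InjOn (simplexwiseLinear (listPoint p))
      (geomRealization (facetComplex (maskFacets n L) h) ∩ {y | y v ≠ 0}) := by
    intro v
    rcases himm v v.2 with hlt | hlink
    · have hinv : σ (σ v) = v := by
        simpa only [hsymm] using σ.symm_apply_apply v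
      have hlink := (himm (σ v) (σ v).2).resolve_left (by
        rw [← hσs, hinv]
        rw [← hσs] at hlt
        exact not_lt.2 hlt.le)
      have hw := injOn_of_linkOk rfl hlink
      rw [← hK] at hw
      rintro y ⟨hy, hyv⟩ z ⟨hz, hzv⟩ hyz
      have := hw ⟨hreal y hy, by simpa using hyv⟩ ⟨hreal z hz, by simpa using hzv⟩ (by
        rw [← axisRotation_simplexwiseLinear _ hσ, ← axisRotation_simplexwiseLinear _ hσ, hyz])
      exact σ.symm.surjective.injective_comp_right this
    · rw [hK]
      exact injOn_of_linkOk rfl hlink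
  intro x
  have hne : ∃ v, (x : Fin n → ℝ) v ≠ 0 := by
    by_contra hall
    push Not at hall
    have h1 : ∑ v, (x : Fin n → ℝ) v = 1 := x.2.1.2
    rw [Finset.sum_eq_zero fun v _ => hall v] at h1
    exact zero_ne_one h1
  obtain ⟨v, hv⟩ := hne
  refine ⟨{y | (y : Fin n → ℝ) v ≠ 0}, IsOpen.mem_nhds ?_ hv, ?_⟩
  · exact isOpen_ne_fun ((continuous_apply v).comp continuous_subtype_val) continuous_const
  · intro y hy z hz hyz
    exact Subtype.ext (hinj v ⟨y.2, hy⟩ ⟨z.2, hz⟩ hyz)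

end Symmetry

/-! ### A numerical isomorphism invariant by colour refinement. -/

section Invariant

variable {n : ℕ}

open Classical in
/-- A refinement of a colouring of the vertices: the new colour of `v` sums, over all triangles
containing `v`, the squared sums of the colours of the vertices. -/
noncomputable def refineColour (K : AbstractSimplicialComplex (Fin n)) (h : Fin n → ℕ)
    (v : Fin n) : ℕ :=
  ∑ s ∈ Finset.univ.filter (fun s : Finset (Fin n) => s ∈ K ∧ s.card = 3 ∧ v ∈ s),
    (∑ w ∈ s, h w) ^ 2

/-- The colouring distinguishing the vertex `u`. -/
def markColour (u v : Fin n) : ℕ := if v = u then 2 else 1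

/-- An isomorphism invariant: for each vertex `u`, the colouring distinguishing `u` is refined `k`
times; the squares of the resulting colours of `u` are summed over `u`. -/
noncomputable def colourInvariant (k : ℕ) (K : AbstractSimplicialComplex (Fin n)) : ℕ :=
  ∑ u, ((refineColour K)^[k] (markColour u) u) ^ 2

/-- Refinement is natural: an isomorphism carries the triangles at `v` to the triangles at `σ v`. -/
theorem refineColour_comp {K L : AbstractSimplicialComplex (Fin n)} {σ : Equiv.Perm (Fin n)}
    (hσ : IsComplexIso K L σ) (h : Fin n → ℕ) :
    refineColour L h ∘ σ = refineColour K (h ∘ σ) := by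
  classical
  funext v
  unfold refineColour
  rw [Function.comp_apply]
  refine (Finset.sum_equiv σ.finsetCongr (fun s => ?_) fun s _ => ?_).symm
  · simp [hσ s]
  · simp [Finset.sum_map]

/-- An isomorphism matches the marking of `u` with that of `σ u`, hence also all their refinements;
the sum over `u` no longer depends on the labelling. -/
theorem colourInvariant_eq {K L : AbstractSimplicialComplex (Fin n)} (h : Isomorphic K L) (k : ℕ) :
    colourInvariant k K = colourInvariant k L := by
  obtain ⟨σ, hσ⟩ := h
  have key : ∀ u, (refineColour L)^[k] (markColour (σ u)) ∘ σ =
      (refineColour K)^[k] (markColour u) := by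
    intro u
    induction k with
    | zero =>
      funext v
      simp [markColour]
    | succ k ih => rw [Function.iterate_succ_apply', Function.iterate_succ_apply',
        refineColour_comp hσ, ih]
  rw [colourInvariant, colourInvariant,
    ← Equiv.sum_comp σ fun u => ((refineColour L)^[k] (markColour u) u) ^ 2]
  exact Finset.sum_congr rfl fun u _ => by rw [← key u]; rfl

/-- The sum of the values of `g` on a list. -/
def sumOver {α : Type} (g : α → ℕ) : List α → ℕ
  | [] => 0
  | a :: l => Nat.add (g a) (sumOver g l)

theorem sumOver_eq {α : Type} (g : α → ℕ) (l : List α) : sumOver g l = (l.map g).sum := by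
  induction l with
  | nil => rfl
  | cons a l ih => simp [sumOver, ih]

/-- The square of a natural number. -/
def natSquare (a : ℕ) : ℕ := Nat.mul a a

/-- The computable version of `refineColour`, on lists of facets. -/
def refineColourList (n : ℕ) (F : List (List ℕ)) (h : List ℕ) : List ℕ :=
  (List.range n).map fun v =>
    sumOver (fun f => natSquare (sumOver (fun w => h.getD w 0) f)) (F.filter fun f => f.elem v)

/-- The computable version of `colourInvariant`, on lists of facets. -/
def colourInvariantList (n k : ℕ) (F : List (List ℕ)) : ℕ :=
  ((List.range n).map fun u => ((refineColourList n F)^[k]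
    ((List.range n).map fun v => if v = u then 2 else 1)).getD u 0 ^ 2).sum

/-- Whether the masks in `L` define distinct triangles. -/
def trianglesOk (n : ℕ) (L : List ℕ) : Bool :=
  decide L.Nodup && L.all fun m => m.blt (2 ^ n) && (maskList n m).length == 3

theorem sum_maskList (m : ℕ) (g : ℕ → ℕ) :
    ((maskList n m).map g).sum = ∑ w ∈ maskFinset n m, g w := by
  have hnodup : (maskList n m).Nodup := List.Nodup.filter _ List.nodup_range
  rw [← List.sum_toFinset _ hnodup]
  refine (Finset.sum_bij (fun (w : Fin n) _ => (w : ℕ)) (fun w hw => ?_)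
    (fun _ _ _ _ h => Fin.val_injective h)
    (fun i hi => ?_) fun _ _ => rfl).symm
  · simpa [mem_maskList] using hw
  · rw [List.mem_toFinset, mem_maskList] at hi
    exact ⟨⟨i, hi.1⟩, by simpa using hi.2, rfl⟩

theorem card_maskFinset (m : ℕ) : (maskFinset n m).card = (maskList n m).length := by
  have := sum_maskList (n := n) m fun _ => 1
  simpa using this.symm

theorem maskFinset_injOn : Set.InjOn (maskFinset n) {m | m < 2 ^ n} := by
  intro a ha b hb hab
  have h1 := (maskFinset_subset_iff ha).1 hab.subset
  have h2 := (maskFinset_subset_iff hb).1 hab.symm.subset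
  rw [← h1, Nat.and_comm, h2]

/-- Facets have exactly three vertices, so a face with three vertices fills its facet. -/
theorem mem_facetComplex_card_three {L : List ℕ} (hL : trianglesOk n L)
    (h : ∀ v, ∃ t ∈ maskFacets n L, v ∈ t) (s : Finset (Fin n)) :
    s ∈ facetComplex (maskFacets n L) h ∧ s.card = 3 ↔ ∃ m ∈ L, maskFinset n m = s := by
  simp only [trianglesOk, Bool.and_eq_true, List.all_eq_true, beq_iff_eq] at hL
  constructor
  · rintro ⟨⟨-, _, ⟨m, hm, rfl⟩, hsm⟩, hcard⟩
    refine ⟨m, hm, (Finset.eq_of_subset_of_card_le (Finset.coe_subset.1 hsm) ?_).symm⟩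
    rw [card_maskFinset, (hL.2 m hm).2, hcard]
  · rintro ⟨m, hm, rfl⟩
    have hc : (maskFinset n m).card = 3 := by rw [card_maskFinset, (hL.2 m hm).2]
    exact ⟨⟨Finset.card_pos.1 (by omega), _, ⟨m, hm, rfl⟩, subset_rfl⟩, hc⟩

/-- The list has no repetitions and masks below `2 ^ n` are determined by their vertex sets, so the
sum over the list counts each triangle once. -/
theorem refineColour_facetComplex {L : List ℕ} (hL : trianglesOk n L)
    (h : ∀ v, ∃ t ∈ maskFacets n L, v ∈ t) (c : List ℕ) (v : Fin n) :
    refineColour (facetComplex (maskFacets n L) h) (fun w => c.getD w 0) v =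
      (refineColourList n (L.map (maskList n)) c).getD v 0 := by
  classical
  have hmem := mem_facetComplex_card_three hL h
  simp only [trianglesOk, Bool.and_eq_true, List.all_eq_true, decide_eq_true_eq, Nat.blt_eq] at hL
  have hv : (refineColourList n (L.map (maskList n)) c).getD v 0 =
      (((L.map (maskList n)).filter fun f => f.elem (v : ℕ)).map fun f =>
        (f.map fun w => c.getD w 0).sum ^ 2).sum := by
    simp [refineColourList, List.getD_eq_getElem?_getD, sumOver_eq, natSquare, sq]
  have hset : Finset.univ.filter (fun s : Finset (Fin n) =>
      s ∈ facetComplex (maskFacets n L) h ∧ s.card = 3 ∧ v ∈ s) =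
      (L.filter fun m => m.testBit v).toFinset.image (maskFinset n) := by
    ext s
    rw [Finset.mem_filter, ← and_assoc (c := v ∈ s), hmem]
    simp only [Finset.mem_univ, true_and, Finset.mem_image, List.mem_toFinset, List.mem_filter]
    constructor
    · rintro ⟨⟨m, hm, rfl⟩, hvm⟩
      exact ⟨m, ⟨hm, by simpa using hvm⟩, rfl⟩
    · rintro ⟨m, ⟨hm, hvm⟩, rfl⟩
      exact ⟨⟨m, hm, rfl⟩, by simpa using hvm⟩
  rw [hv, refineColour, hset, Finset.sum_image, List.sum_toFinset _ (hL.1.filter _),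
    List.filter_map, List.map_map]
  · have hfil : (L.filter fun m => m.testBit v) =
        L.filter ((fun f : List ℕ => f.elem (v : ℕ)) ∘ maskList n) := by
      refine List.filter_congr fun m _ => ?_
      simp [mem_maskList]
    rw [hfil]
    congr 2
    funext m
    simp only [Function.comp_apply]
    rw [sum_maskList m fun w => c.getD w 0]
  · intro a ha b hb
    simp only [Finset.mem_coe, List.mem_toFinset, List.mem_filter] at ha hb
    exact maskFinset_injOn (hL.2 a ha.1).1 (hL.2 b hb.1).1

theorem colourInvariant_facetComplex {L : List ℕ} (hL : trianglesOk n L)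
    (h : ∀ v, ∃ t ∈ maskFacets n L, v ∈ t) (k : ℕ) :
    colourInvariant k (facetComplex (maskFacets n L) h) =
      colourInvariantList n k (L.map (maskList n)) := by
  have key : ∀ u : Fin n, (refineColour (facetComplex (maskFacets n L) h))^[k] (markColour u) =
      fun w : Fin n => ((refineColourList n (L.map (maskList n)))^[k]
        ((List.range n).map fun v => if v = (u : ℕ) then 2 else 1)).getD w 0 := by
    intro u
    induction k with
    | zero =>
      funext w
      simp [List.getD_eq_getElem?_getD, markColour, Fin.ext_iff]
    | succ k ih =>
      rw [Function.iterate_succ_apply', Function.iterate_succ_apply', ih]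
      exact funext fun w => refineColour_facetComplex hL h _ w
  rw [colourInvariant, colourInvariantList, ← List.sum_toFinset _ List.nodup_range]
  refine Finset.sum_bij (fun (u : Fin n) _ => (u : ℕ)) (fun u _ => by simp)
    (fun _ _ _ _ h => Fin.val_injective h) (fun i hi => ?_) fun u _ => by rw [key u]
  rw [List.mem_toFinset, List.mem_range] at hi
  exact ⟨⟨i, hi⟩, Finset.mem_univ _, rfl⟩

end Invariant

/-! ### Labels and facets of the subdivided octagon. -/

/-- The label of the `i`-th boundary vertex of the subdivided octagon. -/
def boundaryLabel (i : ℕ) : ℕ := if i % 3 = 0 then 0 else 2 * (i / 6) + i % 3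

/-- The label of the `i`-th vertex of the inner ring of the subdivided octagon. -/
def ringLabel (i : ℕ) : ℕ := 10 + i % 24

/-- The facets of the subdivided octagon with identified sides, with central vertex `9`. -/
def octagonFacets : List ℕ := (List.range 24).flatMap fun i =>
  [2 ^ 9 ||| (2 ^ ringLabel i ||| 2 ^ ringLabel (i + 1)),
    2 ^ ringLabel i ||| (2 ^ ringLabel (i + 1) ||| 2 ^ boundaryLabel i),
    2 ^ ringLabel (i + 1) ||| (2 ^ boundaryLabel i ||| 2 ^ boundaryLabel (i + 1))]

theorem ringLabel_ge (i : ℕ) : 10 ≤ ringLabel i := Nat.le_add_right _ _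

theorem ringLabel_lt (i : ℕ) : ringLabel i < 34 := by
  unfold ringLabel; omega

theorem ringLabel_succ_ne (i : ℕ) : ringLabel (i + 1) ≠ ringLabel i := by
  unfold ringLabel; omega

theorem boundaryLabel_le {i : ℕ} (hi : i ≤ 24) : boundaryLabel i ≤ 8 := by
  unfold boundaryLabel; split_ifs <;> omega

theorem boundaryLabel_succ_ne {i : ℕ} (hi : i < 24) : boundaryLabel (i + 1) ≠ boundaryLabel i := by
  revert i
  decide +kernel

/-- Label 0 is the common corner. The labels `2 * k + 1` and `2 * k + 2` belong to the `k`-th pair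
of glued sides, on which corresponding vertices are three steps apart. -/
theorem boundaryLabel_eq : ∀ a ≤ 24, ∀ b ≤ 24, boundaryLabel a = boundaryLabel b →
    a % 3 = 0 ∧ b % 3 = 0 ∨ a = b ∨ a / 6 = b / 6 ∧ (b = a + 3 ∨ a = b + 3) := by
  decide +kernel

theorem boundaryLabel_edge_eq : ∀ i < 24, ∀ j < 24, boundaryLabel i = boundaryLabel j ∧
    boundaryLabel (i + 1) = boundaryLabel (j + 1) →
    i = j ∨ i / 6 = j / 6 ∧ (j = i + 3 ∨ i = j + 3) := by
  decide +kernel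

/-- Two edges per side would not suffice: the halves of a side labelled `0, x, 0` would carry the
same labels in opposite order. -/
theorem boundaryLabel_edge_ne : ∀ i < 24, ∀ j < 24,
    boundaryLabel i = boundaryLabel (j + 1) → boundaryLabel (i + 1) ≠ boundaryLabel j := by
  decide +kernel

theorem boundaryLabel_add_three {i : ℕ} (hi : i % 6 ≤ 3) :
    boundaryLabel (i + 3) = boundaryLabel i := by
  unfold boundaryLabel
  split_ifs <;> omega

/-! ### Polar coordinates on the disc and the gluing of its boundary. -/

section Polar

/-- The point of the disc with radius `r` and angle `π t / 12`. -/
noncomputable def polarPoint (r : Set.Icc (0 : ℝ) 1) (t : ℝ) : Metric.closedBall (0 : ℂ) 1 :=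
  ⟨(r : ℝ) * Complex.exp ((Real.pi * t / 12 : ℝ) * Complex.I), by
    rw [mem_closedBall_zero_iff, norm_mul, Complex.norm_exp_ofReal_mul_I, mul_one,
      Complex.norm_real, Real.norm_eq_abs, abs_of_nonneg r.2.1]
    exact r.2.2⟩

/-- The image of `polarPoint` in the surface. -/
noncomputable def surfacePoint (r : Set.Icc (0 : ℝ) 1) (t : ℝ) : NonorientableSurface 4 :=
  Quot.mk _ (polarPoint r t)

theorem polarPoint_add_period (r : Set.Icc (0 : ℝ) 1) (t : ℝ) :
    polarPoint r (t + 24) = polarPoint r t := by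
  refine Subtype.ext ?_
  have : ((Real.pi * (t + 24) / 12 : ℝ) : ℂ) * Complex.I =
      ((Real.pi * t / 12 : ℝ) : ℂ) * Complex.I + 2 * Real.pi * Complex.I := by
    push_cast; ring
  simp only [polarPoint, this, Complex.exp_periodic _]

theorem continuous_polarPoint :
    Continuous fun x : Set.Icc (0 : ℝ) 1 × Set.Icc (0 : ℝ) 24 => polarPoint x.1 x.2 := by
  unfold polarPoint
  fun_prop

theorem surjective_polarPoint :
    Function.Surjective fun x : Set.Icc (0 : ℝ) 1 × Set.Icc (0 : ℝ) 24 => polarPoint x.1 x.2 := by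
  intro z
  have hz : ‖(z : ℂ)‖ ≤ 1 := mem_closedBall_zero_iff.1 z.2
  have hpi := Real.pi_pos
  have hex : ∃ t ∈ Set.Icc (0 : ℝ) 24, polarPoint ⟨‖(z : ℂ)‖, norm_nonneg _, hz⟩ t = z := by
    have h0 : polarPoint ⟨‖(z : ℂ)‖, norm_nonneg _, hz⟩ (12 * Complex.arg z / Real.pi) = z := by
      refine Subtype.ext ?_
      have : Real.pi * (12 * Complex.arg z / Real.pi) / 12 = Complex.arg z := by
        field_simp
      simp only [polarPoint, this]
      exact Complex.norm_mul_exp_arg_mul_I z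
    have h1 := Complex.neg_pi_lt_arg (z : ℂ)
    have h2 := Complex.arg_le_pi (z : ℂ)
    rcases le_total 0 (Complex.arg z) with h | h
    · refine ⟨_, ⟨by positivity, ?_⟩, h0⟩
      rw [div_le_iff₀ hpi]
      linarith
    · refine ⟨12 * Complex.arg z / Real.pi + 24, ⟨?_, ?_⟩, (polarPoint_add_period _ _).trans h0⟩
      · have : -12 ≤ 12 * Complex.arg z / Real.pi := by
          rw [le_div_iff₀ hpi]
          linarith
        linarith
      · have : 12 * Complex.arg z / Real.pi ≤ 0 := by
          rw [div_le_iff₀ hpi]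
          linarith
        linarith
  obtain ⟨t, ht, h⟩ := hex
  exact ⟨(⟨‖(z : ℂ)‖, norm_nonneg _, hz⟩, ⟨t, ht⟩), h⟩

theorem polarPoint_eq {r r' : Set.Icc (0 : ℝ) 1} {t t' : ℝ} (ht : t ∈ Set.Icc (0 : ℝ) 24)
    (ht' : t' ∈ Set.Icc (0 : ℝ) 24) (h : polarPoint r t = polarPoint r' t') :
    r = r' ∧ ((r : ℝ) = 0 ∨ t = t' ∨ t = 0 ∧ t' = 24 ∨ t = 24 ∧ t' = 0) := by
  have hpi := Real.pi_pos
  have h1 := congrArg Subtype.val h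
  simp only [polarPoint] at h1
  have hr : r = r' := by
    have h2 := congrArg norm h1
    rw [norm_mul, norm_mul, Complex.norm_exp_ofReal_mul_I, Complex.norm_exp_ofReal_mul_I, mul_one,
      mul_one, Complex.norm_real, Complex.norm_real, Real.norm_eq_abs, Real.norm_eq_abs,
      abs_of_nonneg r.2.1, abs_of_nonneg r'.2.1] at h2
    exact Subtype.ext h2
  refine ⟨hr, ?_⟩
  subst hr
  by_cases h0 : (r : ℝ) = 0
  · exact Or.inl h0
  refine Or.inr ?_
  have h3 := mul_left_cancel₀ (by exact_mod_cast h0) h1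
  -- The parameters differ by `24 * n` and both lie in `[0, 24]`, so `n` is `-1`, `0` or `1`.
  obtain ⟨n, hn⟩ := Complex.exp_eq_exp_iff_exists_int.1 h3
  have h4 : Real.pi * t / 12 = Real.pi * t' / 12 + n * (2 * Real.pi) := by
    have h5 : ((Real.pi * t / 12 : ℝ) : ℂ) * Complex.I =
        ((Real.pi * t' / 12 + n * (2 * Real.pi) : ℝ) : ℂ) * Complex.I := by
      rw [hn]; push_cast; ring
    exact_mod_cast mul_right_cancel₀ Complex.I_ne_zero h5
  have h6 : t = t' + 24 * n := by
    have : Real.pi * t = Real.pi * (t' + 24 * n) := by linarith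
    exact mul_left_cancel₀ hpi.ne' this
  obtain ⟨a1, a2⟩ := ht
  obtain ⟨b1, b2⟩ := ht'
  have hn1 : (n : ℝ) ≤ 1 := by linarith
  have hn2 : (-1 : ℝ) ≤ n := by linarith
  have hn1' : n ≤ 1 := by exact_mod_cast hn1
  have hn2' : -1 ≤ n := by exact_mod_cast hn2
  interval_cases n
  · right; left; constructor <;> norm_num at h6 <;> linarith
  · left; simpa using h6
  · right; right; constructor <;> norm_num at h6 <;> linarith

theorem surfacePoint_add_period (r : Set.Icc (0 : ℝ) 1) (t : ℝ) :
    surfacePoint r (t + 24) = surfacePoint r t :=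
  congrArg (Quot.mk _) (polarPoint_add_period r t)

theorem surfacePoint_zero (t t' : ℝ) : surfacePoint 0 t = surfacePoint 0 t' :=
  congrArg (Quot.mk _) (Subtype.ext (by simp [polarPoint]))

/-- A side of the octagon has length 3 in the parameter `t`; the sides `2 * k` and `2 * k + 1` start
at `6 * k` and `6 * k + 3`. -/
theorem surfacePoint_glue {k : ℕ} (hk : k < 4) {τ : ℝ} (h0 : 0 ≤ τ) (h1 : τ ≤ 1) :
    surfacePoint 1 (6 * k + 3 * τ) = surfacePoint 1 (6 * k + 3 + 3 * τ) := by
  refine Quot.sound ⟨k, hk, τ, h0, h1, ?_, ?_⟩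
  · simp only [polarPoint, Set.Icc.coe_one, Complex.ofReal_one, one_mul]
    congr 3
    push_cast
    ring
  · simp only [polarPoint, Set.Icc.coe_one, Complex.ofReal_one, one_mul]
    congr 3
    push_cast
    ring

/-- The gluing at `τ = 0` and `τ = 1` identifies consecutive corners, so all corners become one
point. -/
theorem surfacePoint_corner {m : ℕ} (hm : m ≤ 8) :
    surfacePoint 1 ((3 * m : ℕ) : ℝ) = surfacePoint 1 0 := by
  induction m with
  | zero => simp
  | succ m ih =>
    rw [← ih (by omega)]
    rcases Nat.even_or_odd' m with ⟨k, rfl | rfl⟩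
    · have := surfacePoint_glue (k := k) (by omega) le_rfl zero_le_one
      convert this.symm using 2 <;> push_cast <;> ring
    · have := surfacePoint_glue (k := k) (by omega) zero_le_one le_rfl
      convert this.symm using 2 <;> push_cast <;> ring

theorem surfacePoint_shift {i j : ℕ} (hi : i < 24) (hij : i / 6 = j / 6) (hj : j = i + 3) {s : ℝ}
    (h0 : 0 ≤ s) (h1 : s ≤ 1) : surfacePoint 1 (i + s) = surfacePoint 1 (j + s) := by
  subst hj
  obtain ⟨k, a, ha, rfl⟩ : ∃ k a, a ≤ 2 ∧ i = 6 * k + a := ⟨i / 6, i % 6, by omega, by omega⟩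
  have ha' : (a : ℝ) ≤ 2 := by exact_mod_cast ha
  have := surfacePoint_glue (k := k) (τ := (a + s) / 3) (by omega) (by positivity) (by linarith)
  convert this using 2 <;> push_cast <;> ring

theorem surfacePoint_vertex {a b : ℕ} (ha : a ≤ 24) (hb : b ≤ 24)
    (h : boundaryLabel a = boundaryLabel b) : surfacePoint 1 a = surfacePoint 1 b := by
  rcases boundaryLabel_eq a ha b hb h with ⟨h1, h2⟩ | rfl | ⟨h1, h2 | h2⟩
  · obtain ⟨m, rfl⟩ := Nat.dvd_of_mod_eq_zero h1
    obtain ⟨m', rfl⟩ := Nat.dvd_of_mod_eq_zero h2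
    rw [surfacePoint_corner (by omega), surfacePoint_corner (by omega)]
  · rfl
  · simpa using surfacePoint_shift (by omega) h1 h2 le_rfl zero_le_one
  · simpa using (surfacePoint_shift (by omega) h1.symm h2 le_rfl zero_le_one).symm

end Polar

/-! ### Barycentric coordinates on the sectors, and the points they determine. -/

section Octagon

/-- A point of the `i`-th sector of the subdivided octagon, in barycentric coordinates: `κ` and `ρ`
determine the radius, `s` the position between the vertices `i` and `i + 1`. -/
noncomputable def sectorPoint (i : ℕ) (κ ρ s : ℝ) (v : ℕ) : ℝ :=
  -- Points of the complex arise for `κ = 1` or `ρ = 0`. For `ρ = 0` the point lies in the triangle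
  -- at the centre. For `κ = 1` it lies in the square between ring and rim, cut by the diagonal `ρ +
  -- s = 1`; `max` and `min` select the barycentric coordinates on either side of it.
  (if v = 9 then 1 - κ else 0) + ((if v = ringLabel i then κ * max 0 (1 - ρ - s) else 0) +
    (if v = ringLabel (i + 1) then κ * min (1 - ρ) s else 0)) +
    ((if v = boundaryLabel i then min ρ (1 - s) else 0) +
      if v = boundaryLabel (i + 1) then max 0 (ρ + s - 1) else 0)

variable {i j : ℕ} {κ κ' ρ ρ' s s' : ℝ}

theorem sectorPoint_nine (hi : i < 24) : sectorPoint i κ ρ s 9 = 1 - κ := by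
  have h1 := ringLabel_ge i
  have h2 := ringLabel_ge (i + 1)
  have h3 := boundaryLabel_le hi.le
  have h4 := boundaryLabel_le (i := i + 1) hi
  rw [sectorPoint, if_pos rfl, if_neg (by omega), if_neg (by omega), if_neg (by omega),
    if_neg (by omega)]
  simp only [add_zero]

theorem sectorPoint_ring (hi : i < 24) {v : ℕ} (hv : 10 ≤ v) : sectorPoint i κ ρ s v =
    (if v = ringLabel i then κ * max 0 (1 - ρ - s) else 0) +
      if v = ringLabel (i + 1) then κ * min (1 - ρ) s else 0 := by
  have h3 := boundaryLabel_le hi.le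
  have h4 := boundaryLabel_le (i := i + 1) hi
  have n1 : v ≠ 9 := by omega
  have n2 : v ≠ boundaryLabel i := by omega
  have n3 : v ≠ boundaryLabel (i + 1) := by omega
  simp only [sectorPoint, if_neg n1, if_neg n2, if_neg n3, add_zero, zero_add]

theorem sectorPoint_boundary {v : ℕ} (hv : v ≤ 8) : sectorPoint i κ ρ s v =
    (if v = boundaryLabel i then min ρ (1 - s) else 0) +
      if v = boundaryLabel (i + 1) then max 0 (ρ + s - 1) else 0 := by
  have h1 := ringLabel_ge i
  have h2 := ringLabel_ge (i + 1)
  have n1 : v ≠ 9 := by omega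
  have n2 : v ≠ ringLabel i := by omega
  have n3 : v ≠ ringLabel (i + 1) := by omega
  simp only [sectorPoint, if_neg n1, if_neg n2, if_neg n3, zero_add]

theorem min_add_max_boundary (ρ s : ℝ) : min ρ (1 - s) + max 0 (ρ + s - 1) = ρ := by
  rcases le_total ρ (1 - s) with h | h
  · rw [min_eq_left h, max_eq_left (by linarith), add_zero]
  · rw [min_eq_right h, max_eq_right (by linarith)]; ring

theorem max_add_min_ring (ρ s : ℝ) : max 0 (1 - ρ - s) + min (1 - ρ) s = 1 - ρ := by
  rcases le_total (1 - ρ) s with h | h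
  · rw [min_eq_left h, max_eq_left (by linarith), zero_add]
  · rw [min_eq_right h, max_eq_right (by linarith)]; ring

theorem sum_boundary_sectorPoint (hi : i < 24) :
    ∑ v ∈ Finset.range 9, sectorPoint i κ ρ s v = ρ := by
  have h3 := boundaryLabel_le hi.le
  have h4 := boundaryLabel_le (i := i + 1) hi
  rw [Finset.sum_congr rfl fun v hv => sectorPoint_boundary
    (Nat.lt_succ_iff.1 (Finset.mem_range.1 hv)), Finset.sum_add_distrib, Finset.sum_ite_eq',
    Finset.sum_ite_eq', if_pos (Finset.mem_range.2 (by omega)),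
    if_pos (Finset.mem_range.2 (by omega)), min_add_max_boundary]

theorem sum_sectorPoint (hi : i < 24) :
    ∑ v ∈ Finset.range 34, sectorPoint i κ ρ s v = 1 - κ + κ * (1 - ρ) + ρ := by
  have h3 := boundaryLabel_le hi.le
  have h4 := boundaryLabel_le (i := i + 1) hi
  simp only [sectorPoint, Finset.sum_add_distrib, Finset.sum_ite_eq', Finset.mem_range,
    ringLabel_lt, (by omega : boundaryLabel i < 34), (by omega : boundaryLabel (i + 1) < 34),
    if_true, (by norm_num : 9 < 34)]
  rw [min_add_max_boundary, ← mul_add, max_add_min_ring]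

theorem sectorPoint_nonneg (hκ : 0 ≤ κ) (hκ1 : κ ≤ 1) (hρ : 0 ≤ ρ) (hρ1 : ρ ≤ 1) (hs : 0 ≤ s)
    (hs1 : s ≤ 1) (v : ℕ) : 0 ≤ sectorPoint i κ ρ s v := by
  have h1 : 0 ≤ min (1 - ρ) s := le_min (by linarith) hs
  have h2 : 0 ≤ min ρ (1 - s) := le_min hρ (by linarith)
  have h3 : 0 ≤ 1 - κ := by linarith
  unfold sectorPoint
  have h4 : 0 ≤ max 0 (1 - ρ - s) := le_max_left _ _
  have h5 : 0 ≤ max 0 (ρ + s - 1) := le_max_left _ _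
  refine add_nonneg (add_nonneg ?_ (add_nonneg ?_ ?_)) (add_nonneg ?_ ?_) <;> split_ifs <;>
    positivity

/-- The two ring weights add up to `κ * (1 - ρ)`, so away from the centre and the rim a ring vertex
of the sector is visible. -/
theorem mul_max_add_mul_min_pos (hκ : 0 < κ) (hρ : ρ < 1) :
    κ * max 0 (1 - ρ - s) ≠ 0 ∨ κ * min (1 - ρ) s ≠ 0 := by
  by_contra! h
  have h1 : κ * (1 - ρ) = 0 := by
    rw [← max_add_min_ring ρ s, mul_add, h.1, h.2, add_zero]
  exact (mul_pos hκ (sub_pos.2 hρ)).ne' h1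

/-- Adjacent sectors meet in a common side. -/
theorem eq_of_sectorPoint_adjacent (hκ : 0 < κ) (hρ1 : ρ < 1) (hi : i < 24)
    (hj : j < 24) (hs1 : s ≤ 1) (hs' : 0 ≤ s') (hij : ringLabel (i + 1) = ringLabel j)
    (h : ∀ v < 34, sectorPoint i κ ρ s v = sectorPoint j κ ρ s' v) : s = 1 ∧ s' = 0 := by
  -- The ring vertex `i` does not belong to sector `j`, nor the ring vertex `j + 1` to sector `i`,
  -- so both weights vanish.
  have e1 := h _ (ringLabel_lt i)
  have e2 := h _ (ringLabel_lt (j + 1))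
  rw [sectorPoint_ring hi (ringLabel_ge _), sectorPoint_ring hj (ringLabel_ge _), if_pos rfl,
    if_neg (ringLabel_succ_ne i).symm, if_neg (hij ▸ (ringLabel_succ_ne i).symm),
    if_neg (by unfold ringLabel at hij ⊢; omega)] at e1
  rw [sectorPoint_ring hi (ringLabel_ge _), sectorPoint_ring hj (ringLabel_ge _),
    if_neg (by unfold ringLabel at hij ⊢; omega), if_neg (hij ▸ ringLabel_succ_ne j),
    if_neg (ringLabel_succ_ne j), if_pos rfl] at e2
  simp only [add_zero, mul_eq_zero, hκ.ne', false_or] at e1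
  have e2' : min (1 - ρ) s' = 0 := by
    simpa [hκ.ne'] using e2.symm
  have hs0 : s' = 0 := by
    rcases min_choice (1 - ρ) s' with h' | h' <;> linarith
  refine ⟨?_, hs0⟩
  subst hs0
  have h4 : 1 - ρ - s ≤ 0 := e1 ▸ le_max_right _ _
  have hb : boundaryLabel (i + 1) = boundaryLabel j := by
    rcases Nat.lt_or_ge (i + 1) 24 with h24 | h24
    · have : i + 1 = j := by unfold ringLabel at hij; omega
      rw [this]
    · have : i = 23 ∧ j = 0 := by unfold ringLabel at hij; omega
      rw [this.1, this.2]
      rfl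
  have e3 := h (boundaryLabel i) ((boundaryLabel_le hi.le).trans_lt (by norm_num))
  rw [sectorPoint_boundary (boundaryLabel_le hi.le), sectorPoint_boundary (boundaryLabel_le hi.le),
    if_pos rfl, if_neg (boundaryLabel_succ_ne hi).symm,
    if_neg (hb ▸ (boundaryLabel_succ_ne hi).symm),
    max_eq_left (by linarith), ite_self, add_zero, add_zero] at e3
  rcases min_choice ρ (1 - s) with h' | h' <;> linarith

/-- Within one sector, the position is determined by the barycentric coordinates. -/
theorem eq_of_sectorPoint_same (hκ : 0 < κ) (hi : i < 24)
    (h : ∀ v < 34, sectorPoint i κ ρ s v = sectorPoint i κ ρ s' v) : s = s' := by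
  have e1 := h _ (ringLabel_lt (i + 1))
  have e2 := h (boundaryLabel i) ((boundaryLabel_le hi.le).trans_lt (by norm_num))
  rw [sectorPoint_ring hi (ringLabel_ge _), sectorPoint_ring hi (ringLabel_ge _),
    if_neg (ringLabel_succ_ne i), if_pos rfl, if_neg (ringLabel_succ_ne i), if_pos rfl, zero_add,
    zero_add] at e1
  rw [sectorPoint_boundary (boundaryLabel_le hi.le), sectorPoint_boundary (boundaryLabel_le hi.le),
    if_pos rfl, if_neg (boundaryLabel_succ_ne hi).symm, if_pos rfl,
    if_neg (boundaryLabel_succ_ne hi).symm, add_zero, add_zero] at e2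
  have e1' := mul_left_cancel₀ hκ.ne' e1
  -- For `s ≤ 1 - ρ` the weight of the ring vertex `i + 1` determines `s`; for `s ≥ 1 - ρ` the
  -- weight of the boundary vertex `i` does.
  rcases le_total (1 - ρ) s with h1 | h1 <;> rcases le_total (1 - ρ) s' with h2 | h2
  · rw [min_eq_right (by linarith), min_eq_right (by linarith)] at e2
    linarith
  · rw [min_eq_left h1, min_eq_right h2] at e1'
    rw [← e1', min_eq_right (by linarith), min_eq_left (by linarith)] at e2
    linarith
  · rw [min_eq_right h1, min_eq_left h2] at e1'
    rw [e1', min_eq_left (by linarith), min_eq_right (by linarith)] at e2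
    linarith
  · rwa [min_eq_right h1, min_eq_right h2] at e1'

/-- The ring vertices are not identified with each other, so a positive ring weight forces the two
sectors to be equal or adjacent. -/
theorem surfacePoint_eq_of_ring {r : Set.Icc (0 : ℝ) 1} (hκ : 0 < κ) (hρ1 : ρ < 1)
    (hi : i < 24) (hj : j < 24) (hs : 0 ≤ s) (hs1 : s ≤ 1) (hs' : 0 ≤ s') (hs1' : s' ≤ 1)
    (h : ∀ v < 34, sectorPoint i κ ρ s v = sectorPoint j κ ρ s' v) :
    surfacePoint r (i + s) = surfacePoint r (j + s') := by
  have hper : ∀ {a b : ℕ}, a < 24 → b < 24 → ringLabel (a + 1) = ringLabel b →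
      surfacePoint r (a + 1) = surfacePoint r b := by
    intro a b ha hb hab
    rcases Nat.lt_or_ge (a + 1) 24 with h24 | h24
    · have : b = a + 1 := by unfold ringLabel at hab; omega
      rw [this]
      push_cast
      rfl
    · have : a = 23 ∧ b = 0 := by unfold ringLabel at hab; omega
      rw [this.1, this.2, ← surfacePoint_add_period r ((0 : ℕ) : ℝ)]
      norm_num
  by_cases h1 : ringLabel (i + 1) = ringLabel j
  · obtain ⟨rfl, rfl⟩ := eq_of_sectorPoint_adjacent hκ hρ1 hi hj hs1 hs' h1 h
    rw [add_zero]
    exact hper hi hj h1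
  by_cases h2 : ringLabel (j + 1) = ringLabel i
  · obtain ⟨rfl, rfl⟩ := eq_of_sectorPoint_adjacent hκ hρ1 hj hi hs1' hs h2
      fun v hv => (h v hv).symm
    rw [add_zero]
    exact (hper hj hi h2).symm
  by_cases h3 : i = j
  · subst h3
    rw [eq_of_sectorPoint_same hκ hi h]
  · exfalso
    have e1 := h _ (ringLabel_lt i)
    have e2 := h _ (ringLabel_lt (i + 1))
    rw [sectorPoint_ring hi (ringLabel_ge _), sectorPoint_ring hj (ringLabel_ge _), if_pos rfl,
      if_neg (ringLabel_succ_ne i).symm, if_neg (by unfold ringLabel; omega),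
      if_neg (Ne.symm h2)] at e1
    rw [sectorPoint_ring hi (ringLabel_ge _), sectorPoint_ring hj (ringLabel_ge _),
      if_neg (ringLabel_succ_ne i), if_pos rfl, if_neg h1,
      if_neg (by unfold ringLabel; omega)] at e2
    rcases mul_max_add_mul_min_pos (s := s) hκ hρ1 with h5 | h5
    · exact h5 (by linarith)
    · exact h5 (by linarith)

theorem sectorPoint_rim (hs : 0 ≤ s) {v : ℕ} (hv : v ≤ 8) :
    sectorPoint i κ 1 s v = (if v = boundaryLabel i then 1 - s else 0) +
      if v = boundaryLabel (i + 1) then s else 0 := by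
  rw [sectorPoint_boundary hv, min_eq_right (by linarith), max_eq_right (by linarith),
    add_sub_cancel_left]

/-- On the rim, comparison of labels leaves two possibilities: the edges agree or are glued and `s =
s'`, or both points are boundary vertices with the same label. -/
theorem surfacePoint_eq_of_rim (hi : i < 24) (hj : j < 24) (hs : 0 ≤ s) (hs1 : s ≤ 1)
    (hs' : 0 ≤ s') (hs1' : s' ≤ 1)
    (h : ∀ v < 34, sectorPoint i κ 1 s v = sectorPoint j κ' 1 s' v) :
    surfacePoint 1 (i + s) = surfacePoint 1 (j + s') := by
  have hv : ∀ v ≤ 8, (if v = boundaryLabel i then 1 - s else 0) +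
      (if v = boundaryLabel (i + 1) then s else 0) = (if v = boundaryLabel j then 1 - s' else 0) +
      if v = boundaryLabel (j + 1) then s' else 0 := by
    intro v hv
    rw [← sectorPoint_rim (κ := κ) hs hv, ← sectorPoint_rim (κ := κ') hs' hv]
    exact h v (by omega)
  have bi := boundaryLabel_le hi.le
  have bi' := boundaryLabel_le (i := i + 1) hi
  have bj := boundaryLabel_le hj.le
  have bj' := boundaryLabel_le (i := j + 1) hj
  have ni := boundaryLabel_succ_ne hi
  have nj := boundaryLabel_succ_ne hj
  have e1 := hv _ bi
  have e2 := hv _ bi'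
  have e3 := hv _ bj
  have e4 := hv _ bj'
  rw [if_pos rfl, if_neg ni.symm, add_zero] at e1
  rw [if_neg ni, if_pos rfl, zero_add] at e2
  rw [if_pos rfl, if_neg nj.symm, add_zero] at e3
  rw [if_neg nj, if_pos rfl, zero_add] at e4
  have vertex : ∀ {a b : ℕ}, a ≤ 24 → b ≤ 24 → boundaryLabel a = boundaryLabel b →
      (i : ℝ) + s = a → (j : ℝ) + s' = b →
      surfacePoint 1 (i + s) = surfacePoint 1 (j + s') := by
    intro a b ha hb hab h1 h2
    rw [h1, h2]
    exact surfacePoint_vertex ha hb hab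
  by_cases c1 : boundaryLabel i = boundaryLabel j
  · rw [if_pos c1, if_neg (by rw [c1]; exact nj.symm), add_zero] at e1
    have hss : s = s' := by linarith
    subst hss
    by_cases c2 : boundaryLabel (i + 1) = boundaryLabel (j + 1)
    · rcases boundaryLabel_edge_eq i hi j hj ⟨c1, c2⟩ with rfl | ⟨h1, h2 | h2⟩
      · rfl
      · exact surfacePoint_shift hi h1 h2 hs hs1
      · exact (surfacePoint_shift hj h1.symm h2 hs hs1).symm
    · rw [if_neg (by rw [← c1]; exact ni), if_neg c2, add_zero] at e2
      subst e2
      exact vertex hi.le hj.le c1 (add_zero _) (add_zero _)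
  · by_cases c2 : boundaryLabel i = boundaryLabel (j + 1)
    · have c3 := boundaryLabel_edge_ne i hi j hj c2
      rw [if_neg c3, if_neg (by rw [← c2]; exact ni), add_zero] at e2
      rw [if_neg c1, if_pos c2, zero_add] at e1
      subst e2
      have hs1 : s' = 1 := by linarith
      subst hs1
      exact vertex (b := j + 1) hi.le hj c2 (add_zero _) (by push_cast; ring)
    · rw [if_neg c1, if_neg c2, add_zero] at e1
      have hs1 : s = 1 := by linarith
      subst hs1
      by_cases c3 : boundaryLabel (i + 1) = boundaryLabel j
      · rw [if_neg (Ne.symm c2), if_neg (by rw [c3]; exact nj), add_zero] at e4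
        subst e4
        exact vertex (a := i + 1) hi hj.le c3 (by push_cast; ring) (add_zero _)
      · rw [if_neg (Ne.symm c1), if_neg (Ne.symm c3), add_zero] at e3
        have hs1' : s' = 1 := by linarith
        subst hs1'
        by_cases c4 : boundaryLabel (i + 1) = boundaryLabel (j + 1)
        · exact vertex (a := i + 1) (b := j + 1) hi hj c4 (by push_cast; ring) (by push_cast; ring)
        · rw [if_neg c3, if_neg c4, add_zero] at e2
          exact absurd e2 one_ne_zero

end Octagon

/-! ### The homeomorphism between the surface and the subdivided octagon. -/

section OctagonMap

/-- The weight of the central vertex is `1 - innerWeight r`. -/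
noncomputable def innerWeight (r : ℝ) : ℝ := min 1 (2 * r)

/-- The total weight of the boundary vertices. -/
noncomputable def outerWeight (r : ℝ) : ℝ := max 0 (2 * r - 1)

/-- The map from the disc, in polar coordinates, to the subdivided octagon. -/
noncomputable def octagonMap (r t : ℝ) (v : ℕ) : ℝ :=
  -- Each index `k` contributes bump functions of `t - k`, which makes continuity evident; on sector
  -- `i` only `k = i` and `k = i + 1` contribute, with the values of `sectorPoint`. The index 24
  -- repeats the labels of the index 0 and closes the last sector.
  (if v = 9 then 1 - innerWeight r else 0) + ∑ k ∈ Finset.range 25,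
    ((if v = ringLabel k then innerWeight r * max 0 (min (1 - outerWeight r)
      (min (1 - outerWeight r - (t - k)) (1 + (t - k)))) else 0) +
    if v = boundaryLabel k then max 0 (min (outerWeight r)
      (min (1 - (t - k)) (outerWeight r + (t - k)))) else 0)

theorem weights_mem {r : ℝ} (hr : r ∈ Set.Icc (0 : ℝ) 1) :
    0 ≤ innerWeight r ∧ innerWeight r ≤ 1 ∧ 0 ≤ outerWeight r ∧ outerWeight r ≤ 1 :=
  ⟨le_min zero_le_one (by linarith [hr.1]), min_le_left _ _, le_max_left _ _,
    max_le zero_le_one (by linarith [hr.2])⟩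

theorem weights_cases (r : ℝ) : innerWeight r = 1 ∨ outerWeight r = 0 := by
  rcases le_total 1 (2 * r) with h | h
  · exact Or.inl (min_eq_left h)
  · exact Or.inr (max_eq_left (by linarith))

/-- This recovers the radius from the barycentric coordinates. -/
theorem weights_add (r : ℝ) : innerWeight r + outerWeight r = 2 * r := by
  unfold innerWeight outerWeight
  rcases le_total 1 (2 * r) with h | h
  · rw [min_eq_left h, max_eq_right (by linarith)]; ring
  · rw [min_eq_right h, max_eq_left (by linarith)]; ring

theorem continuous_octagonMap (v : ℕ) : Continuous fun x : ℝ × ℝ => octagonMap x.1 x.2 v := by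
  unfold octagonMap innerWeight outerWeight
  refine Continuous.add ?_ (continuous_finsetSum _ fun k _ => Continuous.add ?_ ?_)
  all_goals
    split_ifs
    · fun_prop
    · exact continuous_const

theorem octagonMap_eq {r t : ℝ} (hr : r ∈ Set.Icc (0 : ℝ) 1) {i : ℕ} (hi : i < 24) {s : ℝ}
    (hs : 0 ≤ s) (hs1 : s ≤ 1) (ht : t = i + s) (v : ℕ) :
    octagonMap r t v = sectorPoint i (innerWeight r) (outerWeight r) s v := by
  obtain ⟨-, -, h3, h4⟩ := weights_mem hr
  unfold octagonMap sectorPoint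
  generalize innerWeight r = κ at *
  generalize outerWeight r = ρ at *
  subst ht
  rw [Finset.sum_eq_add (a := i) (b := i + 1) (by omega)]
  · push_cast
    rw [(by ring : (i : ℝ) + s - i = s), (by ring : (i : ℝ) + s - (i + 1) = s - 1),
      min_eq_left (by linarith : 1 - ρ - s ≤ 1 + s), min_eq_right (by linarith : 1 - ρ - s ≤ 1 - ρ),
      min_comm (1 - s) (ρ + s), ← min_assoc, min_eq_left (by linarith : ρ ≤ ρ + s),
      max_eq_right (le_min h3 (by linarith) : 0 ≤ min ρ (1 - s)),
      ← min_assoc (1 - ρ), min_eq_left (by linarith : 1 - ρ ≤ 1 - ρ - (s - 1)),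
      (by ring : 1 + (s - 1) = s), max_eq_right (le_min (by linarith) hs : 0 ≤ min (1 - ρ) s),
      min_eq_right (by linarith : ρ + (s - 1) ≤ 1 - (s - 1)),
      min_eq_right (by linarith : ρ + (s - 1) ≤ ρ), (by ring : ρ + (s - 1) = ρ + s - 1)]
    ring
  · rintro c - ⟨h1, h2⟩
    rcases lt_or_gt_of_ne h1 with hc | hc
    · have hc' : (c : ℝ) + 1 ≤ i := by exact_mod_cast hc
      rw [max_eq_left, max_eq_left, mul_zero, ite_self, ite_self, add_zero]
      · exact (min_le_right _ _).trans ((min_le_left _ _).trans (by linarith))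
      · exact (min_le_right _ _).trans ((min_le_left _ _).trans (by linarith))
    · have hc' : (i : ℝ) + 2 ≤ c := by exact_mod_cast (by omega : i + 2 ≤ c)
      rw [max_eq_left, max_eq_left, mul_zero, ite_self, ite_self, add_zero]
      · exact (min_le_right _ _).trans ((min_le_right _ _).trans (by linarith))
      · exact (min_le_right _ _).trans ((min_le_right _ _).trans (by linarith))
  · intro h
    exact absurd (Finset.mem_range.2 (by omega)) h
  · intro h
    exact absurd (Finset.mem_range.2 (by omega)) h

theorem exists_sector {t : ℝ} (ht : t ∈ Set.Icc (0 : ℝ) 24) :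
    ∃ i < 24, ∃ s : ℝ, 0 ≤ s ∧ s ≤ 1 ∧ t = (i : ℕ) + s := by
  rcases ht.2.eq_or_lt with h | h
  · exact ⟨23, by norm_num, 1, zero_le_one, le_rfl, by rw [h]; norm_num⟩
  · refine ⟨⌊t⌋₊, ?_, t - ⌊t⌋₊, sub_nonneg.2 (Nat.floor_le ht.1), ?_, by ring⟩
    · rw [Nat.floor_lt ht.1]
      exact_mod_cast h
    · linarith [Nat.lt_floor_add_one t]

theorem sectorPoint_ne_zero {i v : ℕ} {κ ρ s : ℝ} (h : sectorPoint i κ ρ s v ≠ 0) :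
    v = 9 ∧ 1 - κ ≠ 0 ∨ v = ringLabel i ∧ max 0 (1 - ρ - s) ≠ 0 ∨ v = ringLabel (i + 1) ∨
      v = boundaryLabel i ∧ min ρ (1 - s) ≠ 0 ∨
      v = boundaryLabel (i + 1) ∧ max 0 (ρ + s - 1) ≠ 0 := by
  by_contra! hn
  obtain ⟨h1, h2, h3, h4, h5⟩ := hn
  apply h
  unfold sectorPoint
  have e1 : (if v = 9 then 1 - κ else 0) = 0 := ite_eq_right_iff.2 h1
  have e2 : (if v = ringLabel i then κ * max 0 (1 - ρ - s) else 0) = 0 :=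
    ite_eq_right_iff.2 fun hv => by rw [h2 hv, mul_zero]
  have e4 : (if v = boundaryLabel i then min ρ (1 - s) else 0) = 0 := ite_eq_right_iff.2 h4
  have e5 : (if v = boundaryLabel (i + 1) then max 0 (ρ + s - 1) else 0) = 0 :=
    ite_eq_right_iff.2 h5
  rw [e1, e2, if_neg h3, e4, e5]
  simp

theorem testBit_triple (a b c v : ℕ) :
    (2 ^ a ||| (2 ^ b ||| 2 ^ c)).testBit v = true ↔ v = a ∨ v = b ∨ v = c := by
  simp only [Nat.testBit_or, Nat.testBit_two_pow, Bool.or_eq_true, decide_eq_true_eq]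
  omega

theorem mem_octagonFacets {m : ℕ} : m ∈ octagonFacets ↔ ∃ i < 24,
    m = 2 ^ 9 ||| (2 ^ ringLabel i ||| 2 ^ ringLabel (i + 1)) ∨
    m = 2 ^ ringLabel i ||| (2 ^ ringLabel (i + 1) ||| 2 ^ boundaryLabel i) ∨
    m = 2 ^ ringLabel (i + 1) ||| (2 ^ boundaryLabel i ||| 2 ^ boundaryLabel (i + 1)) := by
  simp only [octagonFacets, List.mem_flatMap, List.mem_range, List.mem_cons, List.not_mem_nil,
    or_false]

theorem sectorPoint_mem_facetSpace {i : ℕ} (hi : i < 24) {κ ρ s : ℝ} (hκ : 0 ≤ κ) (hκ1 : κ ≤ 1)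
    (hρ : 0 ≤ ρ) (hρ1 : ρ ≤ 1) (hκρ : κ = 1 ∨ ρ = 0) (hs : 0 ≤ s) (hs1 : s ≤ 1) :
    (fun v : Fin 34 => sectorPoint i κ ρ s v) ∈ facetSpace (maskFacets 34 octagonFacets) := by
  refine ⟨⟨fun v => sectorPoint_nonneg hκ hκ1 hρ hρ1 hs hs1 v, ?_⟩, ?_⟩
  · rw [Fin.sum_univ_eq_sum_range (sectorPoint i κ ρ s), sum_sectorPoint hi]
    rcases hκρ with rfl | rfl <;> ring
  · have key : ∃ m ∈ octagonFacets, ∀ v, sectorPoint i κ ρ s v ≠ 0 → m.testBit v = true := by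
      by_cases hρ0 : ρ = 0
      · subst hρ0
        refine ⟨_, mem_octagonFacets.2 ⟨i, hi, Or.inl rfl⟩, fun v hv => ?_⟩
        rw [testBit_triple]
        rcases sectorPoint_ne_zero hv with h | h | h | h | h
        · exact Or.inl h.1
        · exact Or.inr (Or.inl h.1)
        · exact Or.inr (Or.inr h)
        · exact absurd (min_eq_left (by linarith)) h.2
        · exact absurd (max_eq_left (by linarith)) h.2
      · obtain rfl := hκρ.resolve_right hρ0
        rcases le_total s (1 - ρ) with hsρ | hsρ
        · refine ⟨_, mem_octagonFacets.2 ⟨i, hi, Or.inr (Or.inl rfl)⟩, fun v hv => ?_⟩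
          rw [testBit_triple]
          rcases sectorPoint_ne_zero hv with h | h | h | h | h
          · exact absurd (sub_self _) h.2
          · exact Or.inl h.1
          · exact Or.inr (Or.inl h)
          · exact Or.inr (Or.inr h.1)
          · exact absurd (max_eq_left (by linarith)) h.2
        · refine ⟨_, mem_octagonFacets.2 ⟨i, hi, Or.inr (Or.inr rfl)⟩, fun v hv => ?_⟩
          rw [testBit_triple]
          rcases sectorPoint_ne_zero hv with h | h | h | h | h
          · exact absurd (sub_self _) h.2
          · exact absurd (max_eq_left (by linarith)) h.2
          · exact Or.inl h
          · exact Or.inr (Or.inl h.1)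
          · exact Or.inr (Or.inr h.1)
    obtain ⟨m, hm, h⟩ := key
    exact ⟨_, ⟨m, hm, rfl⟩, fun v hv => by simpa using h v hv⟩

theorem octagonMap_mem {r t : ℝ} (hr : r ∈ Set.Icc (0 : ℝ) 1) (ht : t ∈ Set.Icc (0 : ℝ) 24) :
    (fun v : Fin 34 => octagonMap r t v) ∈ facetSpace (maskFacets 34 octagonFacets) := by
  obtain ⟨i, hi, s, hs, hs1, hts⟩ := exists_sector ht
  obtain ⟨h1, h2, h3, h4⟩ := weights_mem hr
  simp only [octagonMap_eq hr hi hs hs1 hts]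
  exact sectorPoint_mem_facetSpace hi h1 h2 h3 h4 (weights_cases r) hs hs1

/-- The map from the disc, in polar coordinates, onto the subdivided octagon. -/
noncomputable def octagonPoint (x : Set.Icc (0 : ℝ) 1 × Set.Icc (0 : ℝ) 24) :
    facetSpace (maskFacets 34 octagonFacets) :=
  ⟨fun v => octagonMap x.1 x.2 v, octagonMap_mem x.1.2 x.2.2⟩

theorem continuous_octagonPoint : Continuous octagonPoint := by
  refine Continuous.subtype_mk (continuous_pi fun v => ?_) _
  exact (continuous_octagonMap v).comp ((continuous_subtype_val.comp continuous_fst).prodMk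
    (continuous_subtype_val.comp continuous_snd))

theorem eq_sum_of_support {n : ℕ} {y : Fin n → ℝ} (hy : ∑ v, y v = 1) {a b c : ℕ} (ha : a < n)
    (hb : b < n) (hc : c < n) (hab : a ≠ b) (hac : a ≠ c) (hbc : b ≠ c)
    (h : ∀ v, y v ≠ 0 → (v : ℕ) = a ∨ (v : ℕ) = b ∨ (v : ℕ) = c) :
    y ⟨a, ha⟩ + y ⟨b, hb⟩ + y ⟨c, hc⟩ = 1 ∧
    ∀ v : Fin n, y v = (if (v : ℕ) = a then y ⟨a, ha⟩ else 0) +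
      (if (v : ℕ) = b then y ⟨b, hb⟩ else 0) + if (v : ℕ) = c then y ⟨c, hc⟩ else 0 := by
  have hv : ∀ v : Fin n, y v = (if v = ⟨a, ha⟩ then y ⟨a, ha⟩ else 0) +
      (if v = ⟨b, hb⟩ then y ⟨b, hb⟩ else 0) + if v = ⟨c, hc⟩ then y ⟨c, hc⟩ else 0 := by
    intro v
    by_cases h0 : y v = 0
    · rw [h0]
      have : ∀ {u : Fin n}, (if v = u then y u else 0) = 0 := fun {u} =>
        ite_eq_right_iff.2 fun huv => huv ▸ h0
      simp only [this, add_zero]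
    · rcases h v h0 with h1 | h1 | h1
      · obtain rfl : v = ⟨a, ha⟩ := Fin.ext h1
        simp [hab, hac]
      · obtain rfl : v = ⟨b, hb⟩ := Fin.ext h1
        simp [hab.symm, hbc]
      · obtain rfl : v = ⟨c, hc⟩ := Fin.ext h1
        simp [hac.symm, hbc.symm]
  constructor
  · rw [← hy, Finset.sum_congr rfl fun v _ => hv v]
    simp [Finset.sum_add_distrib]
  · intro v
    rw [hv v]
    simp only [Fin.ext_iff]

theorem surjective_octagonPoint : Function.Surjective octagonPoint := by
  rintro ⟨y, hy⟩
  obtain ⟨⟨hpos, hsum⟩, _, ⟨m, hm, rfl⟩, hym⟩ := id hy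
  suffices hex : ∃ i < 24, ∃ r ∈ Set.Icc (0 : ℝ) 1, ∃ s : ℝ, 0 ≤ s ∧ s ≤ 1 ∧
      ∀ v : Fin 34, sectorPoint i (innerWeight r) (outerWeight r) s v = y v by
    obtain ⟨i, hi, r, hr, s, hs, hs1, h⟩ := hex
    have hi' : (i : ℝ) + 1 ≤ 24 := by exact_mod_cast hi
    refine ⟨(⟨r, hr⟩, ⟨i + s, by positivity, by linarith⟩), Subtype.ext (funext fun v => ?_)⟩
    exact (octagonMap_eq hr hi hs hs1 rfl v).trans (h v)
  obtain ⟨i, hi, hm⟩ := mem_octagonFacets.1 hm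
  have h1 := ringLabel_ge i
  have h2 := ringLabel_ge (i + 1)
  have h1' := ringLabel_lt i
  have h2' := ringLabel_lt (i + 1)
  have h3 := boundaryLabel_le hi.le
  have h4 := boundaryLabel_le (i := i + 1) hi
  have h5 := ringLabel_succ_ne i
  have h6 := boundaryLabel_succ_ne hi
  have hsupp : ∀ v : Fin 34, y v ≠ 0 → m.testBit v = true := fun v hv => by simpa using hym v hv
  rcases hm with rfl | rfl | rfl
  · obtain ⟨htot, hyv⟩ := eq_sum_of_support hsum (by norm_num) h1' h2' (by omega) (by omega) h5.symm
      fun v hv => (testBit_triple _ _ _ _).1 (hsupp v hv)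
    have hα := hpos ⟨9, by norm_num⟩
    have hβ := hpos ⟨_, h1'⟩
    have hγ := hpos ⟨_, h2'⟩
    generalize y ⟨9, _⟩ = α at *
    generalize y ⟨ringLabel i, _⟩ = β at *
    generalize y ⟨ringLabel (i + 1), _⟩ = γ at *
    simp only [hyv]
    have hs1 : γ / (β + γ) ≤ 1 := div_le_one_of_le₀ (by linarith) (by linarith)
    -- The total ring weight is `κ = β + γ`, and `s` is the share of `γ` in it. At the centre the
    -- quotient takes the value 0, which is harmless because `s` is arbitrary there.
    refine ⟨i, hi, (1 - α) / 2, ⟨by linarith, by linarith⟩, γ / (β + γ), by positivity, hs1,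
      fun v => ?_⟩
    have hκ : innerWeight ((1 - α) / 2) = β + γ := by
      rw [innerWeight, min_eq_right (by linarith)]; linarith
    have hρ : outerWeight ((1 - α) / 2) = 0 := max_eq_left (by linarith)
    have hmul : (β + γ) * (γ / (β + γ)) = γ := by
      by_cases h0 : β + γ = 0
      · rw [h0, zero_mul]; linarith
      · field_simp
    rw [sectorPoint, hκ, hρ, min_eq_left (by linarith : (0 : ℝ) ≤ 1 - γ / (β + γ)),
      max_eq_left (by linarith : 0 + γ / (β + γ) - 1 ≤ 0),
      max_eq_right (by linarith : 0 ≤ 1 - 0 - γ / (β + γ)),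
      min_eq_right (by linarith : γ / (β + γ) ≤ 1 - 0), hmul, sub_zero, mul_sub, hmul]
    simp only [ite_self, add_zero, mul_one, add_sub_cancel_right,
      (by linarith : 1 - (β + γ) = α), add_assoc]
  · obtain ⟨htot, hyv⟩ := eq_sum_of_support hsum h1' h2' (by omega) h5.symm (by omega) (by omega)
      fun v hv => (testBit_triple _ _ _ _).1 (hsupp v hv)
    have hα := hpos ⟨_, h1'⟩
    have hβ := hpos ⟨_, h2'⟩
    have hγ := hpos ⟨boundaryLabel i, by omega⟩
    generalize y ⟨ringLabel i, _⟩ = α at *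
    generalize y ⟨ringLabel (i + 1), _⟩ = β at *
    generalize y ⟨boundaryLabel i, _⟩ = γ at *
    simp only [hyv]
    -- For `κ = 1` the radius is `(1 + ρ) / 2`. In this triangle `ρ = γ`, and `s` is the weight of
    -- the second ring vertex.
    refine ⟨i, hi, (1 + γ) / 2, ⟨by linarith, by linarith⟩, β, hβ, by linarith, fun v => ?_⟩
    have hκ : innerWeight ((1 + γ) / 2) = 1 := min_eq_left (by linarith)
    have hρ : outerWeight ((1 + γ) / 2) = γ := by
      rw [outerWeight, max_eq_right (by linarith)]; ring
    rw [sectorPoint, hκ, hρ, min_eq_left (by linarith : γ ≤ 1 - β),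
      max_eq_left (by linarith : γ + β - 1 ≤ 0), max_eq_right (by linarith : 0 ≤ 1 - γ - β),
      min_eq_right (by linarith : β ≤ 1 - γ), (by linarith : 1 - γ - β = α)]
    simp only [sub_self, ite_self, add_zero, zero_add, one_mul]
  · obtain ⟨htot, hyv⟩ := eq_sum_of_support hsum h2' (by omega) (by omega) (by omega) (by omega)
      h6.symm fun v hv => (testBit_triple _ _ _ _).1 (hsupp v hv)
    have hα := hpos ⟨_, h2'⟩
    have hβ := hpos ⟨boundaryLabel i, by omega⟩
    have hγ := hpos ⟨boundaryLabel (i + 1), by omega⟩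
    generalize y ⟨ringLabel (i + 1), _⟩ = α at *
    generalize y ⟨boundaryLabel i, _⟩ = β at *
    generalize y ⟨boundaryLabel (i + 1), _⟩ = γ at *
    simp only [hyv]
    -- Across the diagonal `ρ = 1 - α`, and the first boundary vertex has weight `1 - s = β`.
    refine ⟨i, hi, 1 - α / 2, ⟨by linarith, by linarith⟩, 1 - β, by linarith, by linarith,
      fun v => ?_⟩
    have hκ : innerWeight (1 - α / 2) = 1 := min_eq_left (by linarith)
    have hρ : outerWeight (1 - α / 2) = 1 - α := by
      rw [outerWeight, max_eq_right (by linarith)]; ring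
    rw [sectorPoint, hκ, hρ, min_eq_right (by linarith : 1 - (1 - β) ≤ 1 - α),
      max_eq_right (by linarith : 0 ≤ 1 - α + (1 - β) - 1),
      max_eq_left (by linarith : 1 - (1 - α) - (1 - β) ≤ 0),
      min_eq_left (by linarith : 1 - (1 - α) ≤ 1 - β), (by linarith : 1 - α + (1 - β) - 1 = γ)]
    simp only [sub_self, ite_self, zero_add, one_mul, sub_sub_cancel, mul_zero, add_assoc]

/-- Polar coordinates are ambiguous only at the centre and between `t = 0` and `t = 24`. -/
theorem octagonPoint_eq_of_polarPoint_eq {x x' : Set.Icc (0 : ℝ) 1 × Set.Icc (0 : ℝ) 24}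
    (h : polarPoint x.1 x.2 = polarPoint x'.1 x'.2) : octagonPoint x = octagonPoint x' := by
  obtain ⟨r, t⟩ := x
  obtain ⟨r', t'⟩ := x'
  obtain ⟨hr, hcases⟩ := polarPoint_eq (r := r) (r' := r') t.2 t'.2 h
  subst hr
  have hwrap : ∀ v, octagonMap r 0 v = octagonMap r 24 v := by
    intro v
    obtain ⟨-, -, h3, h4⟩ := weights_mem r.2
    rw [octagonMap_eq r.2 (i := 0) (by norm_num) le_rfl zero_le_one (by simp),
      octagonMap_eq r.2 (i := 23) (by norm_num) zero_le_one le_rfl (by norm_num), sectorPoint,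
      sectorPoint]
    generalize innerWeight r = κ at *
    generalize outerWeight r = ρ at *
    rw [max_eq_right (by linarith : 0 ≤ 1 - ρ - 0), min_eq_right (by linarith : (0 : ℝ) ≤ 1 - ρ),
      min_eq_left (by linarith : ρ ≤ 1 - 0), max_eq_left (by linarith : ρ + 0 - 1 ≤ 0),
      max_eq_left (by linarith : 1 - ρ - 1 ≤ 0), min_eq_left (by linarith : 1 - ρ ≤ 1),
      min_eq_right (by linarith : (1 : ℝ) - 1 ≤ ρ), max_eq_right (by linarith : 0 ≤ ρ + 1 - 1),
      show ringLabel (23 + 1) = ringLabel 0 from rfl,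
      show boundaryLabel (23 + 1) = boundaryLabel 0 from rfl]
    simp
  refine Subtype.ext (funext fun v => ?_)
  change octagonMap r t v = octagonMap r t' v
  rcases hcases with h | h | ⟨h, h'⟩ | ⟨h, h'⟩
  · have hκ : innerWeight r = 0 := by rw [h, innerWeight]; norm_num
    have hρ : outerWeight r = 0 := by rw [h, outerWeight]; norm_num
    obtain ⟨i, hi, s, hs, hs1, hts⟩ := exists_sector t.2
    obtain ⟨j, hj, s', hs', hs1', hts'⟩ := exists_sector t'.2
    rw [octagonMap_eq r.2 hi hs hs1 hts, octagonMap_eq r.2 hj hs' hs1' hts', hκ, hρ, sectorPoint,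
      sectorPoint, min_eq_left (by linarith : (0 : ℝ) ≤ 1 - s),
      min_eq_left (by linarith : (0 : ℝ) ≤ 1 - s'), max_eq_left (by linarith : 0 + s - 1 ≤ 0),
      max_eq_left (by linarith : 0 + s' - 1 ≤ 0)]
    simp
  · rw [h]
  · rw [h, h', hwrap]
  · rw [h, h', hwrap]

/-- On the rim only boundary vertices carry weight, and their labels repeat after three steps within
a pair of sides. -/
theorem octagonMap_glue {k : ℕ} (hk : k < 4) {τ : ℝ} (h0 : 0 ≤ τ) (h1 : τ ≤ 1) (v : ℕ) :
    octagonMap 1 (6 * k + 3 * τ) v = octagonMap 1 (6 * k + 3 + 3 * τ) v := by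
  have hr : (1 : ℝ) ∈ Set.Icc (0 : ℝ) 1 := ⟨zero_le_one, le_rfl⟩
  obtain ⟨a, ha, s, hs, hs1, has⟩ : ∃ a : ℕ, a ≤ 2 ∧ ∃ s : ℝ, 0 ≤ s ∧ s ≤ 1 ∧ 3 * τ = a + s := by
    rcases h1.eq_or_lt with h | h
    · exact ⟨2, le_rfl, 1, zero_le_one, le_rfl, by rw [h]; norm_num⟩
    · refine ⟨⌊3 * τ⌋₊, ?_, 3 * τ - ⌊3 * τ⌋₊, sub_nonneg.2 (Nat.floor_le (by positivity)), ?_,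
        by ring⟩
      · have : ⌊3 * τ⌋₊ < 3 := (Nat.floor_lt (by positivity)).2 (by push_cast; linarith)
        omega
      · linarith [Nat.lt_floor_add_one (3 * τ)]
  rw [octagonMap_eq hr (i := 6 * k + a) (by omega) hs hs1 (by push_cast; rw [has]; ring),
    octagonMap_eq hr (i := 6 * k + a + 3) (by omega) hs hs1 (by push_cast; rw [has]; ring)]
  have hκ : innerWeight 1 = 1 := min_eq_left (by norm_num)
  have hρ : outerWeight 1 = 1 := by rw [outerWeight]; norm_num
  have e1 : boundaryLabel (6 * k + a + 3) = boundaryLabel (6 * k + a) :=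
    boundaryLabel_add_three (by omega)
  have e2 : boundaryLabel (6 * k + a + 3 + 1) = boundaryLabel (6 * k + a + 1) :=
    boundaryLabel_add_three (i := 6 * k + a + 1) (by omega)
  rw [sectorPoint, sectorPoint, hκ, hρ, e1, e2, max_eq_left (by linarith : (1 : ℝ) - 1 - s ≤ 0),
    min_eq_left (by linarith : (1 : ℝ) - 1 ≤ s)]
  simp

/-- The coordinate at 9 determines the inner weight and the sum over the boundary labels the outer
one, hence the radius. The centre, the rim and the points between are then treated separately. -/
theorem surfacePoint_eq_of_octagonPoint_eq {x x' : Set.Icc (0 : ℝ) 1 × Set.Icc (0 : ℝ) 24}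
    (h : octagonPoint x = octagonPoint x') : surfacePoint x.1 x.2 = surfacePoint x'.1 x'.2 := by
  obtain ⟨r, t, ht⟩ := x
  obtain ⟨r', t', ht'⟩ := x'
  obtain ⟨i, hi, s, hs, hs1, rfl⟩ := exists_sector ht
  obtain ⟨j, hj, s', hs', hs1', rfl⟩ := exists_sector ht'
  have hv : ∀ v < 34, sectorPoint i (innerWeight r) (outerWeight r) s v =
      sectorPoint j (innerWeight r') (outerWeight r') s' v := by
    intro v hv
    rw [← octagonMap_eq r.2 hi hs hs1 rfl, ← octagonMap_eq r'.2 hj hs' hs1' rfl]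
    exact congrFun (congrArg Subtype.val h) ⟨v, hv⟩
  have hκ : innerWeight r = innerWeight r' := by
    have := hv 9 (by norm_num)
    rw [sectorPoint_nine hi, sectorPoint_nine hj] at this
    linarith
  have hρ : outerWeight r = outerWeight r' := by
    have h1 := sum_boundary_sectorPoint (κ := innerWeight r) (ρ := outerWeight r) (s := s) hi
    have h2 := sum_boundary_sectorPoint (κ := innerWeight r') (ρ := outerWeight r') (s := s') hj
    exact h1.symm.trans ((Finset.sum_congr rfl fun v hv' =>
      hv v ((Finset.mem_range.1 hv').trans (by norm_num))).trans h2)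
  have hr : r = r' := by
    have h1 := weights_add r
    have h2 := weights_add r'
    exact Subtype.ext (by linarith)
  subst hr
  obtain ⟨h1, h2, h3, h4⟩ := weights_mem r.2
  have hadd := weights_add r
  change surfacePoint r (i + s) = surfacePoint r (j + s')
  rcases h1.eq_or_lt with hκ0 | hκ0
  · have hρ0 := (weights_cases r).resolve_left (by rw [← hκ0]; exact zero_ne_one)
    have : r = 0 := Subtype.ext (by
      change (r : ℝ) = 0
      linarith)
    rw [this]
    exact surfacePoint_zero _ _
  rcases h4.eq_or_lt with hρ1 | hρ1
  · have hκ1 := (weights_cases r).resolve_right (by rw [hρ1]; exact one_ne_zero)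
    have : r = 1 := Subtype.ext (by
      change (r : ℝ) = 1
      linarith)
    rw [hρ1] at hv
    rw [this]
    exact surfacePoint_eq_of_rim hi hj hs hs1 hs' hs1' hv
  · exact surfacePoint_eq_of_ring hκ0 hρ1 hi hj hs hs1 hs' hs1' hv

/-- The subdivided octagon with identified sides is the non-orientable surface of genus four. -/
theorem nonempty_homeomorph_octagonFacets :
    Nonempty (facetSpace (maskFacets 34 octagonFacets) ≃ₜ NonorientableSurface 4) := by
  let p : C(Set.Icc (0 : ℝ) 1 × Set.Icc (0 : ℝ) 24, Metric.closedBall (0 : ℂ) 1) :=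
    ⟨fun x => polarPoint x.1 x.2, continuous_polarPoint⟩
  -- A continuous surjection from a compact space to a Hausdorff space is a quotient map, so maps
  -- given in polar coordinates descend to the disc.
  have hq : Topology.IsQuotientMap p :=
    Topology.IsQuotientMap.of_surjective_continuous surjective_polarPoint continuous_polarPoint
  have hfac : ∀ x x', p x = p x' → octagonPoint x = octagonPoint x' :=
    fun _ _ h => octagonPoint_eq_of_polarPoint_eq h
  let g : C(Set.Icc (0 : ℝ) 1 × Set.Icc (0 : ℝ) 24,
      facetSpace (maskFacets 34 octagonFacets)) := ⟨octagonPoint, continuous_octagonPoint⟩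
  let F : C(Metric.closedBall (0 : ℂ) 1, facetSpace (maskFacets 34 octagonFacets)) :=
    hq.lift g hfac
  have hF : ∀ x : Set.Icc (0 : ℝ) 1 × Set.Icc (0 : ℝ) 24, F (polarPoint x.1 x.2) = octagonPoint x :=
    fun x => DFunLike.congr_fun (hq.lift_comp g hfac) x
  have hglue : ∀ z w, crosscapGluing 4 z w → F z = F w := by
    rintro z w ⟨k, hk, τ, h0, h1, hz, hw⟩
    have hk' : (k : ℝ) + 1 ≤ 4 := by exact_mod_cast hk
    have m1 : 6 * (k : ℝ) + 3 * τ ∈ Set.Icc (0 : ℝ) 24 := ⟨by positivity, by linarith⟩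
    have m2 : 6 * (k : ℝ) + 3 + 3 * τ ∈ Set.Icc (0 : ℝ) 24 := ⟨by positivity, by linarith⟩
    have hz' : z = polarPoint 1 (6 * k + 3 * τ) := by
      refine Subtype.ext (hz.trans ?_)
      simp only [polarPoint, Set.Icc.coe_one, Complex.ofReal_one, one_mul]
      congr 3
      push_cast
      ring
    have hw' : w = polarPoint 1 (6 * k + 3 + 3 * τ) := by
      refine Subtype.ext (hw.trans ?_)
      simp only [polarPoint, Set.Icc.coe_one, Complex.ofReal_one, one_mul]
      congr 3
      push_cast
      ring
    rw [hz', hw', hF (1, ⟨_, m1⟩), hF (1, ⟨_, m2⟩)]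
    exact Subtype.ext (funext fun v => octagonMap_glue hk h0 h1 v)
  let G : NonorientableSurface 4 → facetSpace (maskFacets 34 octagonFacets) := Quot.lift F hglue
  have hG : Continuous G := continuous_quot_lift hglue F.continuous
  have hbij : Function.Bijective G := by
    constructor
    · rintro ⟨z⟩ ⟨w⟩ h
      obtain ⟨x, rfl⟩ := surjective_polarPoint z
      obtain ⟨x', rfl⟩ := surjective_polarPoint w
      exact surfacePoint_eq_of_octagonPoint_eq ((hF x).symm.trans (h.trans (hF x')))
    · intro y
      obtain ⟨x, rfl⟩ := surjective_octagonPoint y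
      exact ⟨surfacePoint x.1 x.2, hF x⟩
  -- Only compactness of the glued disc is needed; the Hausdorff property is used on the side of the
  -- complex.
  exact ⟨(Continuous.homeoOfEquivCompactToT2 (f := Equiv.ofBijective G hbij) hG).symm⟩

end OctagonMap

/-! ### The explicit triangulations and their verification by computation. -/

section Data

/-- A triangulated surface on ten vertices with a symmetric realization: the facets, each given by
its three digits, the edges flipped in passing from `baseFacets` to these facets, the involution of
the vertices and the coordinates. -/
structure RealizedTriangulation where
  facets : List ℕ
  flips : List ℕ
  symmetry : List ℕ
  coords : List (ℤ × ℤ × ℤ)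

/-- The bit mask of a triple of digits. -/
def digitMask (t : ℕ) : ℕ := 2 ^ (t / 100) ||| (2 ^ (t / 10 % 10) ||| 2 ^ (t % 10))

/-- The bit mask of a pair of digits. -/
def digitMask₂ (t : ℕ) : ℕ := 2 ^ (t / 10) ||| 2 ^ (t % 10)

/-- The bit masks of the facets. -/
def RealizedTriangulation.masks (r : RealizedTriangulation) : List ℕ := r.facets.map digitMask

/-- The facets of a triangulation with ten vertices. -/
def baseFacets : List ℕ := List.map digitMask
  -- The digit 0 is invisible in front: `79` is the triangle `{0, 7, 9}`, and among the flips `9` is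
  -- the edge `{0, 9}`.
  [79, 89, 67, 129, 12, 459, 359, 346, 149, 34, 24, 369, 578, 689, 35, 457, 467, 56, 568, 279, 278,
  18, 248, 148]

/-- The faces to be replaced in reducing the subdivided octagon to ten vertices. -/
def baseMoves : List (List ℕ) :=
  -- A pair is an edge to be flipped; a single entry is a vertex of degree three to be removed. Each
  -- of the 24 ring vertices `10, …, 33` is removed once.
  [[33, 9], [33, 32], [33], [32, 31], [9, 26], [31, 8], [31], [26, 25], [26], [32, 10], [32], [25,
  9], [25, 27], [25], [30, 7], [15, 9], [15, 2], [15], [30, 29], [30], [29, 0], [13, 12], [29, 7],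
  [29], [12, 2], [12], [13, 0], [13], [11, 9], [11], [20, 9], [20, 21], [20], [22, 21], [21, 19],
  [21], [22, 9], [22], [23, 9], [9, 1], [23, 0], [23], [18, 3], [18, 4], [18], [14, 16], [28, 0],
  [9, 16], [16, 0], [16], [0, 4], [1, 2], [14, 9], [14], [28, 9], [28, 27], [28], [19, 5], [6, 8],
  [4, 9], [19, 17], [4, 9], [19, 17], [5, 24], [4, 0], [19, 4], [19, 0], [19], [24, 9], [24, 4],
  [27, 6], [24, 3], [24], [17, 9], [17, 1], [17, 3], [17, 0], [17], [27, 3], [27, 7], [0, 5], [27,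
  9], [27, 3], [5, 6], [27, 0], [27], [10, 9], [10, 7], [10, 0], [10, 2], [10]]

/-- The list of realized triangulations. -/
def realizedTriangulations : List RealizedTriangulation :=
  [⟨[12, 16, 28, 34, 35, 48, 56, 129, 148, 149, 167, 178, 236, 238, 256, 257, 279, 346, 359, 389,
   457, 459, 467, 789], [69, 78, 9, 8, 7, 24, 58, 68], [7, 6, 4, 9, 2, 8, 1, 0, 5, 3], [(-12, 7,
   -3), (-3, 15, 12), (-2, 15, 5), (15, 1, -10), (2, -15, 5), (-9, -6, -10), (3, -15, 12), (12, -7,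
   -3), (9, 6, -10), (-15, -1, -10)]⟩,
   ⟨[12, 18, 25, 45, 47, 68, 69, 79, 129, 136, 138, 146, 149, 235, 238, 278, 279, 347, 349, 357,
   369, 456, 568, 578], [4, 3, 24, 48, 34, 59, 45, 67, 6, 89], [0, 7, 9, 3, 8, 6, 5, 1, 4, 2], [(0,
   0, 9), (-10, -14, -7), (-13, -15, -15), (0, 0, -1), (0, 1, -2), (-3, -4, 3), (3, 4, 3), (10, 14,
   -7), (0, -1, -2), (13, 15, -15)]⟩,
   ⟨[12, 17, 28, 35, 38, 46, 47, 56, 129, 134, 138, 149, 178, 256, 257, 268, 279, 346, 359, 369,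
   457, 459, 689, 789], [78, 9, 8, 24, 4, 48, 58, 67], [9, 3, 5, 1, 8, 2, 7, 6, 4, 0], [(-2, -3,
   -6), (-2, 15, 4), (6, -7, -12), (2, -15, 4), (8, 15, -11), (-6, 7, -12), (-1, -2, -11), (1, 2,
   -11), (-8, -15, -11), (2, 3, -6)]⟩,
   ⟨[12, 18, 26, 36, 37, 79, 89, 129, 135, 139, 147, 148, 157, 246, 248, 257, 258, 279, 345, 347,
   369, 456, 568, 689], [46, 49, 45, 3, 5, 4, 59, 67, 78], [9, 2, 1, 6, 5, 4, 3, 8, 7, 0], [(-24,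
   15, -12), (-25, -12, 25), (25, 12, 25), (6, -3, 5), (-14, -6, 17), (14, 6, 17), (-6, 3, 5), (23,
   28, -30), (-23, -28, -30), (24, -15, -12)]⟩,
   ⟨[12, 14, 23, 35, 49, 56, 67, 79, 129, 146, 157, 159, 167, 234, 248, 278, 279, 346, 359, 368,
   389, 489, 568, 578], [4, 18, 49, 8, 45, 47, 69], [9, 2, 1, 5, 7, 3, 8, 4, 6, 0], [(-2, 6, 13),
   (-12, -12, 14), (12, 12, 14), (15, -1, -5), (-15, -4, 11), (-15, 1, -5), (-9, -3, 11), (15, 4,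
   11), (9, 3, 11), (2, -6, 13)]⟩,
   ⟨[13, 14, 35, 49, 56, 67, 79, 123, 125, 146, 157, 167, 234, 248, 259, 278, 279, 346, 359, 368,
   389, 489, 568, 578], [4, 2, 18, 49, 8, 19, 45, 47, 69], [9, 2, 1, 5, 7, 3, 8, 4, 6, 0], [(1, -3,
   -1), (11, -4, 4), (-11, 4, 4), (1, 5, 2), (-9, 11, -3), (-1, -5, 2), (-9, 9, -7), (9, -11, -3),
   (9, -9, -7), (-1, 3, -1)]⟩,
   ⟨[12, 16, 28, 34, 35, 48, 56, 129, 148, 149, 167, 178, 256, 257, 268, 279, 347, 359, 367, 368,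
   389, 457, 459, 789], [46, 69, 78, 9, 8, 7, 24, 58], [5, 9, 4, 6, 2, 0, 3, 8, 7, 1], [(-5, 3,
   -5), (-8, 11, -1), (11, -7, -4), (6, -6, -11), (-11, 7, -4), (5, -3, -5), (-6, 6, -11), (-1, 12,
   1), (1, -12, 1), (8, -11, -1)]⟩,
   ⟨[12, 14, 23, 35, 47, 56, 67, 129, 146, 157, 159, 167, 234, 248, 278, 279, 346, 359, 368, 389,
   479, 489, 568, 578], [4, 18, 49, 8, 45, 47, 9, 69], [9, 2, 1, 5, 7, 3, 8, 4, 6, 0], [(9, 4, 0),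
   (-11, 4, -11), (11, -4, -11), (-3, -2, -4), (2, 7, 12), (3, 2, -4), (1, 1, 5), (-2, -7, 12),
   (-1, -1, 5), (-9, -4, 0)]⟩,
   ⟨[12, 17, 23, 35, 46, 47, 56, 129, 145, 148, 159, 178, 238, 267, 268, 279, 346, 348, 359, 369,
   457, 567, 689, 789], [4, 24, 49, 67, 58, 78, 9, 8], [9, 3, 5, 1, 8, 2, 7, 6, 4, 0], [(2, 4, 12),
   (-13, 3, -10), (22, -19, 24), (13, -3, -10), (-30, -29, -1), (-22, 19, 24), (8, -5, 26), (-8, 5,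
   26), (30, 29, -1), (-2, -4, 12)]⟩,
   ⟨[12, 15, 27, 35, 38, 79, 89, 123, 138, 148, 149, 157, 179, 234, 248, 267, 268, 346, 356, 457,
   459, 467, 569, 689], [4, 2, 1, 29, 78, 27, 58, 56, 6, 25, 39], [6, 4, 7, 5, 1, 3, 0, 2, 9, 8],
   [(-3, 1, 13), (-4, 12, 3), (-4, 5, 9), (-10, 15, 13), (4, -12, 3), (10, -15, 13), (3, -1, 13),
   (4, -5, 9), (10, 6, 15), (-10, -6, 15)]⟩,
   ⟨[12, 17, 23, 35, 46, 47, 56, 129, 145, 148, 159, 178, 234, 248, 268, 269, 346, 359, 368, 389,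
   457, 567, 679, 789], [4, 49, 67, 58, 69, 78, 9, 8, 27], [3, 9, 5, 0, 6, 2, 4, 8, 7, 1], [(-12,
   -2, -12), (-5, 2, 4), (7, 12, 0), (12, 2, -12), (12, 4, -8), (-7, -12, 0), (-12, -4, -8), (-8,
   -3, -7), (8, 3, -7), (5, -2, 4)]⟩,
   ⟨[12, 17, 28, 35, 38, 46, 47, 56, 124, 136, 138, 146, 178, 249, 257, 258, 279, 345, 349, 369,
   457, 568, 689, 789], [78, 9, 8, 24, 4, 19, 48, 34, 59, 67], [0, 5, 6, 7, 8, 1, 2, 3, 4, 9], [(0,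
   0, 5), (-30, 0, 17), (6, 2, 10), (-6, -6, 1), (-27, -26, -1), (30, 0, 17), (-6, -2, 10), (6, 6,
   1), (27, 26, -1), (0, 0, 3)]⟩,
   ⟨[12, 18, 23, 35, 56, 67, 78, 127, 148, 149, 179, 238, 256, 257, 268, 346, 348, 359, 369, 457,
   459, 467, 689, 789], [4, 24, 29, 78, 9, 58], [9, 1, 4, 5, 2, 3, 6, 8, 7, 0], [(10, -9, 11), (0,
   0, 11), (1, 13, 10), (-15, -3, 15), (-1, -13, 10), (15, 3, 15), (0, 0, -4), (-2, -4, 5), (2, 4,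
   5), (-10, 9, 11)]⟩,
   ⟨[13, 18, 27, 28, 35, 56, 67, 123, 129, 146, 148, 167, 179, 234, 245, 257, 289, 346, 359, 369,
   458, 568, 579, 689], [4, 2, 78, 79, 45, 28, 9, 49, 47], [8, 2, 1, 9, 7, 6, 5, 4, 0, 3], [(3, -6,
   12), (11, -2, -7), (-11, 2, -7), (4, -12, -3), (3, -12, -2), (2, -5, 0), (-2, 5, 0), (-3, 12,
   -2), (-3, 6, 12), (-4, 12, -3)]⟩,
   ⟨[12, 17, 23, 35, 56, 67, 124, 136, 138, 146, 178, 238, 249, 257, 258, 279, 345, 349, 369, 457,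
   467, 568, 689, 789], [4, 24, 19, 48, 34, 59, 78, 9, 8], [0, 5, 6, 7, 8, 1, 2, 3, 4, 9], [(0, 0,
   1), (3, -11, -10), (7, 10, 12), (9, -7, -9), (-11, -11, -9), (-3, 11, -10), (-7, -10, 12), (-9,
   7, -9), (11, 11, -9), (0, 0, -5)]⟩,
   ⟨[12, 18, 23, 35, 56, 67, 78, 127, 136, 138, 146, 149, 179, 238, 257, 258, 345, 349, 369, 457,
   467, 569, 589, 789], [4, 24, 29, 48, 34, 59, 68, 78, 9], [9, 3, 4, 1, 2, 7, 8, 5, 6, 0], [(-2,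
   2, -10), (-4, -4, -3), (15, -6, -12), (4, 4, -3), (-15, 6, -12), (2, 0, -15), (-9, -10, -3),
   (-2, 0, -15), (9, 10, -3), (2, -2, -10)]⟩,
   ⟨[12, 15, 26, 35, 38, 67, 79, 89, 123, 138, 148, 149, 157, 179, 234, 248, 268, 346, 356, 457,
   459, 467, 569, 689], [4, 2, 1, 29, 78, 27, 58, 56, 25, 39], [6, 4, 7, 5, 1, 3, 0, 2, 9, 8],
   [(-2, -6, 2), (-1, -12, -12), (3, 12, 0), (1, 8, -8), (1, 12, -12), (-1, -8, -8), (2, 6, 2),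
   (-3, -12, 0), (-11, -1, 4), (11, 1, 4)]⟩,
   ⟨[12, 17, 28, 35, 38, 46, 47, 56, 124, 134, 138, 179, 189, 249, 278, 279, 346, 359, 369, 457,
   459, 568, 578, 689], [4, 24, 19, 8, 9, 23, 48, 67], [9, 7, 2, 5, 8, 3, 6, 1, 4, 0], [(10, -2,
   3), (5, -12, -12), (0, 0, -3), (-10, 9, 1), (-3, 9, -6), (10, -9, 1), (0, 0, 12), (-5, 12, -12),
   (3, -9, -6), (-10, 2, 3)]⟩,
   ⟨[12, 18, 24, 47, 79, 89, 127, 134, 138, 149, 179, 235, 238, 246, 256, 278, 346, 359, 369, 457,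
   459, 568, 578, 689], [4, 3, 5, 24, 29, 48, 67, 6], [6, 3, 9, 1, 8, 7, 0, 5, 4, 2], [(4, 0, 9),
   (15, -15, 12), (8, 12, 8), (-15, 15, 12), (-14, -9, 10), (2, -15, -8), (-4, 0, 9), (-2, 15, -8),
   (14, 9, 10), (-8, -12, 8)]⟩,
   ⟨[13, 14, 35, 47, 56, 67, 123, 125, 146, 157, 167, 234, 248, 259, 278, 279, 346, 359, 368, 389,
   479, 489, 568, 578], [4, 2, 18, 49, 8, 19, 45, 47, 9, 69], [9, 2, 1, 5, 7, 3, 8, 4, 6, 0], [(-1,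
   -1, -3), (-8, 12, 9), (8, -12, 9), (6, 12, 7), (3, -2, -5), (-6, -12, 7), (12, -5, -12), (-3, 2,
   -5), (-12, 5, -12), (1, 1, -3)]⟩,
   ⟨[12, 18, 23, 35, 56, 67, 78, 125, 134, 138, 149, 157, 179, 238, 256, 268, 346, 359, 369, 457,
   459, 467, 689, 789], [4, 24, 29, 48, 78, 9, 27, 58], [9, 1, 4, 5, 2, 3, 6, 8, 7, 0], [(4, 15,
   -7), (0, 0, -2), (7, -16, -5), (-27, 30, -14), (-7, 16, -5), (27, -30, -14), (0, 0, 29), (-5, 2,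
   11), (5, -2, 11), (-4, -15, -7)]⟩,
   ⟨[12, 18, 25, 45, 47, 68, 69, 79, 127, 136, 138, 146, 149, 179, 235, 238, 278, 347, 349, 357,
   369, 456, 568, 578], [4, 3, 24, 29, 48, 34, 59, 45, 67, 6, 89], [0, 7, 9, 3, 8, 6, 5, 1, 4, 2],
   [(0, 0, 9), (7, 12, 4), (0, 5, 1), (0, 0, -3), (-9, 0, -4), (-9, 11, -12), (9, -11, -12), (-7,
   -12, 4), (9, 0, -4), (0, -5, 1)]⟩,
   ⟨[12, 17, 28, 34, 35, 48, 56, 67, 129, 148, 149, 178, 236, 238, 256, 257, 279, 346, 359, 389,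
   457, 459, 467, 789], [69, 78, 9, 8, 24, 58, 68], [7, 6, 4, 9, 2, 8, 1, 0, 5, 3], [(41, 44, -17),
   (-43, 45, -45), (40, 37, 14), (21, 25, 30), (-40, -37, 14), (-42, -4, -4), (43, -45, -45), (-41,
   -44, -17), (42, 4, -4), (-21, -25, 30)]⟩,
   ⟨[12, 17, 28, 35, 38, 46, 47, 56, 129, 134, 138, 149, 178, 267, 268, 279, 346, 359, 369, 457,
   459, 567, 689, 789], [4, 24, 48, 67, 58, 78, 9, 8, 23], [9, 3, 5, 1, 8, 2, 7, 6, 4, 0], [(0, -6,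
   -1), (-10, 0, 12), (12, 12, -8), (10, 0, 12), (-1, 11, -2), (-12, -12, -8), (2, -3, -6), (-2, 3,
   -6), (1, -11, -2), (0, 6, -1)]⟩,
   ⟨[12, 18, 24, 36, 37, 46, 79, 89, 129, 147, 148, 157, 159, 248, 257, 258, 279, 345, 347, 359,
   369, 456, 568, 689], [46, 49, 45, 3, 5, 67, 78], [9, 2, 1, 6, 5, 4, 3, 8, 7, 0], [(-9, -6, -30),
   (-20, -12, -14), (20, 12, -14), (-30, -21, -29), (-4, -14, 26), (4, 14, 26), (30, 21, -29), (15,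
   -16, -20), (-15, 16, -20), (9, 6, -30)]⟩,
   ⟨[12, 16, 28, 34, 35, 48, 56, 124, 148, 167, 178, 249, 256, 257, 268, 279, 347, 359, 367, 368,
   389, 457, 459, 789], [46, 69, 78, 9, 8, 7, 24, 19, 58], [5, 9, 4, 6, 2, 0, 3, 8, 7, 1], [(2, 5,
   -2), (-11, -12, -4), (8, -1, -7), (5, 5, 1), (-8, 1, -7), (-2, -5, -2), (-5, -5, 1), (-3, -12,
   8), (3, 12, 8), (11, 12, -4)]⟩,
   ⟨[13, 18, 35, 45, 47, 79, 89, 123, 125, 147, 148, 156, 167, 234, 248, 259, 267, 268, 279, 346,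
   359, 369, 456, 689], [4, 2, 49, 19, 45, 67, 6, 58, 57, 78], [9, 2, 1, 5, 6, 3, 4, 8, 7, 0], [(2,
   -3, -6), (3, 13, -15), (-3, -13, -15), (-8, 13, -13), (-15, -12, 8), (8, -13, -13), (15, 12, 8),
   (11, 9, 0), (-11, -9, 0), (-2, 3, -6)]⟩,
   ⟨[12, 18, 26, 36, 37, 78, 129, 135, 139, 147, 148, 157, 246, 248, 257, 258, 279, 345, 347, 369,
   456, 568, 689, 789], [46, 49, 45, 3, 5, 4, 59, 67, 78, 9], [9, 2, 1, 6, 5, 4, 3, 8, 7, 0],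
   [(-30, 6, 5), (30, 30, -30), (-30, -30, -30), (8, -1, 8), (-12, 1, 11), (12, -1, 11), (-8, 1,
   8), (8, -11, 29), (-8, 11, 29), (30, -6, 5)]⟩,
   ⟨[14, 19, 23, 29, 35, 47, 56, 67, 146, 157, 159, 167, 234, 248, 278, 279, 346, 359, 368, 389,
   479, 489, 568, 578], [4, 18, 49, 8, 45, 47, 9, 12, 69], [9, 2, 1, 5, 7, 3, 8, 4, 6, 0], [(-1,
   -12, -15), (-4, 3, -10), (4, -3, -10), (1, 3, -13), (-7, -5, 3), (-1, -3, -13), (-1, -2, -4),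
   (7, 5, 3), (1, 2, -4), (1, 12, -15)]⟩,
   ⟨[13, 14, 35, 48, 56, 67, 79, 89, 128, 129, 138, 147, 157, 159, 256, 257, 268, 279, 346, 348,
   359, 369, 467, 689], [4, 2, 18, 24, 23, 49, 45, 78, 58], [9, 1, 4, 5, 2, 3, 6, 8, 7, 0], [(-13,
   15, 14), (0, 0, 2), (-7, 3, 3), (0, 2, -3), (7, -3, 3), (0, -2, -3), (0, 0, -8), (1, 15, 15),
   (-1, -15, 15), (13, -15, 14)]⟩,
   ⟨[12, 17, 23, 35, 46, 47, 56, 129, 158, 159, 178, 234, 248, 267, 268, 279, 346, 359, 369, 457,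
   458, 567, 689, 789], [4, 49, 67, 58, 14, 78, 9, 8], [9, 3, 5, 1, 8, 2, 7, 6, 4, 0], [(-6, 0, 2),
   (3, 8, 5), (8, -8, 4), (-3, -8, 5), (9, 15, -10), (-8, 8, 4), (-4, -11, 6), (4, 11, 6), (-9,
   -15, -10), (6, 0, 2)]⟩,
   ⟨[15, 18, 27, 29, 38, 39, 56, 67, 123, 129, 135, 148, 149, 234, 248, 278, 346, 359, 368, 469,
   568, 578, 579, 679], [4, 2, 3, 69, 79, 45, 47, 89], [3, 5, 6, 0, 7, 1, 2, 4, 9, 8], [(7, 13,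
   12), (12, 7, -9), (5, 6, 4), (-7, -13, 12), (8, 9, -15), (-12, -7, -9), (-5, -6, 4), (-8, -9,
   -15), (-8, 12, 6), (8, -12, 6)]⟩,
   ⟨[12, 14, 23, 35, 47, 58, 67, 68, 129, 146, 157, 159, 167, 234, 248, 278, 279, 346, 359, 369,
   479, 489, 578, 689], [4, 18, 49, 8, 45, 47, 9, 56], [9, 2, 1, 5, 7, 3, 8, 4, 6, 0], [(-8, 8,
   10), (-4, -10, 10), (4, 10, 10), (-3, 5, 9), (-10, -3, 4), (3, -5, 9), (-3, 0, 6), (10, 3, 4),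
   (3, 0, 6), (8, -8, 10)]⟩,
   ⟨[12, 17, 23, 35, 56, 67, 129, 148, 149, 178, 236, 246, 248, 258, 259, 347, 349, 357, 369, 467,
   568, 579, 689, 789], [4, 34, 59, 45, 78, 9, 8, 27], [1, 0, 7, 8, 5, 4, 9, 2, 3, 6], [(12, 11,
   -8), (-12, -11, -8), (-23, 24, 30), (-28, 10, -1), (23, -5, 9), (-23, 5, 9), (30, 20, -30), (23,
   -24, 30), (28, -10, -1), (-30, -20, -30)]⟩,
   ⟨[12, 17, 28, 46, 47, 56, 58, 124, 134, 138, 178, 249, 256, 257, 268, 279, 346, 358, 359, 369,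
   457, 459, 689, 789], [78, 9, 8, 24, 4, 19, 48, 58, 3, 67], [9, 3, 5, 1, 8, 2, 7, 6, 4, 0], [(13,
   15, -15), (-1, 12, 3), (-11, -2, -14), (1, -12, 3), (15, 10, -15), (11, 2, -14), (-7, 2, 15),
   (7, -2, 15), (-15, -10, -15), (-13, -15, -15)]⟩,
   ⟨[12, 17, 28, 34, 35, 48, 56, 67, 129, 145, 148, 159, 178, 256, 257, 268, 279, 346, 359, 368,
   389, 457, 467, 789], [49, 69, 78, 9, 8, 24, 58], [7, 6, 4, 9, 2, 8, 1, 0, 5, 3], [(-3, 5, 5),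
   (-14, 13, 15), (-1, -5, -5), (8, -4, 4), (1, 5, -5), (14, 1, -10), (14, -13, 15), (3, -5, 5),
   (-14, -1, -10), (-8, 4, 4)]⟩,
   ⟨[12, 16, 28, 34, 35, 48, 56, 129, 148, 149, 168, 236, 238, 256, 257, 279, 346, 359, 378, 379,
   457, 459, 467, 678], [69, 78, 9, 58, 68, 7, 8, 24, 89], [5, 9, 4, 6, 2, 0, 3, 8, 7, 1], [(-1, 4,
   12), (1, -2, 3), (1, -12, 4), (-11, 2, -4), (-1, 12, 4), (1, -4, 12), (11, -2, -4), (3, 1, -2),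
   (-3, -1, -2), (-1, 2, 3)]⟩,
   ⟨[14, 17, 23, 24, 35, 56, 67, 127, 129, 134, 138, 189, 238, 249, 257, 258, 346, 359, 369, 457,
   459, 467, 568, 689], [4, 24, 19, 8, 9, 12, 48, 78, 79], [9, 6, 5, 4, 3, 2, 1, 8, 7, 0], [(8, 3,
   6), (1, 0, 19), (11, 1, -12), (6, -8, 28), (-6, 8, 28), (-11, -1, -12), (-1, 0, 19), (-21, -7,
   -5), (21, 7, -5), (-8, -3, 6)]⟩,
   ⟨[12, 17, 28, 34, 35, 48, 56, 67, 129, 135, 139, 145, 148, 178, 256, 257, 268, 279, 346, 369,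
   457, 467, 689, 789], [49, 59, 78, 9, 8, 24, 58], [7, 6, 4, 9, 2, 8, 1, 0, 5, 3], [(15, -15,
   -10), (-3, -15, -2), (-10, 7, -4), (13, -15, -4), (10, -7, -4), (15, -10, 8), (3, 15, -2), (-15,
   15, -10), (-15, 10, 8), (-13, 15, -4)]⟩,
   ⟨[13, 18, 35, 46, 47, 56, 79, 89, 123, 129, 146, 149, 168, 236, 268, 278, 279, 358, 367, 378,
   457, 459, 567, 589], [4, 2, 34, 67, 58, 69, 39, 68, 24, 48], [8, 9, 4, 5, 2, 3, 7, 6, 0, 1],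
   [(-6, -8, -9), (0, -5, 9), (12, -15, 2), (-13, -15, -14), (-12, 15, 2), (13, 15, -14), (15, 13,
   -15), (-15, -13, -15), (6, 8, -9), (0, 5, 9)]⟩,
   ⟨[12, 17, 23, 35, 46, 47, 56, 125, 145, 148, 178, 234, 248, 259, 268, 269, 346, 359, 368, 389,
   457, 567, 679, 789], [4, 49, 19, 67, 58, 69, 78, 9, 8, 27], [3, 9, 5, 0, 6, 2, 4, 8, 7, 1],
   [(-10, 1, -3), (2, -7, -14), (-1, 0, -5), (10, -1, -3), (9, -11, 5), (1, 0, -5), (-9, 11, 5),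
   (3, -9, -13), (-3, 9, -13), (-2, 7, -14)]⟩,
   ⟨[12, 18, 23, 35, 56, 67, 78, 129, 135, 139, 145, 148, 234, 248, 257, 258, 279, 349, 457, 467,
   469, 568, 689, 789], [4, 49, 36, 59, 78, 9], [9, 7, 8, 6, 5, 4, 3, 1, 2, 0], [(-1, 0, 3), (0, 1,
   -7), (-5, -11, 12), (1, 2, 7), (-12, 11, -12), (12, -11, -12), (-1, -2, 7), (0, -1, -7), (5, 11,
   12), (1, 0, 3)]⟩,
   ⟨[12, 14, 23, 39, 47, 56, 59, 67, 129, 146, 157, 159, 167, 234, 248, 278, 279, 346, 368, 389,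
   479, 489, 568, 578], [4, 18, 49, 8, 45, 47, 9, 35, 69], [9, 2, 1, 5, 7, 3, 8, 4, 6, 0], [(-12,
   -9, 12), (3, -5, -6), (-3, 5, -6), (-12, 3, 12), (-5, 10, -11), (12, -3, 12), (11, -9, 0), (5,
   -10, -11), (-11, 9, 0), (12, 9, 12)]⟩,
   ⟨[12, 15, 26, 58, 67, 79, 89, 123, 138, 148, 149, 157, 179, 234, 248, 268, 346, 358, 359, 369,
   457, 459, 467, 689], [4, 2, 1, 29, 78, 27, 58, 3, 56, 25], [6, 4, 7, 5, 1, 3, 0, 2, 9, 8], [(4,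
   0, 4), (15, -14, -8), (-13, 2, 4), (-1, 0, 1), (-15, 14, -8), (1, 0, 1), (-4, 0, 4), (13, -2,
   4), (3, 15, 9), (-3, -15, 9)]⟩,
   ⟨[17, 18, 23, 27, 35, 56, 69, 89, 123, 128, 134, 149, 179, 257, 258, 346, 359, 368, 389, 457,
   459, 467, 568, 679], [4, 29, 69, 7, 12, 48, 24, 78], [9, 7, 4, 5, 2, 3, 8, 1, 6, 0], [(-5, -4,
   11), (0, -1, -1), (6, 14, -9), (8, -1, 8), (-6, -14, -9), (-8, 1, 8), (15, -3, 10), (0, 1, -1),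
   (-15, 3, 10), (5, 4, 11)]⟩,
   ⟨[12, 14, 23, 35, 48, 56, 69, 89, 129, 146, 157, 159, 167, 234, 248, 278, 279, 346, 359, 368,
   389, 568, 578, 679], [4, 18, 49, 45, 47, 69, 7], [9, 2, 1, 5, 7, 3, 8, 4, 6, 0], [(1, 13, 13),
   (-2, 2, -10), (2, -2, -10), (4, -1, 8), (5, -5, -15), (-4, 1, 8), (-14, 6, 6), (-5, 5, -15),
   (14, -6, 6), (-1, -13, 13)]⟩,
   ⟨[15, 17, 25, 28, 67, 68, 123, 124, 135, 148, 178, 238, 249, 257, 279, 346, 348, 359, 369, 457,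
   459, 467, 689, 789], [4, 2, 3, 24, 19, 78, 9, 8, 56, 58], [6, 9, 4, 5, 2, 3, 0, 8, 7, 1], [(1,
   -1, 6), (10, -10, -12), (-9, 2, -6), (4, 2, 1), (9, -2, -6), (-4, -2, 1), (-1, 1, 6), (-11, -12,
   -10), (11, 12, -10), (-10, 10, -12)]⟩,
   ⟨[15, 17, 25, 28, 67, 68, 123, 129, 135, 148, 149, 178, 238, 257, 279, 346, 348, 359, 369, 457,
   459, 467, 689, 789], [4, 2, 3, 24, 78, 9, 8, 56, 58], [6, 9, 4, 5, 2, 3, 0, 8, 7, 1], [(-1, 2,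
   6), (-11, -15, 12), (-7, 13, 10), (-12, 1, 9), (7, -13, 10), (12, -1, 9), (1, -2, 6), (-11, 15,
   -2), (11, -15, -2), (11, 15, 12)]⟩,
   ⟨[12, 18, 24, 36, 37, 46, 78, 129, 147, 148, 157, 159, 248, 257, 258, 279, 345, 347, 359, 369,
   456, 568, 689, 789], [46, 49, 45, 3, 5, 67, 78, 9], [9, 2, 1, 6, 5, 4, 3, 8, 7, 0], [(-14, 13,
   27), (-16, 12, 7), (16, -12, 7), (-30, 30, 25), (-2, 17, -22), (2, -17, -22), (30, -30, 25),
   (25, 28, 29), (-25, -28, 29), (14, -13, 27)]⟩,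
   ⟨[12, 18, 24, 34, 39, 67, 69, 78, 129, 147, 148, 157, 159, 248, 257, 258, 279, 346, 356, 358,
   389, 467, 569, 789], [49, 45, 69, 78, 9, 35, 5, 68], [9, 2, 1, 6, 5, 4, 3, 8, 7, 0], [(-12, 25,
   -1), (26, 13, 20), (-26, -13, 20), (-6, 13, 4), (21, 11, 18), (-21, -11, 18), (6, -13, 4), (-15,
   18, -2), (15, -18, -2), (12, -25, -1)]⟩,
   ⟨[12, 18, 23, 35, 56, 67, 78, 129, 135, 139, 147, 148, 157, 234, 248, 257, 258, 279, 349, 467,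
   469, 568, 689, 789], [4, 49, 36, 45, 59, 78, 9], [9, 7, 8, 6, 5, 4, 3, 1, 2, 0], [(0, 1, 6),
   (-9, -12, 2), (10, 9, 15), (5, 7, 4), (-14, 13, 9), (14, -13, 9), (-5, -7, 4), (9, 12, 2), (-10,
   -9, 15), (0, -1, 6)]⟩,
   ⟨[12, 18, 24, 36, 38, 46, 129, 147, 148, 157, 159, 248, 257, 258, 279, 345, 347, 359, 369, 378,
   456, 568, 678, 679], [46, 49, 45, 3, 5, 67, 78, 9, 7, 89], [9, 2, 1, 6, 5, 4, 3, 8, 7, 0], [(21,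
   -5, 3), (-19, -2, -1), (19, 2, -1), (-30, 13, -12), (-30, -15, 27), (30, 15, 27), (30, -13,
   -12), (15, -23, -18), (-15, 23, -18), (-21, 5, 3)]⟩,
   ⟨[12, 19, 23, 35, 58, 67, 68, 79, 124, 136, 138, 146, 189, 238, 247, 278, 359, 369, 456, 459,
   479, 567, 578, 689], [4, 24, 19, 8, 48, 34, 56, 47, 29], [9, 7, 4, 5, 2, 3, 8, 1, 6, 0], [(-5,
   -6, -8), (1, -13, -7), (-1, 1, 15), (3, -6, 7), (1, -1, 15), (-3, 6, 7), (-9, 12, 1), (-1, 13,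
   -7), (9, -12, 1), (5, 6, -8)]⟩,
   ⟨[12, 17, 28, 35, 38, 46, 47, 56, 124, 138, 139, 146, 169, 178, 249, 258, 259, 345, 349, 457,
   568, 579, 689, 789], [78, 9, 8, 24, 4, 19, 48, 34, 36, 59, 27, 67], [0, 5, 6, 7, 8, 1, 2, 3, 4,
   9], [(0, 0, -6), (-7, -8, 15), (0, 1, 4), (6, 0, -8), (13, -2, -15), (7, 8, 15), (0, -1, 4),
   (-6, 0, -8), (-13, 2, -15), (0, 0, 0)]⟩,
   ⟨[12, 18, 23, 35, 46, 47, 56, 78, 127, 148, 149, 179, 238, 267, 269, 289, 359, 368, 369, 457,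
   459, 468, 567, 789], [4, 24, 29, 67, 58, 78, 9, 68, 34], [9, 1, 4, 5, 2, 3, 6, 8, 7, 0], [(-6,
   -2, -6), (0, 0, -15), (-6, 13, 3), (0, 6, 15), (6, -13, 3), (0, -6, 15), (0, 0, 3), (-2, 15,
   -1), (2, -15, -1), (6, 2, -6)]⟩,
   ⟨[12, 18, 25, 46, 47, 56, 79, 89, 127, 148, 149, 179, 235, 238, 267, 269, 289, 345, 349, 368,
   369, 457, 468, 567], [4, 3, 24, 29, 67, 58, 78, 68, 34, 59], [9, 1, 4, 5, 2, 3, 6, 8, 7, 0],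
   [(1, 1, -2), (0, 0, -3), (6, -2, 5), (6, -12, 8), (-6, 2, 5), (-6, 12, 8), (0, 0, 2), (3, -5,
   3), (-3, 5, 3), (-1, -1, -2)]⟩,
   ⟨[12, 18, 25, 46, 47, 56, 79, 89, 127, 148, 149, 179, 236, 239, 258, 267, 289, 346, 348, 358,
   359, 457, 459, 567], [4, 3, 24, 29, 67, 58, 23, 78, 68, 69], [9, 1, 4, 6, 2, 5, 3, 8, 7, 0],
   [(9, -15, 11), (0, 0, -13), (-12, -15, 13), (13, -7, 15), (12, 15, 13), (0, 0, 13), (-13, 7,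
   15), (-10, 11, 11), (10, -11, 11), (-9, 15, 11)]⟩,
   ⟨[13, 14, 35, 48, 56, 67, 79, 89, 123, 129, 145, 159, 238, 256, 257, 268, 279, 346, 348, 359,
   369, 457, 467, 689], [4, 2, 18, 24, 49, 78, 58], [9, 1, 4, 5, 2, 3, 6, 8, 7, 0], [(-9, -5, -10),
   (0, 0, -8), (-12, -2, -9), (9, -2, -5), (12, 2, -9), (-9, 2, -5), (0, 0, 15), (15, -14, -13),
   (-15, 14, -13), (9, 5, -10)]⟩,
   ⟨[12, 17, 28, 35, 38, 46, 47, 56, 129, 148, 149, 178, 267, 268, 279, 346, 348, 359, 369, 457,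
   459, 567, 689, 789], [4, 24, 67, 58, 78, 9, 8, 23], [9, 3, 5, 1, 8, 2, 7, 6, 4, 0], [(-3, -2,
   1), (5, -3, 8), (13, 11, 3), (-5, 3, 8), (13, -3, 8), (-13, -11, 3), (4, 14, -9), (-4, -14, -9),
   (-13, 3, 8), (3, 2, 1)]⟩,
   ⟨[12, 17, 28, 34, 35, 48, 56, 67, 129, 148, 149, 178, 236, 238, 256, 257, 279, 346, 358, 457,
   459, 467, 589, 789], [69, 78, 9, 8, 24, 58, 39, 68], [5, 9, 4, 6, 2, 0, 3, 8, 7, 1], [(-5, 3,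
   -4), (-12, 4, -14), (-14, -3, 11), (-15, -11, 15), (14, 3, 11), (5, -3, -4), (15, 11, 15), (15,
   -6, -10), (-15, 6, -10), (12, -4, -14)]⟩,
   ⟨[12, 18, 25, 45, 47, 68, 69, 79, 127, 136, 138, 146, 149, 179, 235, 238, 278, 347, 349, 357,
   369, 458, 468, 578], [4, 3, 24, 29, 48, 34, 59, 45, 67, 6, 56, 89], [0, 7, 9, 3, 8, 6, 5, 1, 4,
   2], [(0, 0, -12), (3, 11, 12), (6, 1, 12), (0, 0, -1), (5, -12, -2), (2, -2, -4), (-2, 2, -4),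
   (-3, -11, 12), (-5, 12, -2), (-6, -1, 12)]⟩,
   ⟨[12, 18, 24, 34, 35, 56, 67, 78, 126, 148, 149, 156, 157, 179, 235, 236, 248, 259, 289, 347,
   367, 457, 459, 789], [29, 46, 78, 9, 27, 58, 25, 68, 69, 39], [5, 4, 7, 6, 1, 0, 3, 2, 9, 8],
   [(10, 8, -4), (1, 7, 10), (1, 6, 2), (-2, -7, -2), (-1, -7, 10), (-10, -8, -4), (2, 7, -2), (-1,
   -6, 2), (-4, 8, 3), (4, -8, 3)]⟩,
   ⟨[12, 18, 23, 35, 56, 67, 79, 89, 127, 148, 149, 179, 238, 257, 258, 347, 348, 359, 367, 369,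
   457, 459, 568, 689], [4, 24, 29, 46, 78], [9, 1, 4, 5, 2, 3, 6, 8, 7, 0], [(12, 14, 12), (0, 0,
   -10), (4, -1, -9), (-10, 1, -7), (-4, 1, -9), (10, -1, -7), (0, 0, 9), (-15, 3, -15), (15, -3,
   -15), (-12, -14, 12)]⟩,
   ⟨[13, 14, 24, 29, 35, 56, 67, 79, 123, 128, 149, 157, 158, 179, 234, 289, 346, 359, 368, 389,
   457, 459, 467, 568], [4, 2, 18, 29, 27, 48, 8, 69, 78], [9, 4, 7, 5, 1, 3, 8, 2, 6, 0], [(9,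
   -15, 12), (13, -13, 13), (-1, -8, 9), (14, -3, -5), (-13, 13, 13), (-14, 3, -5), (-4, 6, 10),
   (1, 8, 9), (4, -6, 10), (-9, 15, 12)]⟩,
   ⟨[12, 14, 23, 35, 49, 58, 67, 68, 79, 129, 146, 157, 159, 167, 234, 248, 278, 279, 346, 359,
   369, 489, 578, 689], [4, 18, 49, 8, 45, 47, 56], [9, 2, 1, 5, 7, 3, 8, 4, 6, 0], [(11, 3, -12),
   (3, 11, 10), (-3, -11, 10), (0, 1, -3), (-2, 7, -5), (0, -1, -3), (7, 1, -11), (2, -7, -5), (-7,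
   -1, -11), (-11, -3, -12)]⟩,
   ⟨[12, 18, 26, 67, 79, 89, 129, 147, 148, 157, 159, 246, 248, 278, 279, 345, 347, 359, 367, 368,
   389, 456, 568, 578], [46, 49, 45, 3, 5, 4, 69], [3, 4, 5, 0, 1, 2, 9, 8, 7, 6], [(4, 3, 9),
   (-10, 3, -6), (8, 2, 12), (-4, -3, 9), (10, -3, -6), (-8, -2, 12), (4, -11, 7), (-11, 15, 9),
   (11, -15, 9), (-4, 11, 7)]⟩,
   ⟨[15, 18, 27, 29, 56, 67, 89, 123, 129, 135, 148, 149, 234, 248, 278, 346, 359, 368, 389, 469,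
   568, 578, 579, 679], [4, 2, 3, 69, 79, 45, 47], [3, 5, 6, 0, 7, 1, 2, 4, 9, 8], [(-11, 11, 15),
   (-2, 15, -8), (-1, 7, 2), (11, -11, 15), (-5, 14, -15), (2, -15, -8), (1, -7, 2), (5, -14, -15),
   (-15, 9, 11), (15, -9, 11)]⟩,
   ⟨[12, 14, 25, 38, 39, 48, 56, 67, 79, 129, 146, 157, 159, 167, 245, 248, 278, 279, 345, 346,
   359, 368, 568, 578], [49, 45, 3, 4, 18, 47, 69, 89], [5, 8, 6, 9, 7, 0, 2, 4, 1, 3], [(-12, 0,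
   -15), (-4, 2, -9), (15, 14, -13), (10, -15, 7), (14, -15, 11), (12, 0, -15), (-15, -14, -13),
   (-14, 15, 11), (4, -2, -9), (-10, 15, 7)]⟩,
   ⟨[12, 18, 25, 46, 47, 56, 78, 126, 148, 149, 169, 234, 235, 248, 268, 346, 359, 368, 378, 379,
   457, 459, 567, 679], [4, 3, 67, 58, 69, 78, 9, 27, 29, 89], [3, 9, 5, 0, 6, 2, 4, 8, 7, 1], [(9,
   -11, 12), (0, -1, -3), (9, 6, 9), (-9, 11, 12), (12, -5, 11), (-9, -6, 9), (-12, 5, 11), (4, 0,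
   -12), (-4, 0, -12), (0, 1, -3)]⟩,
   ⟨[12, 16, 25, 56, 124, 134, 138, 167, 179, 189, 235, 238, 249, 278, 279, 346, 359, 369, 457,
   459, 467, 568, 578, 689], [4, 3, 24, 19, 8, 9, 7, 48], [0, 5, 6, 7, 8, 1, 2, 3, 4, 9], [(0, 0,
   15), (22, 28, 0), (13, -30, 18), (-26, 6, 19), (12, -12, 13), (-22, -28, 0), (-13, 30, 18), (26,
   -6, 19), (-12, 12, 13), (0, 0, -16)]⟩,
   ⟨[12, 19, 23, 35, 58, 67, 68, 79, 124, 148, 189, 238, 247, 256, 258, 267, 346, 348, 359, 369,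
   456, 459, 479, 689], [4, 24, 19, 8, 56, 47, 29, 78, 57], [9, 7, 4, 5, 2, 3, 8, 1, 6, 0], [(-33,
   58, 10), (-2, 6, -21), (27, 15, -45), (-42, -26, -53), (-27, -15, -45), (42, 26, -53), (-47, -3,
   19), (2, -6, -21), (47, 3, 19), (33, -58, 10)]⟩,
   ⟨[12, 18, 23, 35, 46, 47, 56, 79, 89, 127, 148, 149, 179, 238, 267, 269, 289, 359, 368, 369,
   457, 459, 468, 567], [4, 24, 29, 67, 58, 78, 68, 34], [9, 1, 4, 5, 2, 3, 6, 8, 7, 0], [(-4, -15,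
   0), (0, 0, -6), (-15, -8, 8), (-3, 2, 15), (15, 8, 8), (3, -2, 15), (0, 0, 9), (-9, 5, 6), (9,
   -5, 6), (4, 15, 0)]⟩,
   ⟨[13, 18, 27, 29, 35, 56, 67, 89, 123, 129, 146, 148, 169, 234, 248, 257, 258, 346, 359, 368,
   389, 568, 579, 679], [4, 2, 69, 78, 79, 45, 47, 49], [3, 5, 6, 0, 7, 1, 2, 4, 9, 8], [(-2, 14,
   -6), (-6, -9, 2), (-15, -4, -15), (2, -14, -6), (8, -2, -13), (6, 9, 2), (15, 4, -15), (-8, 2,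
   -13), (7, 11, 8), (-7, -11, 8)]⟩,
   ⟨[12, 19, 23, 35, 58, 67, 68, 79, 127, 136, 138, 146, 147, 189, 238, 278, 359, 369, 456, 459,
   479, 567, 578, 689], [4, 24, 19, 8, 48, 34, 56, 47, 29, 24], [9, 7, 4, 5, 2, 3, 8, 1, 6, 0],
   [(9, 14, 14), (5, 6, 8), (2, -3, -8), (-15, 7, -13), (-2, 3, -8), (15, -7, -13), (6, 14, 15),
   (-5, -6, 8), (-6, -14, 15), (-9, -14, 14)]⟩,
   ⟨[16, 17, 27, 29, 35, 38, 56, 89, 123, 129, 138, 146, 148, 179, 234, 248, 257, 258, 346, 359,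
   369, 568, 579, 689], [4, 2, 1, 78, 79, 45, 49, 47, 67], [8, 2, 1, 9, 7, 6, 5, 4, 0, 3], [(-7,
   15, -15), (14, -10, 15), (-14, 10, 15), (15, -2, 12), (2, -8, 10), (2, 0, -2), (-2, 0, -2), (-2,
   8, 10), (7, -15, -15), (-15, 2, 12)]⟩,
   ⟨[17, 18, 23, 27, 35, 56, 69, 89, 123, 128, 136, 146, 149, 179, 278, 359, 368, 389, 457, 459,
   467, 568, 578, 679], [4, 29, 69, 7, 12, 48, 24, 34], [9, 7, 4, 5, 2, 3, 8, 1, 6, 0], [(-19, -5,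
   23), (8, -1, 8), (-29, 3, -2), (30, 6, 21), (29, -3, -2), (-30, -6, 21), (30, 25, 28), (-8, 1,
   8), (-30, -25, 28), (19, 5, 23)]⟩,
   ⟨[12, 18, 24, 47, 79, 89, 129, 134, 138, 149, 235, 238, 246, 256, 278, 279, 346, 359, 369, 457,
   459, 568, 578, 689], [4, 3, 5, 24, 48, 67, 6], [0, 7, 9, 5, 8, 3, 6, 1, 4, 2], [(0, 0, -12),
   (15, 1, 1), (15, -11, 7), (6, 9, -4), (-12, -15, -6), (-6, -9, -4), (0, 0, -7), (-15, -1, 1),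
   (12, 15, -6), (-15, 11, 7)]⟩,
   ⟨[12, 19, 28, 35, 38, 46, 47, 56, 79, 124, 134, 138, 189, 249, 278, 279, 346, 359, 369, 457,
   459, 568, 578, 689], [4, 24, 19, 8, 23, 48, 67], [9, 7, 2, 5, 8, 3, 6, 1, 4, 0], [(1, -5, 2),
   (10, 8, 4), (0, 0, -15), (-10, -12, 15), (4, 8, 4), (10, 12, 15), (0, 0, 5), (-10, -8, 4), (-4,
   -8, 4), (-1, 5, 2)]⟩,
   ⟨[12, 18, 24, 47, 79, 89, 127, 148, 149, 179, 235, 238, 246, 256, 278, 346, 348, 359, 369, 457,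
   459, 568, 578, 689], [4, 3, 5, 24, 29, 67, 6], [6, 3, 9, 1, 8, 7, 0, 5, 4, 2], [(-6, 2, 3),
   (-12, 2, 1), (10, -8, 4), (12, -2, 1), (-7, 12, 12), (-12, 6, -10), (6, -2, 3), (12, -6, -10),
   (7, -12, 12), (-10, 8, 4)]⟩,
   ⟨[12, 18, 24, 45, 56, 67, 79, 89, 129, 147, 148, 157, 159, 248, 257, 258, 279, 347, 349, 367,
   368, 389, 459, 568], [46, 49, 45, 3, 35, 69, 78], [9, 2, 1, 6, 5, 4, 3, 8, 7, 0], [(-1, 30, 15),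
   (-23, 16, 29), (23, -16, 29), (-10, -17, -12), (27, 30, -25), (-27, -30, -25), (10, 17, -12),
   (1, 9, -10), (-1, -9, -10), (1, -30, 15)]⟩,
   ⟨[12, 18, 23, 35, 46, 49, 56, 89, 124, 134, 138, 238, 245, 259, 278, 279, 346, 359, 369, 457,
   479, 568, 578, 689], [4, 24, 19, 48, 49, 67, 7], [9, 7, 2, 5, 8, 3, 6, 1, 4, 0], [(-8, 11, 10),
   (2, -2, 4), (0, 0, 2), (1, 0, -8), (8, -2, 15), (-1, 0, -8), (0, 0, -15), (-2, 2, 4), (-8, 2,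
   15), (8, -11, 10)]⟩,
   ⟨[13, 14, 35, 48, 56, 67, 79, 89, 123, 129, 145, 159, 238, 257, 258, 279, 347, 348, 359, 367,
   369, 457, 568, 689], [4, 2, 18, 24, 46, 49, 78], [9, 1, 4, 5, 2, 3, 6, 8, 7, 0], [(-8, -15, 15),
   (0, 0, 9), (10, -7, 11), (-6, 3, 7), (-10, 7, 11), (6, -3, 7), (0, 0, -8), (-15, 0, 13), (15, 0,
   13), (8, 15, 15)]⟩,
   ⟨[12, 17, 28, 34, 35, 48, 56, 67, 129, 148, 149, 178, 256, 257, 268, 279, 347, 358, 367, 368,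
   457, 459, 589, 789], [46, 69, 78, 9, 8, 24, 58, 39], [5, 9, 4, 6, 2, 0, 3, 8, 7, 1], [(-13, -8,
   -15), (-6, 12, 3), (-12, 0, 15), (3, 0, -14), (12, 0, 15), (13, 8, -15), (-3, 0, -14), (2, -1,
   -1), (-2, 1, -1), (6, -12, 3)]⟩,
   ⟨[12, 18, 24, 34, 35, 56, 67, 78, 123, 136, 148, 149, 156, 157, 179, 235, 248, 259, 289, 346,
   457, 459, 467, 789], [29, 78, 9, 27, 58, 25, 68, 69, 26, 39], [5, 4, 7, 6, 1, 0, 3, 2, 9, 8],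
   [(-17, -20, -30), (28, -19, 22), (-1, -2, 0), (3, 5, -17), (-28, 19, 22), (17, 20, -30), (-3,
   -5, -17), (1, 2, 0), (30, -7, 1), (-30, 7, 1)]⟩,
   ⟨[12, 18, 23, 35, 56, 67, 78, 127, 148, 149, 179, 238, 257, 258, 347, 348, 359, 367, 369, 457,
   459, 568, 689, 789], [4, 24, 29, 46, 78, 9], [9, 1, 4, 5, 2, 3, 6, 8, 7, 0], [(11, 6, 7), (0, 0,
   5), (-4, -12, 5), (-5, 10, 9), (4, 12, 5), (5, -10, 9), (0, 0, -12), (3, 12, -5), (-3, -12, -5),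
   (-11, -6, 7)]⟩,
   ⟨[12, 18, 24, 46, 67, 79, 89, 129, 135, 139, 147, 148, 157, 248, 278, 279, 345, 347, 367, 368,
   389, 456, 568, 578], [46, 49, 45, 3, 5, 59, 69], [3, 4, 5, 0, 1, 2, 9, 8, 7, 6], [(13, 9, 8),
   (15, 9, 1), (-13, -10, 12), (-13, -9, 8), (-15, -9, 1), (13, 10, 12), (-1, 2, 11), (-6, 8, 15),
   (6, -8, 15), (1, -2, 11)]⟩,
   ⟨[12, 14, 23, 35, 49, 58, 67, 68, 79, 129, 146, 156, 159, 238, 278, 279, 346, 348, 359, 369,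
   489, 567, 578, 689], [4, 18, 24, 49, 8, 56, 47, 45], [9, 2, 1, 5, 7, 3, 8, 4, 6, 0], [(-10, 12,
   5), (-1, 2, 2), (1, -2, 2), (0, 3, -4), (-2, 10, -2), (0, -3, -4), (-4, -8, -10), (2, -10, -2),
   (4, 8, -10), (10, -12, 5)]⟩,
   ⟨[13, 18, 27, 29, 35, 56, 67, 89, 123, 129, 148, 149, 234, 248, 278, 346, 359, 368, 389, 469,
   568, 578, 579, 679], [4, 2, 69, 79, 45, 47], [3, 5, 6, 0, 7, 1, 2, 4, 9, 8], [(9, 10, -5), (-15,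
   -3, 2), (-13, 2, -10), (-9, -10, -5), (2, -4, -7), (15, 3, 2), (13, -2, -10), (-2, 4, -7), (15,
   6, 11), (-15, -6, 11)]⟩,
   ⟨[12, 18, 24, 34, 35, 56, 69, 89, 129, 146, 148, 167, 179, 248, 267, 269, 278, 346, 359, 368,
   389, 568, 578, 579], [69, 7, 79, 45, 49, 47], [9, 2, 1, 5, 7, 3, 8, 4, 6, 0], [(30, -14, 26),
   (24, -14, 22), (-24, 14, 22), (-16, 3, 3), (-1, -9, 11), (16, -3, 3), (27, 29, -28), (1, 9, 11),
   (-27, -29, -28), (-30, 14, 26)]⟩,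
   ⟨[14, 17, 27, 29, 35, 38, 46, 56, 89, 123, 129, 138, 148, 179, 234, 248, 278, 346, 359, 369,
   568, 578, 579, 689], [4, 2, 1, 67, 79, 45, 49, 47], [8, 2, 1, 9, 7, 6, 5, 4, 0, 3], [(-18, 12,
   29), (20, 23, -14), (-20, -23, -14), (-1, 30, 2), (20, 4, -4), (-6, 13, 19), (6, -13, 19), (-20,
   -4, -4), (18, -12, 29), (1, -30, 2)]⟩,
   ⟨[12, 18, 23, 35, 46, 47, 56, 78, 126, 148, 149, 169, 234, 248, 268, 346, 359, 368, 378, 379,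
   457, 459, 567, 679], [4, 67, 58, 69, 78, 9, 27, 29, 89], [3, 9, 5, 0, 6, 2, 4, 8, 7, 1], [(10,
   -12, 4), (2, -12, -12), (-2, 1, -1), (-10, 12, 4), (-4, -13, 8), (2, -1, -1), (4, 13, 8), (3,
   -15, -15), (-3, 15, -15), (-2, 12, -12)]⟩,
   ⟨[12, 18, 23, 35, 56, 69, 89, 129, 146, 148, 157, 159, 167, 234, 248, 267, 269, 278, 346, 359,
   368, 389, 568, 578], [4, 49, 45, 47, 69, 7, 79], [9, 2, 1, 5, 7, 3, 8, 4, 6, 0], [(24, 30, -24),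
   (-8, -14, -2), (8, 14, -2), (19, -23, 15), (-24, 23, 10), (-19, 23, 15), (-9, 0, 4), (24, -23,
   10), (9, 0, 4), (-24, -30, -24)]⟩,
   ⟨[14, 17, 27, 29, 35, 38, 46, 56, 89, 123, 129, 138, 148, 157, 159, 236, 246, 248, 278, 359,
   369, 568, 578, 689], [4, 2, 1, 34, 49, 45, 67, 47, 79], [8, 2, 1, 9, 7, 6, 5, 4, 0, 3], [(24, 7,
   30), (-15, -10, 5), (15, 10, 5), (-20, -26, 23), (-20, -16, 26), (8, 0, 29), (-8, 0, 29), (20,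
   16, 26), (-24, -7, 30), (20, 26, 23)]⟩,
   ⟨[12, 14, 23, 39, 47, 58, 59, 67, 68, 129, 146, 157, 159, 167, 234, 248, 278, 279, 346, 369,
   479, 489, 578, 689], [4, 18, 49, 8, 45, 47, 9, 35, 56], [9, 2, 1, 5, 7, 3, 8, 4, 6, 0], [(-1, 9,
   -4), (-1, 0, 8), (1, 0, 8), (-6, 2, 2), (15, -3, 14), (6, -2, 2), (-7, -8, -6), (-15, 3, 14),
   (7, 8, -6), (1, -9, -4)]⟩,
   ⟨[12, 18, 24, 34, 35, 56, 69, 89, 123, 136, 148, 149, 156, 157, 179, 238, 248, 346, 358, 457,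
   459, 467, 589, 679], [29, 69, 7, 78, 27, 58, 25, 39, 68, 26], [5, 4, 7, 6, 1, 0, 3, 2, 9, 8],
   [(-3, 5, 0), (-9, -10, 15), (-20, 26, -27), (6, -5, -12), (9, 10, 15), (3, -5, 0), (-6, 5, -12),
   (20, -26, -27), (13, -1, 2), (-13, 1, 2)]⟩,
   ⟨[12, 16, 28, 34, 35, 48, 56, 124, 148, 168, 236, 238, 249, 256, 257, 279, 346, 359, 378, 379,
   457, 459, 467, 678], [69, 78, 9, 58, 68, 7, 8, 24, 19, 89], [5, 9, 4, 6, 2, 0, 3, 8, 7, 1], [(0,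
   -2, 7), (3, -5, -4), (-4, 8, -1), (-5, -5, 9), (4, -8, -1), (0, 2, 7), (5, 5, 9), (7, -10, -9),
   (-7, 10, -9), (-3, 5, -4)]⟩,
   ⟨[15, 18, 25, 26, 67, 79, 89, 123, 129, 135, 146, 148, 169, 234, 248, 257, 268, 279, 346, 359,
   368, 389, 567, 569], [4, 2, 3, 69, 78, 58, 56, 47, 45, 49], [8, 9, 6, 5, 7, 3, 2, 4, 0, 1],
   [(16, 30, 14), (0, 2, 15), (20, -30, 30), (8, -13, 27), (24, 2, -10), (-8, 13, 27), (-20, 30,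
   30), (-24, -2, -10), (-16, -30, 14), (0, -2, 15)]⟩,
   ⟨[13, 18, 25, 26, 35, 67, 79, 89, 123, 129, 146, 148, 169, 234, 248, 257, 268, 279, 346, 358,
   368, 567, 569, 589], [4, 2, 69, 78, 58, 39, 56, 47, 45, 49], [8, 9, 6, 5, 7, 3, 2, 4, 0, 1],
   [(-29, 11, -29), (-1, 1, -23), (7, 28, -30), (9, -30, 1), (25, -8, -27), (-9, 30, 1), (-7, -28,
   -30), (-25, 8, -27), (29, -11, -29), (1, -1, -23)]⟩,
   ⟨[12, 18, 24, 45, 56, 67, 78, 129, 147, 148, 157, 159, 248, 257, 258, 279, 347, 349, 367, 368,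
   389, 459, 568, 789], [46, 49, 45, 3, 35, 69, 78, 9], [9, 2, 1, 6, 5, 4, 3, 8, 7, 0], [(-60, -45,
   -31), (39, -57, -1), (-39, 57, -1), (5, -24, 24), (-45, 23, 60), (45, -23, 60), (-5, 24, 24),
   (-3, 14, 14), (3, -14, 14), (60, 45, -31)]⟩,
   ⟨[12, 18, 24, 45, 56, 67, 79, 89, 129, 147, 148, 157, 159, 248, 257, 258, 279, 346, 349, 356,
   358, 389, 459, 467], [49, 45, 3, 35, 69, 68, 78], [9, 2, 1, 6, 5, 4, 3, 8, 7, 0], [(-53, -60,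
   19), (60, 15, 47), (-60, -15, 47), (-8, -4, 2), (-26, -12, -60), (26, 12, -60), (8, 4, 2), (10,
   13, 15), (-10, -13, 15), (53, 60, 19)]⟩,
   ⟨[12, 18, 25, 46, 47, 56, 79, 89, 127, 148, 149, 179, 234, 238, 245, 267, 269, 289, 349, 368,
   369, 457, 468, 567], [4, 3, 24, 29, 67, 58, 78, 68, 34, 59, 35], [9, 1, 4, 5, 2, 3, 6, 8, 7, 0],
   [(4, 2, 1), (0, 0, -12), (9, 1, 11), (-9, -4, 11), (-9, -1, 11), (9, 4, 11), (0, 0, 4), (-4, -7,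
   4), (4, 7, 4), (-4, -2, 1)]⟩,
   ⟨[12, 18, 25, 46, 47, 56, 79, 89, 127, 148, 149, 179, 234, 239, 246, 258, 267, 289, 348, 358,
   359, 457, 459, 567], [4, 3, 24, 29, 67, 58, 23, 78, 68, 69, 36], [9, 1, 4, 6, 2, 5, 3, 8, 7, 0],
   [(-2, 11, 5), (0, 0, -3), (12, 12, 10), (-9, 5, 12), (-12, -12, 10), (0, 0, 7), (9, -5, 12), (8,
   -5, 3), (-8, 5, 3), (2, -11, 5)]⟩,
   ⟨[12, 18, 23, 35, 46, 48, 56, 124, 134, 138, 238, 245, 259, 278, 279, 346, 359, 369, 457, 479,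
   489, 568, 578, 689], [4, 24, 19, 48, 49, 67, 7, 9], [9, 7, 2, 5, 8, 3, 6, 1, 4, 0], [(-9, -15,
   10), (7, 11, 9), (0, 0, 7), (4, -1, 4), (13, 0, 12), (-4, 1, 4), (0, 0, -15), (-7, -11, 9),
   (-13, 0, 12), (9, 15, 10)]⟩,
   ⟨[12, 18, 23, 35, 56, 67, 79, 89, 125, 134, 138, 149, 157, 179, 238, 258, 347, 359, 367, 369,
   457, 459, 568, 689], [4, 24, 29, 46, 48, 78, 27], [9, 1, 4, 5, 2, 3, 6, 8, 7, 0], [(34, -60,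
   54), (0, 0, -16), (-15, -7, -31), (57, 37, -52), (15, 7, -31), (-57, -37, -52), (0, 0, 56), (4,
   3, 4), (-4, -3, 4), (-34, 60, 54)]⟩,
   ⟨[12, 14, 23, 35, 48, 56, 69, 89, 129, 146, 158, 159, 167, 178, 236, 246, 248, 278, 279, 359,
   368, 389, 568, 679], [4, 18, 34, 49, 45, 47, 57, 69, 7], [9, 2, 1, 5, 7, 3, 8, 4, 6, 0], [(-12,
   10, 15), (1, 1, 6), (-1, -1, 6), (-3, -4, -15), (13, -9, 12), (3, 4, -15), (4, 6, 3), (-13, 9,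
   12), (-4, -6, 3), (12, -10, 15)]⟩,
   ⟨[12, 17, 28, 34, 35, 48, 56, 67, 124, 148, 178, 249, 256, 257, 268, 279, 347, 358, 367, 368,
   457, 459, 589, 789], [46, 69, 78, 9, 8, 24, 19, 58, 39], [5, 9, 4, 6, 2, 0, 3, 8, 7, 1], [(4, 8,
   4), (-12, 1, 5), (-5, 12, 12), (5, 12, -8), (5, -12, 12), (-4, -8, 4), (-5, -12, -8), (3, -4,
   6), (-3, 4, 6), (12, -1, 5)]⟩,
   ⟨[12, 17, 28, 34, 35, 48, 56, 67, 124, 148, 178, 236, 238, 249, 256, 257, 279, 346, 358, 457,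
   459, 467, 589, 789], [69, 78, 9, 8, 24, 19, 58, 39, 68], [5, 9, 4, 6, 2, 0, 3, 8, 7, 1], [(-2,
   12, 0), (15, -8, 0), (15, 12, 15), (0, 3, -4), (-15, -12, 15), (2, -12, 0), (0, -3, -4), (-3,
   -2, 2), (3, 2, 2), (-15, 8, 0)]⟩,
   ⟨[15, 17, 36, 37, 56, 123, 129, 135, 148, 149, 178, 238, 257, 258, 279, 347, 348, 359, 369, 457,
   459, 568, 689, 789], [4, 2, 3, 24, 46, 67, 78, 9, 8], [6, 9, 4, 5, 2, 3, 0, 8, 7, 1], [(-5, -8,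
   25), (-25, 30, 30), (26, 30, 27), (14, 22, -6), (-26, -30, 27), (-14, -22, -6), (5, 8, 25), (4,
   -1, 28), (-4, 1, 28), (25, -30, 30)]⟩,
   ⟨[16, 18, 27, 29, 67, 89, 126, 129, 148, 149, 234, 235, 248, 256, 278, 346, 359, 368, 389, 469,
   568, 578, 579, 679], [4, 3, 5, 2, 69, 79, 45, 47], [1, 0, 9, 5, 7, 3, 8, 4, 6, 2], [(-3, -4,
   -12), (3, 4, -12), (9, 15, -13), (-13, 12, 13), (3, 2, 4), (13, -12, 13), (-1, -1, -2), (-3, -2,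
   4), (1, 1, -2), (-9, -15, -13)]⟩,
   ⟨[12, 18, 25, 56, 69, 89, 129, 135, 139, 146, 148, 157, 167, 234, 235, 248, 267, 269, 278, 346,
   368, 389, 568, 578], [4, 3, 49, 45, 47, 59, 69, 7, 79], [9, 2, 1, 5, 7, 3, 8, 4, 6, 0], [(-5,
   -4, -15), (3, 3, -1), (-3, -3, -1), (-1, 13, 10), (3, -15, 0), (1, -13, 10), (2, -9, 0), (-3,
   15, 0), (-2, 9, 0), (5, 4, -15)]⟩,
   ⟨[12, 18, 24, 45, 56, 67, 79, 89, 129, 147, 148, 157, 159, 248, 257, 258, 279, 347, 349, 378,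
   389, 459, 568, 678], [46, 49, 45, 3, 35, 69, 78, 36], [9, 2, 1, 6, 5, 4, 3, 8, 7, 0], [(-12,
   -20, 14), (0, -24, 23), (0, 24, 23), (1, -3, -1), (-15, -3, -5), (15, 3, -5), (-1, 3, -1), (-2,
   -3, 3), (2, 3, 3), (12, 20, 14)]⟩,
   ⟨[13, 14, 35, 48, 56, 69, 89, 123, 128, 149, 157, 158, 167, 169, 234, 248, 346, 359, 368, 389,
   457, 459, 467, 568], [4, 2, 18, 29, 27, 69, 7, 78, 79], [9, 4, 7, 5, 1, 3, 8, 2, 6, 0], [(-14,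
   4, 0), (-27, 8, 4), (4, 29, -25), (28, -29, -5), (27, -8, 4), (-28, 29, -5), (19, 0, 30), (-4,
   -29, -25), (-19, 0, 30), (14, -4, 0)]⟩]

/-- Whether every vertex lies in a facet. -/
def coverOk (n : ℕ) (L : List ℕ) : Bool := (List.range n).all fun v => L.any fun m => m.testBit v

theorem movesTo_baseFacets : movesTo 34 (baseMoves.map fun l => (l.map (2 ^ ·)).foldl (· ||| ·) 0)
    octagonFacets baseFacets := by
  decide +kernel

theorem movesTo_masks : realizedTriangulations.all fun r =>
    movesTo 10 (r.flips.map digitMask₂) baseFacets r.masks := by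
  decide +kernel

theorem trianglesOk_masks : realizedTriangulations.all fun r => trianglesOk 10 r.masks := by
  decide +kernel

theorem coverOk_masks : realizedTriangulations.all fun r => coverOk 10 r.masks := by
  decide +kernel

theorem symmetryOk_masks : realizedTriangulations.all fun r =>
    symmetryOk 10 r.symmetry r.coords r.masks := by
  decide +kernel

theorem immersionOk_masks : realizedTriangulations.all fun r =>
    immersionOk 10 r.symmetry r.coords (r.masks.map (maskList 10)) := by
  decide +kernel

/-- Since the list is sorted by the invariant, comparing neighbours replaces comparing all pairs.
Three refinements separate all entries. -/
theorem isChain_colourInvariantList : List.IsChain (· < ·) (realizedTriangulations.map fun r =>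
    colourInvariantList 10 3 (r.masks.map (maskList 10))) := by
  decide +kernel

theorem length_realizedTriangulations : realizedTriangulations.length = 112 := by
  decide +kernel

theorem exists_mem_maskFacets {n : ℕ} {L : List ℕ} (h : coverOk n L) (v : Fin n) :
    ∃ t ∈ maskFacets n L, v ∈ t := by
  simp only [coverOk, List.all_eq_true, List.any_eq_true, List.mem_range] at h
  obtain ⟨m, hm, hv⟩ := h v v.2
  exact ⟨_, ⟨m, hm, rfl⟩, by simpa using hv⟩

theorem isTriangulationOf_masks {r : RealizedTriangulation} (hr : r ∈ realizedTriangulations)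
    (h : ∀ v, ∃ t ∈ maskFacets 10 r.masks, v ∈ t) :
    IsTriangulationOf (facetComplex (maskFacets 10 r.masks) h) (NonorientableSurface 4) := by
  have htri := List.all_eq_true.1 trianglesOk_masks r hr
  have hmem := mem_facetComplex_card_three htri h
  have hcard : ∀ m ∈ r.masks, (maskFinset 10 m).card = 3 := fun m hm => ((hmem _).2 ⟨m, hm, rfl⟩).2
  refine ⟨?_, ?_, ?_⟩
  · rintro s ⟨-, _, ⟨m, hm, rfl⟩, hsm⟩
    exact (Finset.card_le_card (Finset.coe_subset.1 hsm)).trans (hcard m hm).le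
  · obtain ⟨_, ⟨m, hm, rfl⟩, -⟩ := h 0
    exact ⟨_, (hmem _).2 ⟨m, hm, rfl⟩⟩
  · rw [geomRealization_facetComplex]
    obtain ⟨e⟩ := nonempty_homeomorph_octagonFacets
    obtain ⟨e₁⟩ := nonempty_homeomorph_of_movesTo movesTo_baseFacets
    obtain ⟨e₂⟩ := nonempty_homeomorph_maskFacets_of_le (k := 10) (n := 34) (by norm_num)
      (L := baseFacets) (by decide +kernel)
    obtain ⟨e₃⟩ := nonempty_homeomorph_of_movesTo (List.all_eq_true.1 movesTo_masks r hr)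
    -- Back along the flips to `baseFacets`, from ten to 34 coordinates, and back along the
    -- reduction to the octagon.
    exact ⟨e₃.symm.trans (e₂.symm.trans (e₁.symm.trans e))⟩

/-- The `i`-th triangulation of the list. -/
def realizedTriangulation (i : Fin 112) : RealizedTriangulation :=
  realizedTriangulations.get (i.cast length_realizedTriangulations.symm)

theorem realizedTriangulation_mem (i : Fin 112) :
    realizedTriangulation i ∈ realizedTriangulations := List.get_mem _ _

theorem exists_mem_maskFacets_masks (i : Fin 112) (v : Fin 10) :
    ∃ t ∈ maskFacets 10 (realizedTriangulation i).masks, v ∈ t :=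
  exists_mem_maskFacets (List.all_eq_true.1 coverOk_masks _ (realizedTriangulation_mem i)) v

theorem strictMono_colourInvariantList : StrictMono fun i : Fin 112 =>
    colourInvariantList 10 3 ((realizedTriangulation i).masks.map (maskList 10)) := by
  intro i j hij
  have h := List.pairwise_iff_get.1 isChain_colourInvariantList.pairwise
    (i.cast (by simp [length_realizedTriangulations]))
    (j.cast (by simp [length_realizedTriangulations])) hij
  simpa [realizedTriangulation] using h

end Data

/-! ### Assembly of the result. -/

theorem theorem5 :
    ∃ Δ : Fin 112 → AbstractSimplicialComplex (Fin 10),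
      (∀ i, IsTriangulationOf (Δ i) (NonorientableSurface 4)) ∧
      (∀ i j, i ≠ j → ¬ Isomorphic (Δ i) (Δ j)) ∧
      ∀ i, ∃ ψ : Fin 10 → Space3,
        (∀ v c, ∃ n : ℤ, ψ v c = n) ∧
        IsPolyhedralImmersion (Δ i) ψ ∧
        ∃ R : Space3 ≃ᵃⁱ[ℝ] Space3, IsTwofoldRotation R ∧ IsGeometricSymmetry (Δ i) ψ R := by
  refine ⟨fun i => facetComplex (maskFacets 10 (realizedTriangulation i).masks)
    (exists_mem_maskFacets_masks i),
    fun i => isTriangulationOf_masks (realizedTriangulation_mem i) _,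
    fun i j hij hiso => hij ?_, fun i => ?_⟩
  · have h := colourInvariant_eq hiso 3
    rw [colourInvariant_facetComplex
        (List.all_eq_true.1 trianglesOk_masks _ (realizedTriangulation_mem i)),
      colourInvariant_facetComplex
        (List.all_eq_true.1 trianglesOk_masks _ (realizedTriangulation_mem j))] at h
    exact strictMono_colourInvariantList.injective h
  · have hmem := realizedTriangulation_mem i
    have hsymm := List.all_eq_true.1 symmetryOk_masks _ hmem
    refine ⟨listPoint (realizedTriangulation i).coords, fun v c => ?_,
      isPolyhedralImmersion_of_immersionOk _ hsymm
        (List.all_eq_true.1 immersionOk_masks _ hmem), axisRotation,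
      isTwofoldRotation_axisRotation, isGeometricSymmetry_of_symmetryOk _ hsymm⟩
    fin_cases c
    exacts [⟨_, rfl⟩, ⟨_, rfl⟩, ⟨_, rfl⟩]
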